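/- Let $R_0$ be a finite, crystallographic, reduced, irreducible root system with Weyl group $W_0$, base $\alpha_1,\dots,\alpha_n$, positive roots $R_0^+$, highest root $\varphi$, simple reflections $s_1,\dots,s_n$ and length function $l(w)=\#(R_0^+\cap w^{-1}R_0^-)$. Let $P^\vee$ be the coweight lattice and let $W=W_0\ltimes P^\vee$ be the extended affine Weyl group, acting on the twisted affine root system $R=\{a^\vee : a\in\mathbb Zc+R_0\}$ (translations act by $\tau(\lambda)(\alpha+rc)=\alpha+(r-\langle\lambda,\alpha\rangle)c$), with simple affine roots $a_0=(c-\varphi)^\vee$, $a_i=\alpha_i^\vee$ $(1\le i\le n)$, corresponding simple reflections $s_0,\dots,s_n$, the associated length function $l$ on $W$, and $\Omega=\{w\in W: l(w)=0\}$. Let $k:R\to\mathbb C^\times$ be a $W$-invariant function and put $k_j=k_{a_j}$. The extended affine Hecke algebra $H(k)=H^a(k)\#\Omega$ is the unital complex algebra generated by $T_0,\dots,T_n$ and $\Omega$, with the braid relations of the $s_j$, the relations $(T_j-k_j)(T_j+k_j^{-1})=0$, the multiplication of $\Omega$, and $\omega T_j=T_{\omega(j)}\omega$ where $\omega(a_j)=a_{\omega(j)}$.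 For a reduced expression $w=s_{i_1}\cdots s_{i_r}\omega\in W$ ($r=l(w)$, $\omega\in\Omega$) put $T_w=T_{i_1}\cdots T_{i_r}\omega$. Let $\lambda\mapsto Y^\lambda$ be the unique group homomorphism $P^\vee\to H(k)^\times$ with $Y^\lambda=T_{\tau(\lambda)}$ for dominant $\lambda$. Let $\epsilon_\pm:H(k)\to\mathbb C$ be the characters with $\epsilon_\pm(T_j)=\pm k_j^{\pm1}$ and $\epsilon_\pm(\omega)=1$. For $1\le i\le n$ put $I_i(k)=T_i(1-Y^{\alpha_i^\vee})+(k_i-k_i^{-1})Y^{\alpha_i^\vee}$, and for a reduced expression $w=s_{i_1}\cdots s_{i_r}\in W_0$ put $I_w(k)=I_{i_1}(k)\cdots I_{i_r}(k)$ (this does not depend on the reduced expression). Fix $I\subseteq\{1,\dots,n\}$. Let $R_0^{I,+}=R_0^+\cap\mathrm{span}_{\mathbb Z}\{\alpha_i\}_{i\in I}$ and $W_0^I=\{w\in W_0: l(ws_i)>l(w)\ \forall i\in I\}$, and let $H_I(k)\subseteq H(k)$ be the subalgebra generated by all $Y^\lambda$ $(\lambda\in P^\vee)$ and the $T_i$ $(i\in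 I)$. Put $C_\pm^I(k)=\sum_{w\in W_0^I}\epsilon_\pm(T_w)T_w$. In all that follows fix one of the two signs $\pm$. Let $\gamma\in T=\mathrm{Hom}(P^\vee,\mathbb C^\times)$, written $\lambda\mapsto\gamma^\lambda$, satisfy $\gamma^{\alpha_i^\vee}=k_i^{\pm2}$ for all $i\in I$ (that is, $\gamma\in T_I^{k^{\pm1}}$), and $\gamma^{\alpha^\vee}\ne1$ for all $\alpha\in R_0^+\setminus R_0^{I,+}$. Then there is a unique character $\chi_\gamma:H_I(k)\to\mathbb C$ with $\chi_\gamma(Y^\lambda)=\gamma^\lambda$ for $\lambda\in P^\vee$ and $\chi_\gamma(T_i)=\pm k_i^{\pm1}$ for $i\in I$, and for every left $H(k)$-module $M$ and every $m\in M$ with $hm=\chi_\gamma(h)m$ for all $h\in H_I(k)$, $$C_\pm^I(k)m=\Bigl(\prod_{\alpha\in R_0^+\setminus R_0^{I,+}}\frac{\pm k_{\alpha^\vee}^{\pm1}}{1-\gamma^{\alpha^\vee}}\Bigr)\sum_{w\in W_0^I}\Bigl(\prod_{\alpha\in(R_0^+\setminus R_0^{I,+})\cap w^{-1}(R_0^+)}(\pm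 k_{\alpha^\vee}^{\mp1}\mp k_{\alpha^\vee}^{\pm1}\gamma^{\alpha^\vee})\Bigr)I_w(k)m .$$ In particular, in the induced module $M(\gamma)=H(k)\otimes_{H_I(k)}\mathbb C_{\chi_\gamma}$ with generator $v_e=1\otimes1$, the (anti)spherical vector $1_\gamma=C_\pm^I(k)v_e$ and the vectors $b_w(\gamma)=I_w(k)v_e$ satisfy $$1_\gamma=\Bigl(\prod_{\alpha\in R_0^+\setminus R_0^{I,+}}\frac{\pm k_{\alpha^\vee}^{\pm1}}{1-\gamma^{\alpha^\vee}}\Bigr)\sum_{w\in W_0^I}\Bigl(\prod_{\alpha\in(R_0^+\setminus R_0^{I,+})\cap w^{-1}(R_0^+)}(\pm k_{\alpha^\vee}^{\mp1}\mp k_{\alpha^\vee}^{\pm1}\gamma^{\alpha^\vee})\Bigr)b_w(\gamma).$$ -/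

import Mathlib

noncomputable section

namespace AffHecke

variable {ι V N : Type*} [AddCommGroup V] [Module ℝ V] [AddCommGroup N] [Module ℝ N]

/-! ### The finite Weyl group and the coweight lattice

`P : RootPairing ι ℝ V N` is the finite root system `R₀`: its roots are `P.root i ∈ V`, its coroots
`P.coroot i ∈ N`, where `N` is the dual of `V` (the Euclidean structure is only used to identify
the two spaces). -/

section FiniteType

variable (P : RootPairing ι ℝ V N)

/-- The coweight lattice `P^∨ = {λ | ⟨λ, α⟩ ∈ ℤ for all roots α}`. -/
def coweights : AddSubgroup N where
  carrier := {x | ∀ i, ∃ z : ℤ, P.root' i x = z}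
  zero_mem' i := ⟨0, by simp⟩
  add_mem' {x y} hx hy i := by
    obtain ⟨a, ha⟩ := hx i
    obtain ⟨c, hc⟩ := hy i
    exact ⟨a + c, by rw [map_add, ha, hc]; push_cast; rfl⟩
  neg_mem' {x} hx i := by
    obtain ⟨a, ha⟩ := hx i
    exact ⟨-a, by rw [map_neg, ha]; push_cast; rfl⟩

/-- The integer `⟨λ, α⟩`, for a root `α` and a coweight `λ`. -/
def pairZ (i : ι) (x : coweights P) : ℤ := (x.2 i).choose

lemma coe_pairZ (i : ι) (x : coweights P) : (pairZ P i x : ℝ) = P.root' i (x : N) :=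
  (x.2 i).choose_spec.symm

lemma pairZ_add (i : ι) (x y : coweights P) : pairZ P i (x + y) = pairZ P i x + pairZ P i y := by
  have h : (pairZ P i (x + y) : ℝ) = pairZ P i x + pairZ P i y := by
    simp only [coe_pairZ, AddSubgroup.coe_add, map_add]
  exact_mod_cast h

lemma pairZ_neg (i : ι) (x : coweights P) : pairZ P i (-x) = - pairZ P i x := by
  have h : (pairZ P i (-x) : ℝ) = - pairZ P i x := by
    simp only [coe_pairZ, AddSubgroup.coe_neg, map_neg]
  exact_mod_cast h

lemma pairZ_zero (i : ι) : pairZ P i 0 = 0 := by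
  have h : (pairZ P i 0 : ℝ) = 0 := by
    simp only [coe_pairZ, AddSubgroup.coe_zero, map_zero]
  exact_mod_cast h

/-- The coroot `α^∨` as an element of the coweight lattice. -/
def corootC [P.IsCrystallographic] (i : ι) : coweights P :=
  ⟨P.coroot i, fun j => by
    obtain ⟨z, hz⟩ := P.exists_value (S := ℤ) j i
    exact ⟨z, by rw [RootPairing.root'_coroot_eq_pairing, ← hz]; simp⟩⟩

/-- The action of the Weyl group `W₀` on `N`, normalised by `⟨w λ, w α⟩ = ⟨λ, α⟩`. -/
def weylN (w : P.weylGroup) : N ≃ₗ[ℝ] N :=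
  RootPairing.Equiv.coweightEquiv P P ((w⁻¹ : P.weylGroup) : P.Aut)

lemma weylN_mul (v w : P.weylGroup) (x : N) : weylN P (v * w) x = weylN P v (weylN P w x) := by
  simp [weylN]

lemma weylN_one (x : N) : weylN P 1 x = x := by
  simp [weylN]

lemma root_smul_weylN (w : P.weylGroup) (i : ι) (x : N) :
    P.root' (w • i) (weylN P w x) = P.root' i x := by
  have h := RootPairing.Hom.weight_coweight_transpose_apply P P x
    ((w⁻¹ : P.weylGroup) : P.Aut).toHom
  have h2 := LinearMap.congr_fun h (P.root (w • i))
  have h3 : ((w⁻¹ : P.weylGroup) : P.Aut).toHom.weightMap (P.root (w • i)) = P.root i := by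
    rw [RootPairing.Hom.root_weightMap_apply]
    exact congrArg P.root (inv_smul_smul w i)
  simp only [LinearMap.dualMap_apply, h3] at h2
  exact h2.symm

/-- The action of `W₀` on the coweight lattice `P^∨`. -/
def weylCow : P.weylGroup →* MulAut (Multiplicative (coweights P)) where
  toFun w :=
    { toFun := fun x => Multiplicative.ofAdd ⟨weylN P w (x.toAdd : N), fun i => by
        obtain ⟨z, hz⟩ := x.toAdd.2 (w⁻¹ • i)
        exact ⟨z, by rw [← hz, ← root_smul_weylN P w (w⁻¹ • i), smul_inv_smul]⟩⟩
      invFun := fun x => Multiplicative.ofAdd ⟨weylN P w⁻¹ (x.toAdd : N), fun i => by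
        obtain ⟨z, hz⟩ := x.toAdd.2 (w • i)
        exact ⟨z, by rw [← hz, ← root_smul_weylN P w⁻¹ (w • i), inv_smul_smul]⟩⟩
      left_inv := fun x => by
        apply Multiplicative.toAdd.injective
        apply Subtype.ext
        simp [← weylN_mul, weylN_one]
      right_inv := fun x => by
        apply Multiplicative.toAdd.injective
        apply Subtype.ext
        simp [← weylN_mul, weylN_one]
      map_mul' := fun x y => by
        apply Multiplicative.toAdd.injective
        apply Subtype.ext
        simp }
  map_one' := by
    ext x
    simp [weylN_one]
  map_mul' v w := by
    ext x
    simp [weylN_mul]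

lemma pairZ_weylCow (w : P.weylGroup) (i : ι) (x : Multiplicative (coweights P)) :
    pairZ P (w • i) (weylCow P w x).toAdd = pairZ P i x.toAdd := by
  have h : (pairZ P (w • i) (weylCow P w x).toAdd : ℝ) = pairZ P i x.toAdd := by
    rw [coe_pairZ, coe_pairZ]
    exact root_smul_weylN P w i _
  exact_mod_cast h

instance finite_weylGroup [Finite ι] [P.IsRootSystem] : Finite P.weylGroup := by
  refine Finite.of_injective (fun w : P.weylGroup => RootPairing.Equiv.indexHom P w.1) ?_
  intro v w h
  apply Subtype.ext
  apply RootPairing.Equiv.weightHom_injective P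
  apply LinearEquiv.toLinearMap_injective
  apply LinearMap.ext_on_range (v := P.root) RootPairing.IsRootSystem.span_root_eq_top
  intro i
  have hv := RootPairing.Hom.root_weightMap_apply P P i v.1.toHom
  have hw := RootPairing.Hom.root_weightMap_apply P P i w.1.toHom
  have hi : v.1.toHom.indexEquiv i = w.1.toHom.indexEquiv i := congrArg (fun e => e i) h
  exact hv.trans ((congrArg P.root hi).trans hw.symm)

lemma nonempty_index [P.IsRootSystem] [P.IsIrreducible] : Nonempty ι := by
  by_contra h
  rw [not_nonempty_iff] at h
  have := RootPairing.IsIrreducible.nontrivial P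
  have h1 := RootPairing.IsRootSystem.span_root_eq_top (P := P)
  rw [Set.range_eq_empty, Submodule.span_empty] at h1
  exact bot_ne_top h1

end FiniteType

/-! ### The extended affine Weyl group and the affine root system -/

section Affine

variable (P : RootPairing ι ℝ V N)

/-- The extended affine Weyl group `W = W₀ ⋉ P^∨`; the pair `(λ, w)` is `τ(λ) w`. -/
abbrev ExtWeyl : Type _ := Multiplicative (coweights P) ⋊[weylCow P] P.weylGroup

/-- The translation `τ(λ) ∈ W`. -/
def tau (x : coweights P) : ExtWeyl P := SemidirectProduct.inl (Multiplicative.ofAdd x)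

/-- The twisted affine root system `R = {a^∨ | a ∈ ℤc + R₀}`. The pair `⟨i, r⟩` stands for
`(r c + α)^∨`, where `α = P.root i`. -/
@[ext] structure AffRoot (P : RootPairing ι ℝ V N) where
  grad : ι
  lvl : ℤ

/-- The action of `W` on affine roots: `w (α + r c) = w α + r c` for `w ∈ W₀` and
`τ(λ) (α + r c) = α + (r - ⟨λ, α⟩) c` for `λ ∈ P^∨`. -/
instance : MulAction (ExtWeyl P) (AffRoot P) where
  smul w a := ⟨w.right • a.grad, a.lvl - pairZ P (w.right • a.grad) w.left.toAdd⟩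
  one_smul a := by
    apply AffRoot.ext
    · exact one_smul _ a.grad
    · change a.lvl - pairZ P _ 0 = a.lvl
      rw [pairZ_zero, sub_zero]
  mul_smul v w a := by
    apply AffRoot.ext
    · exact mul_smul v.right w.right a.grad
    · change a.lvl - pairZ P ((v.right * w.right) • a.grad)
          (v.left.toAdd + (weylCow P v.right w.left).toAdd) =
        a.lvl - pairZ P (w.right • a.grad) w.left.toAdd
          - pairZ P (v.right • w.right • a.grad) v.left.toAdd
      rw [pairZ_add, mul_smul, pairZ_weylCow]
      ring

/-- The reflection `s_a = s_α τ(r α^∨) = τ(-r α^∨) s_α` for `a = (r c + α)^∨`. -/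
def affRefl [P.IsCrystallographic] (a : AffRoot P) : ExtWeyl P :=
  tau P (-(a.lvl • corootC P a.grad)) * SemidirectProduct.inr (RootPairing.weylGroup.ofIdx P a.grad)

/-- A multiplicity function: a `W`-invariant map `k : R → ℂ^×`. -/
structure Mult (P : RootPairing ι ℝ V N) where
  toFun : AffRoot P → ℂˣ
  invariant : ∀ (w : ExtWeyl P) (a : AffRoot P), toFun (w • a) = toFun a

/-- The torus `T = Hom(P^∨, ℂ^×)`. -/
abbrev Torus : Type _ := Multiplicative (coweights P) →* ℂˣ

end Affine

section Based

variable {P : RootPairing ι ℝ V N} (b : P.Base)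

/-- The positive affine roots: `(r c + α)^∨ > 0` iff `r > 0`, or `r = 0` and `α ∈ R₀⁺`. -/
def AffPos (a : AffRoot P) : Prop := 0 < a.lvl ∨ (a.lvl = 0 ∧ b.IsPos a.grad)

/-- The length `l(w) = #(R⁺ ∩ w⁻¹ R⁻)` on the extended affine Weyl group. -/
def affLen (w : ExtWeyl P) : ℕ := Set.ncard {a : AffRoot P | AffPos b a ∧ ¬ AffPos b (w • a)}

/-- The length `l(w) = #(R₀⁺ ∩ w⁻¹ R₀⁻)` on the finite Weyl group. -/
def finLen (w : P.weylGroup) : ℕ := Set.ncard {i : ι | b.IsPos i ∧ ¬ b.IsPos (w • i)}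

/-- The set `Ω` of elements of length zero in `W`. -/
abbrev Omega : Type _ := {w : ExtWeyl P // affLen b w = 0}

section Highest

variable [Finite ι] [P.IsRootSystem] [P.IsCrystallographic] [P.IsIrreducible]

/-- The highest root `φ`, that is, the root of maximal height. -/
def highest : ι :=
  haveI := nonempty_index P
  (Finite.exists_max b.height).choose

/-- The simple affine roots `a₀ = (c - φ)^∨` (index `none`) and `a_i = α_i^∨`
(index `some i`). -/
def simpleAff : Option b.support → AffRoot P
  | none => ⟨P.reflectionPerm (highest b) (highest b), 1⟩
  | some i => ⟨i, 0⟩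

/-- The simple reflections `s_0, …, s_n` in `W`. -/
def simpleRefl (j : Option b.support) : ExtWeyl P := affRefl P (simpleAff b j)

end Highest

/-- The simple reflections `s_i` of the finite Weyl group. -/
def finRefl (i : b.support) : P.weylGroup := RootPairing.weylGroup.ofIdx P i

/-- The alternating product `x y x ⋯` with `m` factors. -/
def altProd {A : Type*} [Monoid A] : ℕ → A → A → A
  | 0, _, _ => 1
  | m + 1, x, y => x * altProd m y x

/-! ### The extended affine Hecke algebra -/

section Hecke

variable [Finite ι] [P.IsRootSystem] [P.IsCrystallographic] [P.IsIrreducible] (k : Mult P)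

/-- The parameter `k_j = k_{a_j}`. -/
def kSimple (j : Option b.support) : ℂˣ := k.toFun (simpleAff b j)

/-- The parameter `k_{α^∨}` of a finite root `α`. -/
def kRoot (k : Mult P) (i : ι) : ℂˣ := k.toFun ⟨i, 0⟩

/-- Generators of `H(k)`: `T_j` for `0 ≤ j ≤ n` and the elements of `Ω`. -/
abbrev Gen : Type _ := Option b.support ⊕ Omega b

/-- The generator `T_j` of the free algebra. -/
def freeT (j : Option b.support) : FreeAlgebra ℂ (Gen b) := FreeAlgebra.ι ℂ (Sum.inl j)

/-- The generator `ω` of the free algebra. -/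
def freeO (ω : Omega b) : FreeAlgebra ℂ (Gen b) := FreeAlgebra.ι ℂ (Sum.inr ω)

/-- The defining relations of `H(k) = H^a(k) # Ω`: the braid relations (for `s_i s_j` of finite
order) and the quadratic relations of `H^a(k)`, the multiplication of `Ω`, and
`ω T_i ω⁻¹ = T_{ω(i)}` where `ω(a_i) = a_{ω(i)}`. -/
inductive HeckeRel : FreeAlgebra ℂ (Gen b) → FreeAlgebra ℂ (Gen b) → Prop
  | braid (i j : Option b.support) (hij : i ≠ j)
      (hfin : IsOfFinOrder (simpleRefl b i * simpleRefl b j)) :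
      HeckeRel (altProd (orderOf (simpleRefl b i * simpleRefl b j)) (freeT b i) (freeT b j))
        (altProd (orderOf (simpleRefl b i * simpleRefl b j)) (freeT b j) (freeT b i))
  | quad (j : Option b.support) :
      HeckeRel ((freeT b j - algebraMap ℂ _ (kSimple b k j : ℂ)) *
        (freeT b j + algebraMap ℂ _ (((kSimple b k j)⁻¹ : ℂˣ) : ℂ))) 0
  | omega_one (ω : Omega b) (h : ω.1 = 1) : HeckeRel (freeO b ω) 1
  | omega_mul (ω₁ ω₂ ω₃ : Omega b) (h : ω₁.1 * ω₂.1 = ω₃.1) :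
      HeckeRel (freeO b ω₁ * freeO b ω₂) (freeO b ω₃)
  | omega_conj (ω : Omega b) (i j : Option b.support) (h : ω.1 • simpleAff b i = simpleAff b j) :
      HeckeRel (freeO b ω * freeT b i) (freeT b j * freeO b ω)

/-- The extended affine Hecke algebra `H(k)`. -/
abbrev Hecke : Type _ := RingQuot (HeckeRel b k)

/-- The generator `T_j ∈ H(k)`, `0 ≤ j ≤ n`. -/
def genT (j : Option b.support) : Hecke b k := RingQuot.mkAlgHom ℂ (HeckeRel b k) (freeT b j)

/-- The element `ω ∈ Ω` of `H(k)`. -/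
def genO (ω : Omega b) : Hecke b k := RingQuot.mkAlgHom ℂ (HeckeRel b k) (freeO b ω)

/-- `w = s_{i_1} ⋯ s_{i_r} ω` with `r = l(w)` and `ω ∈ Ω` is a reduced expression of `w ∈ W`. -/
def IsReducedExpr (w : ExtWeyl P) (L : List (Option b.support)) (ω : Omega b) : Prop :=
  L.length = affLen b w ∧ (L.map (simpleRefl b)).prod * ω.1 = w

/-- `T_w = T_{i_1} ⋯ T_{i_r} ω` for a reduced expression `w = s_{i_1} ⋯ s_{i_r} ω`; it does not
depend on the choice of the reduced expression. -/
def heckeT (w : ExtWeyl P) : Hecke b k :=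
  Classical.epsilon fun t => ∃ L ω, IsReducedExpr b w L ω ∧ t = (L.map (genT b k)).prod * genO b k ω

/-- `T_w` for `w` in the finite Weyl group. -/
def finT (w : P.weylGroup) : Hecke b k := heckeT b k (SemidirectProduct.inr w)

/-- `λ ↦ Y^λ`: the group homomorphism `P^∨ → H(k)^×` that extends `λ ↦ T_{τ(λ)}` on the dominant
coweights; it exists and is unique. -/
def heckeY : Multiplicative (coweights P) →* (Hecke b k)ˣ :=
  Classical.epsilon fun Y => ∀ x : coweights P, (∀ i, b.IsPos i → 0 ≤ pairZ P i x) →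
    (Y (Multiplicative.ofAdd x) : Hecke b k) = heckeT b k (tau P x)

/-- `Y^λ` as an element of `H(k)`. -/
def Yel (x : coweights P) : Hecke b k := heckeY b k (Multiplicative.ofAdd x)

/-- The intertwiner `I_i(k) = T_i (1 - Y^{α_i^∨}) + (k_i - k_i⁻¹) Y^{α_i^∨}`, `1 ≤ i ≤ n`. -/
def simpleInt (i : b.support) : Hecke b k :=
  genT b k (some i) * (1 - Yel b k (corootC P i)) +
    ((kSimple b k (some i) : ℂ) - (((kSimple b k (some i))⁻¹ : ℂˣ) : ℂ)) • Yel b k (corootC P i)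

/-- The intertwiner `I_w(k) = I_{i_1}(k) ⋯ I_{i_r}(k)` for a reduced expression
`w = s_{i_1} ⋯ s_{i_r}` in `W₀`; it does not depend on the choice of the reduced expression. -/
def intertwiner (w : P.weylGroup) : Hecke b k :=
  Classical.epsilon fun t => ∃ L : List b.support,
    L.length = finLen b w ∧ (L.map (finRefl b)).prod = w ∧ t = (L.map (simpleInt b k)).prod

/-! ### The characters `ε_±` -/

/-- The number `± z^{± 1}`, where `σ ∈ {1, -1}` is the sign `±`. -/
def sgnPow (σ : ℤˣ) (z : ℂˣ) : ℂ := ((σ : ℤ) : ℂ) * ((z ^ (σ : ℤ) : ℂˣ) : ℂ)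

end Hecke

section Characters

lemma map_altProd {A B F : Type*} [Monoid A] [Monoid B] [FunLike F A B] [MonoidHomClass F A B]
    (f : F) (m : ℕ) (x y : A) : f (altProd m x y) = altProd m (f x) (f y) := by
  induction m generalizing x y with
  | zero => simp [altProd]
  | succ m ih => simp [altProd, ih]

lemma altProd_two_mul {A : Type*} [Monoid A] (p : ℕ) (x y : A) :
    altProd (2 * p) x y = (x * y) ^ p := by
  induction p with
  | zero => simp [altProd]
  | succ p ih =>
    rw [show 2 * (p + 1) = 2 * p + 1 + 1 by ring, altProd, altProd, ih, pow_succ', mul_assoc]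

/-- The root `-a`. -/
def affNeg (a : AffRoot P) : AffRoot P := ⟨P.reflectionPerm a.grad a.grad, -a.lvl⟩

lemma pairZ_neg_left (i : ι) (x : coweights P) :
    pairZ P (P.reflectionPerm i i) x = - pairZ P i x := by
  have : (pairZ P (P.reflectionPerm i i) x : ℝ) = - pairZ P i x := by
    rw [coe_pairZ, coe_pairZ]
    simp [RootPairing.root']
  exact_mod_cast this

lemma smul_affNeg (w : ExtWeyl P) (a : AffRoot P) : w • affNeg a = affNeg (w • a) := by
  have hg : w.right • P.reflectionPerm a.grad a.grad =
      P.reflectionPerm (w.right • a.grad) (w.right • a.grad) := by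
    apply P.root.injective
    have h1 := RootPairing.weylGroup_apply_root P w.right (P.reflectionPerm a.grad a.grad)
    have h2 := RootPairing.weylGroup_apply_root P w.right a.grad
    have h3 : P.root (w.right • P.reflectionPerm a.grad a.grad) =
      w.right • P.root (P.reflectionPerm a.grad a.grad) := h1.symm
    have h4 : P.root (w.right • a.grad) = w.right • P.root a.grad := h2.symm
    rw [h3]
    rw [RootPairing.root_reflectionPerm, RootPairing.root_reflectionPerm,
      RootPairing.reflection_apply_self, RootPairing.reflection_apply_self, h4, smul_neg]
  apply AffRoot.ext
  · exact hg
  · change -a.lvl - pairZ P (w.right • P.reflectionPerm a.grad a.grad) w.left.toAdd =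
      -(a.lvl - pairZ P (w.right • a.grad) w.left.toAdd)
    rw [hg, pairZ_neg_left]
    ring

variable [P.IsCrystallographic]

lemma pairZ_smul_corootC (i j : ι) (r : ℤ) :
    (pairZ P i (-(r • corootC P j)) : ℝ) = -(r * P.pairing i j) := by
  rw [coe_pairZ]
  simp [corootC]

lemma affRefl_smul (a c : AffRoot P) :
    affRefl P a • c = ⟨P.reflectionPerm a.grad c.grad,
      c.lvl - pairZ P (P.reflectionPerm a.grad c.grad) (-(a.lvl • corootC P a.grad))⟩ := by
  unfold affRefl
  rw [mul_smul]
  apply AffRoot.ext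
  · change (1 : P.weylGroup) • RootPairing.weylGroup.ofIdx P a.grad • c.grad = _
    rw [one_smul]
    rfl
  · change c.lvl - pairZ P (_) 0 - pairZ P ((1 : P.weylGroup) •
      RootPairing.weylGroup.ofIdx P a.grad • c.grad) (-(a.lvl • corootC P a.grad)) = _
    rw [pairZ_zero, one_smul, sub_zero]
    rfl

lemma affRefl_smul_self (a : AffRoot P) : affRefl P a • a = affNeg a := by
  rw [affRefl_smul]
  apply AffRoot.ext
  · rfl
  · have h := pairZ_smul_corootC (P := P) (P.reflectionPerm a.grad a.grad) a.grad a.lvl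
    rw [RootPairing.pairing_reflectionPerm_self_left, RootPairing.pairing_same] at h
    have h' : pairZ P (P.reflectionPerm a.grad a.grad) (-(a.lvl • corootC P a.grad)) =
        2 * a.lvl := by
      have : (pairZ P (P.reflectionPerm a.grad a.grad) (-(a.lvl • corootC P a.grad)) : ℝ) =
        2 * a.lvl := by rw [h]; ring
      exact_mod_cast this
    simp only [affNeg]
    omega

lemma eq_or_eq_affNeg [P.IsReduced] (a c : AffRoot P) (h : affRefl P a • c = affNeg c) :
    c = a ∨ c = affNeg a := by
  rw [affRefl_smul] at h
  have hg : P.reflectionPerm a.grad c.grad = P.reflectionPerm c.grad c.grad :=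
    congrArg AffRoot.grad h
  have hl : c.lvl - pairZ P (P.reflectionPerm a.grad c.grad) (-(a.lvl • corootC P a.grad)) =
    -c.lvl := congrArg AffRoot.lvl h
  have hp := pairZ_smul_corootC (P := P) (P.reflectionPerm a.grad c.grad) a.grad a.lvl
  by_cases hca : c.grad = a.grad
  · left
    apply AffRoot.ext hca
    rw [hca, RootPairing.pairing_reflectionPerm_self_left, RootPairing.pairing_same] at hp
    rw [hca] at hl
    have hp' : ((pairZ P (P.reflectionPerm a.grad a.grad) (-(a.lvl • corootC P a.grad)) : ℤ) : ℝ) =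
      ((2 * a.lvl : ℤ) : ℝ) := by rw [hp]; push_cast; ring
    have hp'' := Int.cast_injective hp'
    omega
  · right
    have hr : P.root c.grad = - P.root a.grad := by
      apply RootPairing.IsReduced.eq_or_eq_neg (P := P) c.grad a.grad ?_ |>.resolve_left
        (fun e => hca (P.root.injective e))
      intro hli
      have hr := congrArg P.root hg
      rw [RootPairing.root_reflectionPerm, RootPairing.root_reflectionPerm,
        RootPairing.reflection_apply_self, RootPairing.reflection_apply_root] at hr
      rw [LinearIndependent.pair_iff] at hli
      have := hli 2 (-P.pairing c.grad a.grad) (by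
        rw [neg_smul, ← sub_eq_add_neg, two_smul, add_sub_assoc, hr, add_neg_cancel])
      exact two_ne_zero this.1
    have hcg : c.grad = P.reflectionPerm a.grad a.grad := RootPairing.root_eq_neg_iff P |>.mp hr
    apply AffRoot.ext hcg
    have hca' : P.reflectionPerm a.grad c.grad = a.grad := by
      rw [hcg, RootPairing.reflectionPerm_self]
    rw [hca', RootPairing.pairing_same] at hp
    rw [hca'] at hl
    have hp' : ((pairZ P a.grad (-(a.lvl • corootC P a.grad)) : ℤ) : ℝ) =
      ((-(2 * a.lvl) : ℤ) : ℝ) := by rw [hp]; push_cast; ring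
    have hp'' := Int.cast_injective hp'
    simp only [affNeg]
    omega

lemma affRefl_mul_self (a : AffRoot P) : affRefl P a * affRefl P a = 1 := by
  have hi : (RootPairing.weylGroup.ofIdx P a.grad)⁻¹ = RootPairing.weylGroup.ofIdx P a.grad :=
    Subtype.ext (RootPairing.Equiv.reflection_inv P a.grad)
  have hc : weylN P (RootPairing.weylGroup.ofIdx P a.grad) (P.coroot a.grad) =
      -P.coroot a.grad := by
    rw [weylN, hi]
    exact P.coreflection_apply_self a.grad
  have he : affRefl P a = ⟨Multiplicative.ofAdd (-(a.lvl • corootC P a.grad)),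
      RootPairing.weylGroup.ofIdx P a.grad⟩ := (SemidirectProduct.mk_eq_inl_mul_inr _ _).symm
  rw [he]
  apply SemidirectProduct.ext
  · apply Multiplicative.toAdd.injective
    apply Subtype.ext
    change -(a.lvl • P.coroot a.grad) +
      weylN P (RootPairing.weylGroup.ofIdx P a.grad) (-(a.lvl • P.coroot a.grad)) = 0
    rw [map_neg, map_zsmul, hc]
    simp
  · exact mul_eq_one_iff_inv_eq.mpr hi

lemma mult_eq_of_conj [P.IsReduced] (k : Mult P) (a c : AffRoot P) (u : ExtWeyl P)
    (h : affRefl P c = u * affRefl P a * u⁻¹) : k.toFun c = k.toFun a := by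
  have h1 : affRefl P a • (u⁻¹ • c) = affNeg (u⁻¹ • c) := by
    rw [← smul_affNeg, ← affRefl_smul_self, h, mul_smul, mul_smul, inv_smul_smul]
  rw [← k.invariant u⁻¹ c]
  rcases eq_or_eq_affNeg a _ h1 with h2 | h2
  · rw [h2]
  · rw [h2, ← affRefl_smul_self, k.invariant]

lemma mult_eq_of_odd [P.IsReduced] (k : Mult P) (a c : AffRoot P)
    (hodd : Odd (orderOf (affRefl P a * affRefl P c))) : k.toFun c = k.toFun a := by
  obtain ⟨p, hp⟩ := hodd
  have hone := pow_orderOf_eq_one (affRefl P a * affRefl P c)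
  rw [hp] at hone
  have ha := affRefl_mul_self a
  have hc := affRefl_mul_self c
  have hinv : (affRefl P a * affRefl P c)⁻¹ = affRefl P c * affRefl P a := by
    rw [mul_inv_rev, inv_eq_of_mul_eq_one_left ha, inv_eq_of_mul_eq_one_left hc]
  apply mult_eq_of_conj k a c ((affRefl P a * affRefl P c) ^ p)
  have hsc : affRefl P a * ((affRefl P a * affRefl P c) ^ p)⁻¹ =
      (affRefl P a * affRefl P c) ^ p * affRefl P a := by
    rw [← inv_pow, hinv]
    have : SemiconjBy (affRefl P a) (affRefl P c * affRefl P a) (affRefl P a * affRefl P c) := by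
      simp [SemiconjBy, mul_assoc]
    exact this.pow_right p
  rw [mul_assoc, hsc, ← mul_assoc, ← pow_add]
  have h3 : (affRefl P a * affRefl P c) ^ (p + p) = (affRefl P a * affRefl P c)⁻¹ := by
    rw [← two_mul]
    exact eq_inv_of_mul_eq_one_left (by rw [← pow_succ]; exact hone)
  rw [h3, hinv, mul_assoc, ha, mul_one]

variable [Finite ι] [P.IsRootSystem] [P.IsReduced] [P.IsIrreducible] (k : Mult P)

/-- The values `ε_±(T_j) = ± k_j^{±1}` and `ε_±(ω) = 1` on generators. -/
def epsGen (σ : ℤˣ) : Gen b → ℂ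
  | Sum.inl j => sgnPow σ (kSimple b k j)
  | Sum.inr _ => 1

lemma epsGen_rel (σ : ℤˣ) {x y : FreeAlgebra ℂ (Gen b)} (h : HeckeRel b k x y) :
    FreeAlgebra.lift ℂ (epsGen b k σ) x = FreeAlgebra.lift ℂ (epsGen b k σ) y := by
  have hT (j) : FreeAlgebra.lift ℂ (epsGen b k σ) (freeT b j) = sgnPow σ (kSimple b k j) := by
    simp [freeT, epsGen]
  have hO (ω) : FreeAlgebra.lift ℂ (epsGen b k σ) (freeO b ω) = 1 := by
    simp [freeO, epsGen]
  cases h with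
  | braid i j hij hfin =>
    rw [map_altProd, map_altProd, hT, hT]
    rcases Nat.even_or_odd (orderOf (simpleRefl b i * simpleRefl b j)) with he | ho
    · obtain ⟨p, hp⟩ := he
      rw [hp, ← two_mul, altProd_two_mul, altProd_two_mul, mul_comm (sgnPow _ _)]
    · have : kSimple b k j = kSimple b k i := mult_eq_of_odd k _ _ ho
      rw [this]
  | quad j =>
    simp only [map_mul, map_sub, map_add, hT, map_zero, AlgHom.commutes]
    rcases Int.units_eq_one_or σ with rfl | rfl
    · simp [sgnPow]
    · simp [sgnPow]
  | omega_one ω h => simp [hO]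
  | omega_mul => simp [hO]
  | omega_conj ω i j h =>
    have : kSimple b k j = kSimple b k i := by
      rw [kSimple, ← h, k.invariant]
      rfl
    simp [hO, hT, this]

/-- The characters `ε_±^k : H(k) → ℂ` with `ε_±(T_j) = ± k_j^{±1}` and `ε_±(ω) = 1`. -/
def eps (σ : ℤˣ) : Hecke b k →ₐ[ℂ] ℂ :=
  RingQuot.liftAlgHom ℂ ⟨FreeAlgebra.lift ℂ (epsGen b k σ), fun _ _ h => epsGen_rel b k σ h⟩

lemma eps_genT (σ : ℤˣ) (j : Option b.support) :
    eps b k σ (genT b k j) = sgnPow σ (kSimple b k j) := by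
  unfold eps genT
  rw [RingQuot.liftAlgHom_mkAlgHom_apply]
  simp [freeT, epsGen]

lemma eps_genO (σ : ℤˣ) (ω : Omega b) : eps b k σ (genO b k ω) = 1 := by
  unfold eps genO
  rw [RingQuot.liftAlgHom_mkAlgHom_apply]
  simp [freeO, epsGen]

end Characters

/-! ### Parabolic data -/

section Parabolic

variable (I : Set b.support)

/-- The indices of the roots in `R₀⁺ ∖ R₀^{I,+}`, where `R₀^I = R₀ ∩ span_ℤ {α_i | i ∈ I}`. -/
def posOutside [Finite ι] : Finset ι :=
  (Set.toFinite {i : ι | b.IsPos i ∧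
    P.root i ∉ AddSubgroup.closure ((fun j : b.support => P.root j) '' I)}).toFinset

variable [Finite ι] [P.IsRootSystem]

/-- The set `W₀^I` of minimal coset representatives: `l(w s_i) > l(w)` for all `i ∈ I`. -/
def minReps : Finset P.weylGroup :=
  (Set.toFinite {w : P.weylGroup | ∀ i ∈ I, finLen b w < finLen b (w * finRefl b i)}).toFinset

variable [P.IsCrystallographic] [P.IsIrreducible] (k : Mult P) (σ : ℤˣ)

/-- `γ^λ ∈ ℂ`, for `γ ∈ T` and `λ ∈ P^∨`. -/
def tpow (γ : Torus P) (x : coweights P) : ℂ := ((γ (Multiplicative.ofAdd x) : ℂˣ) : ℂ)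

/-- `T_I^{k^{±1}} = {γ ∈ T | γ^{α_i^∨} = k_i^{± 2} for all i ∈ I}`. -/
def torusI : Set (Torus P) :=
  {γ | ∀ i ∈ I, γ (Multiplicative.ofAdd (corootC P i)) = (kSimple b k (some i) ^ (σ : ℤ)) ^ 2}

/-- The parabolic subalgebra `H_I(k)`, generated by all `Y^λ` and the `T_i` with `i ∈ I`. -/
def parabolic : Subalgebra ℂ (Hecke b k) :=
  Algebra.adjoin ℂ (Set.range (Yel b k) ∪ (fun i : b.support => genT b k (some i)) '' I)

lemma Yel_mem_parabolic (x : coweights P) : Yel b k x ∈ parabolic b I k :=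
  Algebra.subset_adjoin (Or.inl ⟨x, rfl⟩)

lemma genT_mem_parabolic {i : b.support} (hi : i ∈ I) : genT b k (some i) ∈ parabolic b I k :=
  Algebra.subset_adjoin (Or.inr ⟨i, hi, rfl⟩)

/-- `χ` is the character `χ_γ^{k,±,I}` of `H_I(k)`: `χ(Y^λ) = γ^λ` for `λ ∈ P^∨` and
`χ(T_i) = ± k_i^{±1}` for `i ∈ I`. -/
def IsChi (γ : Torus P) (χ : parabolic b I k →ₐ[ℂ] ℂ) : Prop :=
  (∀ x : coweights P, χ ⟨Yel b k x, Yel_mem_parabolic b I k x⟩ = tpow γ x) ∧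
  ∀ (i : b.support) (hi : i ∈ I),
    χ ⟨genT b k (some i), genT_mem_parabolic b I k hi⟩ = sgnPow σ (kSimple b k (some i))

/-- The left ideal of `H(k)` generated by the elements `h - χ(h)`, `h ∈ H_I(k)`. -/
def indIdeal (χ : parabolic b I k →ₐ[ℂ] ℂ) : Submodule (Hecke b k) (Hecke b k) :=
  Submodule.span (Hecke b k)
    (Set.range fun h : parabolic b I k => (h : Hecke b k) - algebraMap ℂ (Hecke b k) (χ h))

/-- The induced left `H(k)`-module `H(k) ⊗_{H_I(k)} ℂ_χ`, realised as the quotient of `H(k)` by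
the left ideal generated by the `h - χ(h)`; the class of `h` is `h ⊗ 1`. -/
abbrev Ind (χ : parabolic b I k →ₐ[ℂ] ℂ) : Type _ := Hecke b k ⧸ indIdeal b I k χ

/-- The generating vector `v_e = 1 ⊗ 1` of the induced module. -/
def vE (χ : parabolic b I k →ₐ[ℂ] ℂ) : Ind b I k χ := Submodule.Quotient.mk 1

/-- The vector `b_w = I_w(k) v_e` of the induced module. -/
def bVec (χ : parabolic b I k →ₐ[ℂ] ℂ) (w : P.weylGroup) : Ind b I k χ :=
  intertwiner b k w • vE b I k χ

variable [P.IsReduced]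

/-- `C_±^I(k) = ∑_{w ∈ W₀^I} ε_±(T_w) T_w`. -/
def symmetrizer : Hecke b k := ∑ w ∈ minReps b I, eps b k σ (finT b k w) • finT b k w

/-- The (anti)spherical vector `1_γ = C_±^I(k) v_e` of the induced module. -/
def sphVec (χ : parabolic b I k →ₐ[ℂ] ℂ) : Ind b I k χ := symmetrizer b I k σ • vE b I k χ

open scoped Classical in
/-- The coefficient `∏ (± k_{α^∨}^{∓1} ∓ k_{α^∨}^{±1} γ^{α^∨})` over the roots
`α ∈ (R₀⁺ ∖ R₀^{I,+}) ∩ w⁻¹ R₀⁺`. -/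
def coeffW (γ : Torus P) (w : P.weylGroup) : ℂ :=
  ∏ i ∈ posOutside b I with b.IsPos (w • i),
    (((σ : ℤ) : ℂ) * ((kRoot k i ^ (-(σ : ℤ)) : ℂˣ) : ℂ) -
      ((σ : ℤ) : ℂ) * ((kRoot k i ^ (σ : ℤ) : ℂˣ) : ℂ) * tpow γ (corootC P i))

/-- The factor `∏ (± k_{α^∨}^{±1}) / (1 - γ^{α^∨})` over the roots `α ∈ R₀⁺ ∖ R₀^{I,+}`. -/
def coeff0 (γ : Torus P) : ℂ :=
  ∏ i ∈ posOutside b I, sgnPow σ (kRoot k i) / (1 - tpow γ (corootC P i))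

end Parabolic

end Based

end AffHecke

end

/-! Write κ_i = ±k_i^{±1}. In the induced module the vectors ε(T_w)⁻¹ T_w v_e depend only on the
coset w W_I, and both sides of the formula are expanded in them. If T_i v = κ_i v for 1 ≤ i ≤ n,
then comparing coefficients of T_i v at the coset of s_i w gives c(s_i w) = κ_i² c(w), so that c(u)
= ε(T_u)² c(1) on minimal representatives (`psi_apply_of_spherical`). The symmetrizer has exactly
the coefficients ε(T_u)² (`psi_symmetrizer`). Hence it is enough to show that Σ c_w I_w v_e is an
eigenvector of every T_i, 1 ≤ i ≤ n, and to compute one of its coefficients.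

Eigenvector (`psi_genT_mul_intSum`): the minimal representatives are grouped under w ↦ s_i w. If
both w and s_i w are minimal, the recursion for I_{s_i w} and the factor (κ_i⁻¹ - κ_i γ^{β^∨}), β =
w⁻¹α_i, that separates c_w from c_{s_i w} make the two contributions cancel (`defect_add_defect`).
Otherwise w α_j = α_i with j ∈ I, and T_i I_w = I_w T_j (`genT_mul_intertwiner`) shows that I_w v_e
is an eigenvector by itself.

Normalisation (`psi_intSum_longest`): I_w is T_w ∏ (1 - Y^{β^∨}) over the inversions β of w, plus
terms T_v Y^λ with v shorter. At the coset of the longest minimal representative u only I_u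
contributes. The inversions of u are all roots in R₀⁺ ∖ R₀^{I,+}, so c_u = 1 and the coefficient is
ε(T_u) ∏ (1 - γ^{α^∨}), which regularity of γ makes nonzero.

The induced module itself is reached through `psi`, which sends T_w Y^λ to γ^λ ε(T_w) [w W_I] on the
subalgebra `bern`. It turns right multiplication by H_I(k) into scalars
(`psi_mul_of_mem_parabolic`), which produces the character without a presentation of H_I(k). Its
kernel on `bern` lies in the left ideal generated by the h - χ(h) (`mem_indIdeal_of_psi_eq_zero`).
The formula is thus a congruence modulo that ideal and passes to every module. Since both sides lie
in `bern`, there is no need to express T_0 or Ω through the T_i and Y^λ.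

The foundations are Matsumoto's theorem (`matsumoto`), for one notion of reflection system covering
the finite and the affine group; the regular representation (`linearIndependent_heckeT`); the
Bernstein relations (`bernsteinRel`) and the resulting independence of the T_w Y^λ
(`linearIndependent_finT_mul_Yel`); and a rigidity statement for intertwiners
(`eq_zero_of_intertwine`), which makes I_w independent of the reduced word. -/

noncomputable section

namespace AffHecke

/-! ### Groups acting on a signed set of roots with simple reflections -/

/-- A group `G` acting on a set `R` of signed roots, with simple roots `a j` and simple
reflections `s j`, such that `s j` permutes the positive roots other than `a j`. -/
structure ReflSys (G J R : Type*) [Group G] [MulAction G R] where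
  s : J → G
  a : J → R
  pos : R → Prop
  neg : R → R
  neg_neg : ∀ r, neg (neg r) = r
  smul_neg : ∀ (g : G) r, g • neg r = neg (g • r)
  pos_neg : ∀ r, pos (neg r) ↔ ¬ pos r
  pos_a : ∀ j, pos (a j)
  s_mul_self : ∀ j, s j * s j = 1
  s_smul_a : ∀ j, s j • a j = neg (a j)
  pos_s : ∀ j r, pos r → r ≠ a j → pos (s j • r)
  conj : ∀ (g : G) i j, g • a i = a j → s j * g = g * s i
  finite_inv : ∀ g : G, {r | pos r ∧ ¬ pos (g • r)}.Finite
  pos_of : ∀ g : G, (∀ j, pos (g • a j)) → ∀ r, pos r → pos (g • r)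

namespace ReflSys

variable {G J R : Type*} [Group G] [MulAction G R] (S : ReflSys G J R)

/-- The set of positive roots made negative by `g`. -/
def inv (g : G) : Set R := {r | S.pos r ∧ ¬ S.pos (g • r)}

lemma finite_inv' (g : G) : (S.inv g).Finite := S.finite_inv g

/-- The length function. -/
def len (g : G) : ℕ := (S.inv g).ncard

/-- The product of a word in the simple reflections. -/
def wprod (L : List J) : G := (L.map S.s).prod

@[simp] lemma wprod_nil : S.wprod [] = 1 := rfl

@[simp] lemma wprod_cons (j : J) (L : List J) : S.wprod (j :: L) = S.s j * S.wprod L := by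
  simp [wprod]

@[simp] lemma wprod_append (L L' : List J) : S.wprod (L ++ L') = S.wprod L * S.wprod L' := by
  simp [wprod]

lemma wprod_reverse (L : List J) : S.wprod L.reverse = (S.wprod L)⁻¹ := by
  induction L with
  | nil => simp
  | cons j L ih =>
    simp [ih, inv_eq_of_mul_eq_one_left (S.s_mul_self j)]

lemma s_inv (j : J) : (S.s j)⁻¹ = S.s j := inv_eq_of_mul_eq_one_left (S.s_mul_self j)

lemma s_mul_cancel (j : J) (g : G) : S.s j * (S.s j * g) = g := by
  rw [← mul_assoc, S.s_mul_self, one_mul]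

lemma mul_s_cancel (j : J) (g : G) : g * S.s j * S.s j = g := by
  rw [mul_assoc, S.s_mul_self, mul_one]

lemma s_smul_s_smul (j : J) (r : R) : S.s j • S.s j • r = r := by
  rw [← mul_smul, S.s_mul_self, one_smul]

lemma not_pos_neg {r : R} (h : S.pos r) : ¬ S.pos (S.neg r) := by
  rw [S.pos_neg]; exact not_not.mpr h

lemma pos_s_iff {j : J} {r : R} (h1 : r ≠ S.a j) (h2 : r ≠ S.neg (S.a j)) :
    S.pos (S.s j • r) ↔ S.pos r := by
  constructor
  · intro h
    have h3 := S.pos_s j _ h (fun e => h2 (by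
      rw [← S.s_smul_a, ← e, S.s_smul_s_smul]))
    rwa [S.s_smul_s_smul] at h3
  · exact fun h => S.pos_s j r h h1

lemma not_pos_s_smul_a (j : J) : ¬ S.pos (S.s j • S.a j) := by
  rw [S.s_smul_a]; exact S.not_pos_neg (S.pos_a j)

lemma eq_a_of_pos_of_not_pos {j : J} {r : R} (h1 : S.pos r) (h2 : ¬ S.pos (S.s j • r)) :
    r = S.a j := by
  by_contra h
  exact h2 (S.pos_s j r h1 h)

/-- If `u` undoes no inversion of `v`, the inversions of `u * v` are the disjoint union of those of
`v` and the `v⁻¹`-translates of those of `u`. All additivity statements for lengths, and hence all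
products T_u T_v = T_{uv}, are reduced to this criterion. -/
lemma len_mul_of_forall {u v : G}
    (h : ∀ r, S.pos r → ¬ S.pos (v • r) → ¬ S.pos (u • v • r)) :
    S.len (u * v) = S.len u + S.len v := by
  have key : S.inv (u * v) = S.inv v ∪ (fun r => v⁻¹ • r) '' S.inv u := by
    ext r
    simp only [inv, Set.mem_ofPred_eq, Set.mem_union, Set.mem_image, mul_smul]
    constructor
    · rintro ⟨h1, h2⟩
      by_cases h3 : S.pos (v • r)
      · exact Or.inr ⟨v • r, ⟨h3, h2⟩, by simp⟩
      · exact Or.inl ⟨h1, h3⟩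
    · rintro (⟨h1, h2⟩ | ⟨b, ⟨h1, h2⟩, rfl⟩)
      · exact ⟨h1, h r h1 h2⟩
      · refine ⟨?_, by simpa using h2⟩
        -- If `v⁻¹ • b` were negative, its negative would be an inversion of `v` that `u` makes
        -- positive again.
        by_contra h3
        have h4 := h (S.neg (v⁻¹ • b)) (by rw [S.pos_neg]; exact h3) (by
          rw [S.smul_neg, smul_inv_smul]; exact S.not_pos_neg h1)
        rw [S.smul_neg, smul_inv_smul, S.smul_neg, S.pos_neg] at h4
        exact h4 h2
  have hd : Disjoint (S.inv v) ((fun r => v⁻¹ • r) '' S.inv u) := by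
    rw [Set.disjoint_left]
    rintro _ ⟨_, h2⟩ ⟨b, ⟨h3, _⟩, rfl⟩
    exact h2 (by simpa using h3)
  rw [len, key, Set.ncard_union_eq hd (S.finite_inv v) ((S.finite_inv u).image _),
    Set.ncard_image_of_injective _ (MulAction.injective _), add_comm]
  rfl

lemma inv_one : S.inv 1 = ∅ := by
  ext r; simp only [inv, one_smul, Set.mem_ofPred_eq, Set.mem_empty_iff_false]; tauto

@[simp] lemma len_one : S.len 1 = 0 := by rw [len, inv_one, Set.ncard_empty]

lemma inv_s (j : J) : S.inv (S.s j) = {S.a j} := by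
  ext r
  simp only [inv, Set.mem_ofPred_eq, Set.mem_singleton_iff]
  constructor
  · rintro ⟨h1, h2⟩; exact S.eq_a_of_pos_of_not_pos h1 h2
  · rintro rfl; exact ⟨S.pos_a j, S.not_pos_s_smul_a j⟩

@[simp] lemma len_s (j : J) : S.len (S.s j) = 1 := by rw [len, inv_s, Set.ncard_singleton]

lemma len_mul_s {g : G} {j : J} (h : S.pos (g • S.a j)) : S.len (g * S.s j) = S.len g + 1 := by
  rw [← S.len_s j]
  apply S.len_mul_of_forall
  intro r h1 h2
  rw [S.eq_a_of_pos_of_not_pos h1 h2, S.s_smul_a, S.smul_neg]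
  exact S.not_pos_neg h

lemma len_mul_s_of_not {g : G} {j : J} (h : ¬ S.pos (g • S.a j)) :
    S.len (g * S.s j) + 1 = S.len g := by
  rw [← S.len_mul_s (j := j), S.mul_s_cancel]
  rw [mul_smul, S.s_smul_a, S.smul_neg, S.pos_neg]
  exact h

lemma len_s_mul {g : G} {j : J} (h : S.pos (g⁻¹ • S.a j)) :
    S.len (S.s j * g) = S.len g + 1 := by
  rw [← S.len_s j, add_comm]
  apply S.len_mul_of_forall
  intro r h1 h2 h3
  rw [← S.pos_neg, ← S.smul_neg] at h2
  have h4 : S.neg (g • r) = S.a j := by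
    rw [← S.smul_neg]
    apply S.eq_a_of_pos_of_not_pos h2
    rw [S.smul_neg, S.smul_neg]
    exact S.not_pos_neg h3
  rw [← h4, S.smul_neg, inv_smul_smul] at h
  exact S.not_pos_neg h1 h

lemma len_s_mul_of_not {g : G} {j : J} (h : ¬ S.pos (g⁻¹ • S.a j)) :
    S.len (S.s j * g) + 1 = S.len g := by
  rw [← S.len_s_mul (j := j), S.s_mul_cancel]
  rw [mul_inv_rev, S.s_inv, mul_smul, S.s_smul_a, S.smul_neg, S.pos_neg]
  exact h

lemma len_mul_s_iff {g : G} {j : J} : S.len g < S.len (g * S.s j) ↔ S.pos (g • S.a j) := by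
  by_cases h : S.pos (g • S.a j)
  · simp [h, S.len_mul_s h]
  · have := S.len_mul_s_of_not h
    simp only [h, iff_false]; omega

lemma len_wprod_le (L : List J) : S.len (S.wprod L) ≤ L.length := by
  induction L with
  | nil => simp
  | cons j L ih =>
    rw [wprod_cons, List.length_cons]
    by_cases h : S.pos ((S.wprod L)⁻¹ • S.a j)
    · rw [S.len_s_mul h]; omega
    · have := S.len_s_mul_of_not h
      omega

/-- A word is reduced if its length is the length of its product. -/
def IsRed (L : List J) : Prop := L.length = S.len (S.wprod L)

lemma len_mul_le (u : G) (L : List J) : S.len (u * S.wprod L) ≤ S.len u + L.length := by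
  induction L generalizing u with
  | nil => simp
  | cons j L ih =>
    rw [wprod_cons, ← mul_assoc, List.length_cons]
    have h1 := ih (u * S.s j)
    by_cases h : S.pos (u • S.a j)
    · rw [S.len_mul_s h] at h1; omega
    · have := S.len_mul_s_of_not h
      omega

lemma IsRed.of_append {L L' : List J} (h : S.IsRed (L ++ L')) : S.IsRed L := by
  rw [IsRed, List.length_append, wprod_append] at h
  have h1 := S.len_wprod_le L
  have h2 := S.len_mul_le (S.wprod L) L'
  rw [IsRed]; omega

lemma IsRed.tail {j : J} {L : List J} (h : S.IsRed (j :: L)) :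
    S.IsRed L ∧ S.pos ((S.wprod L)⁻¹ • S.a j) := by
  rw [IsRed, wprod_cons, List.length_cons] at h
  have h1 := S.len_wprod_le L
  by_cases h2 : S.pos ((S.wprod L)⁻¹ • S.a j)
  · rw [S.len_s_mul h2] at h
    exact ⟨by rw [IsRed]; omega, h2⟩
  · have := S.len_s_mul_of_not h2
    omega

lemma isRed_nil : S.IsRed [] := by simp [IsRed]

lemma IsRed.cons {j : J} {L : List J} (h : S.IsRed L) (h2 : S.pos ((S.wprod L)⁻¹ • S.a j)) :
    S.IsRed (j :: L) := by
  rw [IsRed] at *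
  rw [wprod_cons, S.len_s_mul h2, List.length_cons, h]

lemma IsRed.concat {j : J} {L : List J} (h : S.IsRed L) (h2 : S.pos (S.wprod L • S.a j)) :
    S.IsRed (L ++ [j]) := by
  rw [IsRed] at *
  rw [wprod_append, wprod_cons, wprod_nil, mul_one, S.len_mul_s h2, List.length_append, h]
  rfl

/-- The exchange condition. -/
lemma exchange (L : List J) (j : J) (h : ¬ S.pos ((S.wprod L)⁻¹ • S.a j)) :
    ∃ n < L.length, S.s j * S.wprod (L.take n) = S.wprod (L.take (n + 1)) := by
  induction L using List.reverseRecOn with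
  | nil => simp [S.pos_a] at h
  | append_singleton L t ih =>
    by_cases h1 : S.pos ((S.wprod L)⁻¹ • S.a j)
    · refine ⟨L.length, by simp, ?_⟩
      rw [List.take_left, List.take_of_length_le (by simp)]
      rw [wprod_append, mul_inv_rev, mul_smul] at h
      simp only [wprod_cons, wprod_nil, mul_one, S.s_inv] at h
      have h2 := S.eq_a_of_pos_of_not_pos h1 h
      rw [inv_smul_eq_iff] at h2
      rw [S.conj _ _ _ h2.symm, wprod_append, wprod_cons, wprod_nil, mul_one]
    · obtain ⟨n, hn, h2⟩ := ih h1
      refine ⟨n, by simp; omega, ?_⟩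
      rwa [List.take_append_of_le_length hn.le, List.take_append_of_le_length hn]

lemma wprod_eraseIdx {L : List J} {j : J} {n : ℕ}
    (h : S.s j * S.wprod (L.take n) = S.wprod (L.take (n + 1))) :
    S.wprod (L.eraseIdx n) = S.s j * S.wprod L := by
  rw [List.eraseIdx_eq_take_drop_succ, wprod_append]
  conv_rhs => rw [← List.take_append_drop (n + 1) L, wprod_append, ← h]
  rw [← mul_assoc, S.s_mul_cancel]

/-- A letter that does not lengthen the product cancels against another letter by the exchange
condition. -/
lemma exists_isRed (L : List J) : ∃ L', S.wprod L' = S.wprod L ∧ S.IsRed L' := by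
  induction L with
  | nil => exact ⟨[], rfl, S.isRed_nil⟩
  | cons j L ih =>
    obtain ⟨L', h1, h2⟩ := ih
    by_cases h : S.pos ((S.wprod L')⁻¹ • S.a j)
    · exact ⟨j :: L', by simp [h1], h2.cons S h⟩
    · obtain ⟨n, hn, h3⟩ := S.exchange L' j h
      refine ⟨L'.eraseIdx n, by rw [S.wprod_eraseIdx h3, h1, wprod_cons], ?_⟩
      have h4 := S.len_s_mul_of_not h
      rw [IsRed, S.wprod_eraseIdx h3, List.length_eraseIdx_of_lt hn]
      rw [IsRed] at h2
      omega

/-! ### Elements of length zero and the decomposition into a reflection part and a length-zero part.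
-/

lemma wprod_eq_one_of_len {L : List J} (h : S.len (S.wprod L) = 0) : S.wprod L = 1 := by
  obtain ⟨L', h1, h2⟩ := S.exists_isRed L
  rw [IsRed, h1, h, List.length_eq_zero_iff] at h2
  rw [← h1, h2, wprod_nil]

lemma pos_smul_of_len {g : G} (h : S.len g = 0) (r : R) (hr : S.pos r) : S.pos (g • r) := by
  rw [len, Set.ncard_eq_zero (S.finite_inv' g)] at h
  by_contra h1
  have : r ∈ S.inv g := ⟨hr, h1⟩
  rw [h] at this
  exact this

lemma pos_smul_iff_of_len {g : G} (h : S.len g = 0) (r : R) : S.pos (g • r) ↔ S.pos r := by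
  refine ⟨fun h1 => ?_, S.pos_smul_of_len h r⟩
  by_contra h2
  rw [← S.pos_neg] at h2
  have := S.pos_smul_of_len h _ h2
  rw [S.smul_neg] at this
  exact S.not_pos_neg h1 this

lemma len_eq_zero_of_forall {g : G} (h : ∀ r, S.pos r → S.pos (g • r)) : S.len g = 0 := by
  rw [len, Set.ncard_eq_zero (S.finite_inv' g)]
  ext r
  simp only [inv, Set.mem_ofPred_eq, Set.mem_empty_iff_false, iff_false, not_and, not_not]
  exact h r

lemma len_inv_of_len {g : G} (h : S.len g = 0) : S.len g⁻¹ = 0 := by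
  apply S.len_eq_zero_of_forall
  intro r hr
  rwa [← S.pos_smul_iff_of_len h, smul_inv_smul]

lemma len_mul_of_len_right {u v : G} (h : S.len v = 0) : S.len (u * v) = S.len u := by
  rw [S.len_mul_of_forall, h, add_zero]
  intro r h1 h2
  exact absurd (S.pos_smul_of_len h r h1) h2

lemma len_mul_of_len_left {u v : G} (h : S.len u = 0) : S.len (u * v) = S.len v := by
  rw [S.len_mul_of_forall, h, zero_add]
  intro r h1 h2
  rwa [S.pos_smul_iff_of_len h]

/-- The axiom `pos_of` replaces the fact that positive roots are nonnegative combinations of simple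
ones: an element that inverts no simple root inverts no positive root. -/
lemma exists_descent {g : G} (h : S.len g ≠ 0) : ∃ j, ¬ S.pos (g⁻¹ • S.a j) := by
  by_contra! h1
  apply h
  have h2 := S.len_inv_of_len (S.len_eq_zero_of_forall (S.pos_of _ h1))
  rwa [inv_inv] at h2

lemma exists_descent_right {g : G} (h : S.len g ≠ 0) : ∃ j, ¬ S.pos (g • S.a j) := by
  by_contra! h1
  exact h (S.len_eq_zero_of_forall (S.pos_of _ h1))

lemma exists_expr (g : G) : ∃ L o, S.len o = 0 ∧ S.wprod L * o = g ∧ L.length = S.len g := by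
  induction hn : S.len g generalizing g with
  | zero => exact ⟨[], g, hn, by simp, rfl⟩
  | succ n ih =>
    obtain ⟨j, hj⟩ := S.exists_descent (g := g) (by omega)
    have h1 := S.len_s_mul_of_not hj
    obtain ⟨L, o, h2, h3, h4⟩ := ih (S.s j * g) (by omega)
    refine ⟨j :: L, o, h2, ?_, by simp [h4]⟩
    rw [wprod_cons, mul_assoc, h3, S.s_mul_cancel]

/-- The conjugate `o * s j * o⁻¹` has `o • a j` as its only inversion. An element of positive length
inverts some simple root, so this single inversion is simple. -/
lemma exists_smul_a_eq {o : G} (h : S.len o = 0) (j : J) : ∃ i, o • S.a j = S.a i := by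
  have h1 : S.inv (o * S.s j * o⁻¹) = {o • S.a j} := by
    ext r
    simp only [inv, Set.mem_ofPred_eq, Set.mem_singleton_iff, mul_smul]
    rw [S.pos_smul_iff_of_len h, ← S.pos_smul_iff_of_len (S.len_inv_of_len h) r,
      ← inv_smul_eq_iff]
    constructor
    · rintro ⟨h1, h2⟩; exact S.eq_a_of_pos_of_not_pos h1 h2
    · intro e; rw [e]; exact ⟨S.pos_a j, S.not_pos_s_smul_a j⟩
  obtain ⟨i, hi⟩ := S.exists_descent_right (g := o * S.s j * o⁻¹) (by rw [len, h1]; simp)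
  have h2 : S.a i ∈ S.inv (o * S.s j * o⁻¹) := ⟨S.pos_a i, hi⟩
  rw [h1] at h2
  exact ⟨i, (Set.mem_singleton_iff.mp h2).symm⟩

/-- The quotient of the two words equals `o' * o⁻¹` and has length zero, and a word of length zero
is trivial. This is the uniqueness half of the semidirect decomposition of the group. -/
lemma eq_of_wprod_mul_eq {L L' : List J} {o o' : G} (ho : S.len o = 0) (ho' : S.len o' = 0)
    (h : S.wprod L * o = S.wprod L' * o') : S.wprod L = S.wprod L' ∧ o = o' := by
  have h1 : S.wprod (L'.reverse ++ L) = o' * o⁻¹ := by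
    rw [wprod_append, wprod_reverse, eq_mul_inv_iff_mul_eq, mul_assoc, h, inv_mul_cancel_left]
  have h2 := S.wprod_eq_one_of_len (L := L'.reverse ++ L) (by
    rw [h1, S.len_mul_of_len_left ho', S.len_inv_of_len ho])
  rw [h1, mul_inv_eq_one] at h2
  subst h2
  exact ⟨mul_right_cancel h, rfl⟩

/-! ### Alternating words and braid relations -/

/-- The alternating word `i j i ⋯` with `m` letters. -/
def altList : ℕ → J → J → List J
  | 0, _, _ => []
  | m + 1, i, j => i :: altList m j i

@[simp] lemma length_altList (m : ℕ) (i j : J) : (altList m i j).length = m := by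
  induction m generalizing i j with
  | zero => rfl
  | succ m ih => simp [altList, ih]

lemma take_altList {n m : ℕ} (h : n ≤ m) (i j : J) :
    (altList m i j).take n = altList n i j := by
  induction n generalizing m i j with
  | zero => simp [altList]
  | succ n ih =>
    obtain ⟨m, rfl⟩ : ∃ m', m = m' + 1 := ⟨m - 1, by omega⟩
    simp [altList, ih (show n ≤ m by omega)]

lemma map_altList_prod {A : Type*} [Monoid A] (t : J → A) (m : ℕ) (i j : J) :
    ((altList m i j).map t).prod = altProd m (t i) (t j) := by
  induction m generalizing i j with
  | zero => rfl
  | succ m ih => simp [altList, altProd, ih]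

lemma wprod_altList (m : ℕ) (i j : J) : S.wprod (altList m i j) = altProd m (S.s i) (S.s j) :=
  map_altList_prod _ _ _ _

end ReflSys

lemma altProd_mul_inv {G : Type*} [Group G] {x y : G} (hx : x * x = 1) (hy : y * y = 1) (p : ℕ) :
    altProd p x y * (altProd p y x)⁻¹ = (x * y) ^ p := by
  have hx' : x⁻¹ = x := inv_eq_of_mul_eq_one_left hx
  have hy' : y⁻¹ = y := inv_eq_of_mul_eq_one_left hy
  induction p with
  | zero => simp [altProd]
  | succ p ih =>
    have h1 : altProd p y x * (altProd p x y)⁻¹ = (y * x) ^ p := by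
      have h2 := congrArg (fun z => z⁻¹) ih
      simp only [mul_inv_rev, inv_inv, ← inv_pow, hx', hy'] at h2
      exact h2
    rw [altProd, altProd, mul_inv_rev, hy']
    calc x * altProd p y x * ((altProd p x y)⁻¹ * y)
        = x * (altProd p y x * (altProd p x y)⁻¹) * y := by simp only [mul_assoc]
      _ = x * (y * x) ^ p * y := by rw [h1]
      _ = (x * y) ^ (p + 1) := by
        have h3 : SemiconjBy x (y * x) (x * y) := by simp [SemiconjBy, mul_assoc]
        rw [(h3.pow_right p).eq, pow_succ, mul_assoc]

lemma altProd_eq_iff {G : Type*} [Group G] {x y : G} (hx : x * x = 1) (hy : y * y = 1) (p : ℕ) :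
    altProd p x y = altProd p y x ↔ (x * y) ^ p = 1 := by
  rw [← altProd_mul_inv hx hy, mul_inv_eq_one]

/-! ### Reduced alternating words and Matsumoto's theorem. -/

namespace ReflSys

variable {G J R : Type*} [Group G] [MulAction G R] (S : ReflSys G J R)

lemma altProd_pow (i j : J) (p : ℕ) :
    altProd p (S.s i) (S.s j) = altProd p (S.s j) (S.s i) ↔ (S.s i * S.s j) ^ p = 1 :=
  altProd_eq_iff (S.s_mul_self i) (S.s_mul_self j) p

lemma pow_swap (i j : J) (p : ℕ) : (S.s i * S.s j) ^ p = 1 ↔ (S.s j * S.s i) ^ p = 1 := by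
  rw [← S.altProd_pow, ← S.altProd_pow, eq_comm]

/-- If prepending a letter to an alternating word failed to lengthen it, the exchange condition
would equate two alternating words with the same number of letters, at most `p - 1` before the
increment, and so give a forbidden relation (s_i s_j)^q = 1. -/
lemma isRed_altList (p : ℕ) (i j : J) (h : ∀ q, 0 < q → q < p → (S.s i * S.s j) ^ q ≠ 1) :
    S.IsRed (altList p i j) := by
  induction p generalizing i j with
  | zero => exact S.isRed_nil
  | succ p ih =>
    have h1 : S.IsRed (altList p j i) :=
      ih j i fun q h2 h3 h4 => h q h2 (by omega) ((S.pow_swap j i q).mp h4)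
    rw [altList]
    apply h1.cons
    by_contra h2
    obtain ⟨n, hn, h3⟩ := S.exchange _ _ h2
    rw [length_altList] at hn
    rw [take_altList hn.le, take_altList hn, ← wprod_cons] at h3
    have h4 : S.wprod (altList (n + 1) i j) = S.wprod (altList (n + 1) j i) := h3
    rw [wprod_altList, wprod_altList, S.altProd_pow] at h4
    exact h (n + 1) (by omega) (by omega) h4

/-- A relation (s_i s_j)^q = 1 with `q < p` would rewrite the reduced prefix with `q + 1` letters as
a word with `q - 1` letters. -/
lemma le_of_isRed_altList {p q : ℕ} {i j : J} (h : S.IsRed (altList p i j)) (hq : 0 < q)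
    (h1 : (S.s i * S.s j) ^ q = 1) : p ≤ q := by
  by_contra! h2
  have h3 : S.IsRed (altList (q + 1) i j) := by
    rw [← take_altList (show q + 1 ≤ p from h2)]
    apply IsRed.of_append S (L' := (altList p i j).drop (q + 1))
    rwa [List.take_append_drop]
  obtain ⟨q, rfl⟩ : ∃ q', q = q' + 1 := ⟨q - 1, by omega⟩
  have h4 : S.wprod (altList (q + 1 + 1) i j) = S.wprod (altList q j i) := by
    rw [altList, wprod_cons, wprod_altList, ← (S.altProd_pow i j (q + 1)).mpr h1, altProd,
      S.s_mul_cancel, wprod_altList]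
  have h5 := S.len_wprod_le (altList q j i)
  rw [IsRed, h4] at h3
  rw [length_altList] at h3 h5
  omega

/-- Apply the exchange condition to the descent `j`. If the removed letter lies in the alternating
prefix, that prefix is already the full braid word. If it lies in the tail, moving it to the front
lengthens the prefix by one, so induction on the length of the tail finishes; the roles of `i` and
`j` swap. -/
lemma exists_altList_aux (n p : ℕ) (i j : J) (L : List J) (hp : 0 < p)
    (h : S.IsRed (altList p i j ++ L)) (hL : L.length = n)
    (hj : ¬ S.pos ((S.wprod (altList p i j ++ L))⁻¹ • S.a j))
    (hi : ¬ S.pos ((S.wprod (altList p i j ++ L))⁻¹ • S.a i)) :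
    ∃ L', IsOfFinOrder (S.s i * S.s j) ∧
      S.wprod (altList (orderOf (S.s i * S.s j)) i j ++ L') = S.wprod (altList p i j ++ L) ∧
      S.IsRed (altList (orderOf (S.s i * S.s j)) i j ++ L') := by
  induction n generalizing p i j L with
  | zero =>
    rw [List.length_eq_zero_iff] at hL
    subst hL
    rw [List.append_nil] at *
    obtain ⟨n, hn, h1⟩ := S.exchange _ _ hj
    rw [length_altList] at hn
    rw [take_altList hn.le, take_altList hn, ← wprod_cons] at h1
    have h4 : S.wprod (altList (n + 1) j i) = S.wprod (altList (n + 1) i j) := h1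
    rw [wprod_altList, wprod_altList, eq_comm, S.altProd_pow] at h4
    have h5 : IsOfFinOrder (S.s i * S.s j) := isOfFinOrder_iff_pow_eq_one.mpr ⟨_, by omega, h4⟩
    -- Reducedness bounds `p` by the order of s_i s_j, while the exchange relation makes this order
    -- divide `n + 1 ≤ p`; so the two agree.
    have h6 := S.le_of_isRed_altList h h5.orderOf_pos (pow_orderOf_eq_one _)
    have h7 := Nat.le_of_dvd (by omega) (orderOf_dvd_of_pow_eq_one h4)
    obtain rfl : p = orderOf (S.s i * S.s j) := by omega
    exact ⟨[], h5, by simp, by simpa using h⟩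
  | succ m ih =>
    obtain ⟨n, hn, h1⟩ := S.exchange _ _ hj
    by_cases hnp : n < p
    · rw [List.take_append_of_le_length (by simpa using hnp.le),
        List.take_append_of_le_length (by simpa using hnp),
        take_altList hnp.le, take_altList hnp, ← wprod_cons] at h1
      have h4 : S.wprod (altList (n + 1) j i) = S.wprod (altList (n + 1) i j) := h1
      rw [wprod_altList, wprod_altList, eq_comm, S.altProd_pow] at h4
      have h5 : IsOfFinOrder (S.s i * S.s j) := isOfFinOrder_iff_pow_eq_one.mpr ⟨_, by omega, h4⟩
      have h6 := S.le_of_isRed_altList (h.of_append) h5.orderOf_pos (pow_orderOf_eq_one _)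
      have h7 := Nat.le_of_dvd (by omega) (orderOf_dvd_of_pow_eq_one h4)
      obtain rfl : p = orderOf (S.s i * S.s j) := by omega
      exact ⟨L, h5, rfl, h⟩
    · have h2 := S.wprod_eraseIdx h1
      rw [List.eraseIdx_append_of_length_le (by simpa using not_lt.mp hnp), length_altList] at h2
      rw [List.length_append, length_altList] at hn
      set L₁ := L.eraseIdx (n - p) with hL₁
      have hlen : L₁.length = m := by
        rw [hL₁, List.length_eraseIdx_of_lt (by omega)]; omega
      have h3 : S.wprod (altList (p + 1) j i ++ L₁) = S.wprod (altList p i j ++ L) := by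
        rw [altList, List.cons_append, wprod_cons, h2, S.s_mul_cancel]
      have hr : S.IsRed (altList (p + 1) j i ++ L₁) := by
        rw [IsRed, h3, ← h]
        simp; omega
      obtain ⟨L', h4, h5, h6⟩ := ih (p + 1) j i L₁ (by omega) hr hlen (by rwa [h3]) (by rwa [h3])
      have ho : orderOf (S.s j * S.s i) = orderOf (S.s i * S.s j) := by
        rw [orderOf_eq_orderOf_iff]; exact fun n => S.pow_swap j i n
      have hf : IsOfFinOrder (S.s i * S.s j) := by
        rw [← orderOf_pos_iff, ← ho]; exact h4.orderOf_pos
      have hw : S.wprod (altList (orderOf (S.s i * S.s j)) i j ++ L') =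
          S.wprod (altList p i j ++ L) := by
        rw [← h3, ← h5, wprod_append, wprod_append, wprod_altList, wprod_altList, ho,
          (S.altProd_pow i j _).mpr (pow_orderOf_eq_one _)]
      refine ⟨L', hf, hw, ?_⟩
      rw [IsRed, hw, ← h3, ← h5, ← h6]
      simp [ho]

/-- If two different simple reflections are left descents of `w`, then `w` has a reduced word
which starts with the longest alternating word. -/
lemma exists_altList {i j : J} {L : List J} (h : S.IsRed (i :: L))
    (hj : ¬ S.pos ((S.wprod (i :: L))⁻¹ • S.a j)) :
    ∃ L', IsOfFinOrder (S.s i * S.s j) ∧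
      S.wprod (altList (orderOf (S.s i * S.s j)) i j ++ L') = S.wprod (i :: L) ∧
      S.IsRed (altList (orderOf (S.s i * S.s j)) i j ++ L') := by
  refine S.exists_altList_aux L.length 1 i j L one_pos h rfl hj ?_
  change ¬ S.pos ((S.wprod (i :: L))⁻¹ • S.a i)
  rw [wprod_cons, mul_inv_rev, mul_smul, S.s_inv, S.s_smul_a, S.smul_neg]
  exact S.not_pos_neg (h.tail).2

/-- Matsumoto's theorem. -/
theorem matsumoto {A : Type*} [Monoid A] (t : J → A)
    (ht : ∀ i j, i ≠ j → IsOfFinOrder (S.s i * S.s j) →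
      altProd (orderOf (S.s i * S.s j)) (t i) (t j) =
        altProd (orderOf (S.s i * S.s j)) (t j) (t i))
    {L L' : List J} (hL : S.IsRed L) (hL' : S.IsRed L') (h : S.wprod L = S.wprod L') :
    (L.map t).prod = (L'.map t).prod := by
  induction hn : L.length generalizing L L' with
  | zero =>
    have h1 : L'.length = 0 := by rw [hL', ← h, ← hL, hn]
    rw [List.length_eq_zero_iff] at hn h1
    rw [hn, h1]
  | succ n ih =>
    have hn' : L'.length = n + 1 := by rw [hL', ← h, ← hL, hn]
    obtain ⟨i, L, rfl⟩ := List.exists_cons_of_length_eq_add_one hn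
    obtain ⟨j, L', rfl⟩ := List.exists_cons_of_length_eq_add_one hn'
    by_cases hij : i = j
    · subst hij
      rw [List.map_cons, List.map_cons, List.prod_cons, List.prod_cons]
      rw [ih hL.tail.1 hL'.tail.1 (by simpa using h) (by simpa using hn)]
    · have hj : ¬ S.pos ((S.wprod (i :: L))⁻¹ • S.a j) := by
        rw [h, wprod_cons, mul_inv_rev, mul_smul, S.s_inv, S.s_smul_a, S.smul_neg]
        exact S.not_pos_neg (hL'.tail).2
      -- Both words are compared with words that start with the two forms of the full braid word and
      -- share the tail `U`. Each comparison has a common first letter, so the induction hypothesis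
      -- applies, and the hypothesis on `t` joins the two.
      obtain ⟨U, hf, h1, h2⟩ := S.exists_altList hL hj
      obtain ⟨m, hm⟩ : ∃ m, orderOf (S.s i * S.s j) = m + 1 :=
        ⟨_, (Nat.succ_pred_eq_of_pos hf.orderOf_pos).symm⟩
      have hb := ht i j hij hf
      have hb' := (S.altProd_pow i j _).mpr (pow_orderOf_eq_one _)
      rw [hm] at h1 h2 hb hb'
      have h3 : S.wprod (altList (m + 1) j i ++ U) = S.wprod (j :: L') := by
        rw [← h, ← h1, wprod_append, wprod_append, wprod_altList, wprod_altList, hb']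
      have h4 : S.IsRed (altList (m + 1) j i ++ U) := by
        rw [IsRed, h3, ← h, ← h1, ← h2]; simp
      have e1 : ((i :: L).map t).prod = ((altList (m + 1) i j ++ U).map t).prod := by
        rw [altList, List.cons_append] at h1 h2
        rw [altList, List.cons_append, List.map_cons, List.map_cons, List.prod_cons,
          List.prod_cons, ih hL.tail.1 h2.tail.1 (by simpa using h1.symm) (by simpa using hn)]
      have e2 : ((j :: L').map t).prod = ((altList (m + 1) j i ++ U).map t).prod := by
        rw [altList, List.cons_append] at h3 h4
        rw [altList, List.cons_append, List.map_cons, List.map_cons, List.prod_cons,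
          List.prod_cons, ih hL'.tail.1 h4.tail.1 (by simpa using h3.symm) (by simpa using hn')]
      rw [e1, e2, List.map_append, List.map_append, List.prod_append, List.prod_append,
        map_altList_prod, map_altList_prod, hb]

end ReflSys

end AffHecke

end

noncomputable section

namespace AffHecke

namespace ReflSys

variable {G J R : Type*} [Group G] [MulAction G R] (S : ReflSys G J R)

/-! ### The regular representation of the Hecke algebra -/

/-- The vector `e_w` of the free module on a set. -/
def ev {X : Type*} (w : X) : X →₀ ℂ := Finsupp.single w 1

lemma ext_ev {X : Type*} {f g : Module.End ℂ (X →₀ ℂ)} (h : ∀ w, f (ev w) = g (ev w)) : f = g :=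
  Finsupp.lhom_ext' fun w => LinearMap.ext_ring (h w)

open scoped Classical in
/-- Left multiplication by `T_j` on the free module on `G`. -/
def leftOp (c : J → ℂ) (j : J) : Module.End ℂ (G →₀ ℂ) :=
  Finsupp.linearCombination ℂ fun w =>
    ev (S.s j * w) + if S.pos (w⁻¹ • S.a j) then 0 else c j • ev w

open scoped Classical in
/-- Right multiplication by `T_j` on the free module on `G`. -/
def rightOp (c : J → ℂ) (j : J) : Module.End ℂ (G →₀ ℂ) :=
  Finsupp.linearCombination ℂ fun w =>
    ev (w * S.s j) + if S.pos (w • S.a j) then 0 else c j • ev w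

/-- Left translation on the free module on `G`. -/
def leftTr (g : G) : Module.End ℂ (G →₀ ℂ) := Finsupp.linearCombination ℂ fun w => ev (g * w)

/-- Right translation on the free module on `G`. -/
def rightTr (g : G) : Module.End ℂ (G →₀ ℂ) := Finsupp.linearCombination ℂ fun w => ev (w * g)

open scoped Classical in
lemma leftOp_ev (c : J → ℂ) (j : J) (w : G) : S.leftOp c j (ev w) =
    ev (S.s j * w) + if S.pos (w⁻¹ • S.a j) then 0 else c j • ev w := by
  simp [leftOp, ev]

open scoped Classical in
lemma rightOp_ev (c : J → ℂ) (j : J) (w : G) : S.rightOp c j (ev w) =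
    ev (w * S.s j) + if S.pos (w • S.a j) then 0 else c j • ev w := by
  simp [rightOp, ev]

lemma leftTr_ev (g w : G) : leftTr g (ev w) = ev (g * w) := by simp [leftTr, ev]

lemma rightTr_ev (g w : G) : rightTr g (ev w) = ev (w * g) := by simp [rightTr, ev]

lemma leftOp_ev_of_pos (c : J → ℂ) {j : J} {w : G} (h : S.pos (w⁻¹ • S.a j)) :
    S.leftOp c j (ev w) = ev (S.s j * w) := by
  rw [leftOp_ev, if_pos h, add_zero]

lemma rightOp_ev_of_pos (c : J → ℂ) {j : J} {w : G} (h : S.pos (w • S.a j)) :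
    S.rightOp c j (ev w) = ev (w * S.s j) := by
  rw [rightOp_ev, if_pos h, add_zero]

/-- Left and right multiplication should commute, but both depend on descents. The signs of w⁻¹a_i
and w a_j are unaffected by multiplying on the other side unless w a_j = ±a_i; in those two cases
s_i w = w s_j and `c i = c j`, so both composites still agree. -/
lemma leftOp_comm_rightOp (c : J → ℂ) (hc : ∀ (g : G) i j, g • S.a i = S.a j → c i = c j)
    (i j : J) : Commute (S.leftOp c i) (S.rightOp c j) := by
  apply ext_ev
  intro w
  simp only [Module.End.mul_apply]
  rw [S.leftOp_ev, S.rightOp_ev, map_add, map_add, S.leftOp_ev, S.rightOp_ev]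
  have e1 : (w * S.s j)⁻¹ • S.a i = S.s j • w⁻¹ • S.a i := by
    rw [mul_inv_rev, S.s_inv, mul_smul]
  rw [e1, mul_smul, mul_assoc]
  by_cases h1 : w • S.a j = S.a i
  · have h2 := S.conj w j i h1
    have h3 := hc w j i h1
    have h4 : w⁻¹ • S.a i = S.a j := by rw [← h1, inv_smul_smul]
    rw [h4, h1]
    simp [S.pos_a, S.not_pos_s_smul_a, h2, h3]
  by_cases h1' : w • S.a j = S.neg (S.a i)
  · have h2' : (S.s i * w) • S.a j = S.a i := by
      rw [mul_smul, h1', S.smul_neg, S.s_smul_a, S.neg_neg]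
    have h2 := S.conj _ j i h2'
    rw [S.s_mul_cancel] at h2
    have h2'' : w * S.s j = S.s i * w := by
      conv_lhs => rw [h2]
      rw [S.mul_s_cancel]
    have h3 := hc _ j i h2'
    have h4 : w⁻¹ • S.a i = S.neg (S.a j) := by
      rw [inv_smul_eq_iff, S.smul_neg, h1', S.neg_neg]
    rw [h4, h1', S.smul_neg, S.smul_neg, S.s_smul_a, S.s_smul_a, S.neg_neg, S.neg_neg]
    simp [S.pos_a, S.pos_neg, h2'', h3, leftOp_ev, rightOp_ev, h4, h1']
  · have h2 : S.pos (S.s i • w • S.a j) ↔ S.pos (w • S.a j) := S.pos_s_iff h1 h1'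
    have h3 : S.pos (S.s j • w⁻¹ • S.a i) ↔ S.pos (w⁻¹ • S.a i) := by
      apply S.pos_s_iff
      · rw [ne_eq, inv_smul_eq_iff]; exact fun e => h1 e.symm
      · rw [ne_eq, inv_smul_eq_iff, S.smul_neg]
        exact fun e => h1' (by rw [e, S.neg_neg])
    by_cases h4 : S.pos (w • S.a j) <;> by_cases h5 : S.pos (w⁻¹ • S.a i) <;>
      simp only [h2.mpr, h3.mpr, mt h2.mp, mt h3.mp, h4, h5, if_true, if_false, map_zero, map_smul,
        leftOp_ev, rightOp_ev, not_false_eq_true, add_zero, smul_add]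
    rw [smul_comm (c i) (c j)]
    abel

lemma leftOp_comm_rightTr (c : J → ℂ) (i : J) {o : G} (ho : S.len o = 0) :
    Commute (S.leftOp c i) (rightTr o) := by
  apply ext_ev
  intro w
  simp only [Module.End.mul_apply]
  rw [rightTr_ev, S.leftOp_ev, S.leftOp_ev, map_add, rightTr_ev, mul_inv_rev, mul_smul,
    mul_assoc]
  have := S.pos_smul_iff_of_len (S.len_inv_of_len ho) (w⁻¹ • S.a i)
  by_cases h : S.pos (w⁻¹ • S.a i) <;> simp [this, h, rightTr_ev]

lemma leftOp_sq (c : J → ℂ) (i : J) :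
    S.leftOp c i * S.leftOp c i = c i • S.leftOp c i + 1 := by
  apply ext_ev
  intro w
  simp only [Module.End.mul_apply, LinearMap.add_apply, LinearMap.smul_apply, Module.End.one_apply]
  have h1 : S.pos ((S.s i * w)⁻¹ • S.a i) ↔ ¬ S.pos (w⁻¹ • S.a i) := by
    rw [mul_inv_rev, S.s_inv, mul_smul, S.s_smul_a, S.smul_neg, S.pos_neg]
  by_cases h : S.pos (w⁻¹ • S.a i)
  · rw [S.leftOp_ev_of_pos c h, S.leftOp_ev, if_neg (by rwa [h1, not_not]), S.s_mul_cancel,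
      add_comm]
  · rw [S.leftOp_ev, if_neg h, map_add, S.leftOp_ev_of_pos c (h1.mpr h), S.s_mul_cancel,
      map_smul, S.leftOp_ev, if_neg h, add_comm]

lemma leftTr_mul_leftOp (c : J → ℂ) (g : G) {i j : J} (h : g • S.a i = S.a j) (hc : c i = c j) :
    leftTr g * S.leftOp c i = S.leftOp c j * leftTr g := by
  apply ext_ev
  intro w
  simp only [Module.End.mul_apply]
  rw [leftTr_ev, S.leftOp_ev, S.leftOp_ev, map_add, leftTr_ev, mul_inv_rev, mul_smul,
    ← mul_assoc, ← mul_assoc, S.conj g i j h, ← h, inv_smul_smul]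
  by_cases h : S.pos (w⁻¹ • S.a i) <;> simp [h, leftTr_ev, hc]

lemma leftOp_word_ev_one (c : J → ℂ) {L : List J} (h : S.IsRed L) :
    (L.map (S.leftOp c)).prod (ev 1) = ev (S.wprod L) := by
  induction L with
  | nil => simp
  | cons j L ih =>
    rw [List.map_cons, List.prod_cons, Module.End.mul_apply, ih h.tail.1,
      S.leftOp_ev_of_pos c h.tail.2, wprod_cons]

/-- Both alternating products send the vector of `1` to the vector of the same group element,
because alternating words of this length are reduced. They commute with right multiplication by
simple reflections and by length-zero elements, so agreement spreads from `1` along a reduced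
expression to every basis vector. -/
lemma leftOp_braid (c : J → ℂ) (hc : ∀ (g : G) i j, g • S.a i = S.a j → c i = c j) (i j : J) :
    altProd (orderOf (S.s i * S.s j)) (S.leftOp c i) (S.leftOp c j) =
      altProd (orderOf (S.s i * S.s j)) (S.leftOp c j) (S.leftOp c i) := by
  set m := orderOf (S.s i * S.s j) with hm
  have hcomm (L : List J) (f : Module.End ℂ (G →₀ ℂ)) (hf : ∀ i, Commute (S.leftOp c i) f) :
      Commute (L.map (S.leftOp c)).prod f := by
    induction L with
    | nil => simp
    | cons j L ih => rw [List.map_cons, List.prod_cons]; exact (hf j).mul_left ih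
  rw [← map_altList_prod, ← map_altList_prod]
  have hr : ∀ q, 0 < q → q < m → (S.s i * S.s j) ^ q ≠ 1 :=
    fun q h1 h2 h3 => absurd (orderOf_le_of_pow_eq_one h1 h3) (by omega)
  have h1 : ((altList m i j).map (S.leftOp c)).prod (ev 1) =
      ((altList m j i).map (S.leftOp c)).prod (ev 1) := by
    rw [S.leftOp_word_ev_one c (S.isRed_altList m i j hr),
      S.leftOp_word_ev_one c (S.isRed_altList m j i fun q h1 h2 h3 =>
        hr q h1 h2 ((S.pow_swap j i q).mp h3)), wprod_altList, wprod_altList,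
      (S.altProd_pow i j m).mpr (pow_orderOf_eq_one _)]
  set X := ((altList m i j).map (S.leftOp c)).prod with hX
  set X' := ((altList m j i).map (S.leftOp c)).prod with hX'
  have h2 (L : List J) (hL : S.IsRed L) : X (ev (S.wprod L)) = X' (ev (S.wprod L)) := by
    induction L using List.reverseRecOn with
    | nil => exact h1
    | append_singleton L t ih =>
      have h3 := hL.of_append
      have h4 : S.pos (S.wprod L • S.a t) := by
        by_contra h5
        have h6 := S.len_mul_s_of_not h5
        rw [IsRed] at hL h3
        simp only [List.length_append, wprod_append, wprod_cons, wprod_nil, mul_one,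
          List.length_singleton] at hL
        omega
      have h5 := (hcomm (altList m i j) _ fun i => S.leftOp_comm_rightOp c hc i t).eq
      have h6 := (hcomm (altList m j i) _ fun i => S.leftOp_comm_rightOp c hc i t).eq
      rw [wprod_append, wprod_cons, wprod_nil, mul_one, ← S.rightOp_ev_of_pos c h4]
      rw [← Module.End.mul_apply, ← Module.End.mul_apply, h5, h6, Module.End.mul_apply,
        Module.End.mul_apply, ih h3]
  apply ext_ev
  intro w
  obtain ⟨L, o, h3, rfl, h4⟩ := S.exists_expr w
  have h5 := (hcomm (altList m i j) _ fun i => S.leftOp_comm_rightTr c i h3).eq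
  have h6 := (hcomm (altList m j i) _ fun i => S.leftOp_comm_rightTr c i h3).eq
  rw [← rightTr_ev, ← Module.End.mul_apply, ← Module.End.mul_apply, h5, h6, Module.End.mul_apply,
    Module.End.mul_apply, h2 L]
  rw [IsRed, h4, S.len_mul_of_len_right h3]

end ReflSys

end AffHecke

end

noncomputable section

set_option linter.unusedSectionVars false

namespace AffHecke

variable {ι V N : Type*} [AddCommGroup V] [Module ℝ V] [AddCommGroup N] [Module ℝ N]

/-! ### The finite Weyl group as a reflection system -/

section Finite

variable {P : RootPairing ι ℝ V N}

lemma ofIdx_smul_index (i j : ι) :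
    RootPairing.weylGroup.ofIdx P j • i = P.reflectionPerm j i := rfl

lemma root_smul (w : P.weylGroup) (i : ι) : P.root (w • i) = w • P.root i :=
  (RootPairing.weylGroup_apply_root P w i).symm

lemma weylN_coroot (w : P.weylGroup) (i : ι) : weylN P w (P.coroot i) = P.coroot (w • i) := by
  have h := RootPairing.Hom.coroot_coweightMap_apply P P i ((w⁻¹ : P.weylGroup) : P.Aut).toHom
  have h1 : ((w⁻¹ : P.weylGroup) : P.Aut).toHom.indexEquiv.symm i = w • i := by
    rw [Equiv.symm_apply_eq]
    exact (inv_smul_smul w i).symm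
  rw [h1] at h
  exact h

lemma pairing_smul (w : P.weylGroup) (i j : ι) :
    P.pairing (w • i) (w • j) = P.pairing i j := by
  rw [← P.root'_coroot_eq_pairing, ← P.root'_coroot_eq_pairing, ← weylN_coroot, root_smul_weylN]

lemma smul_reflectionPerm (w : P.weylGroup) (i j : ι) :
    w • P.reflectionPerm j i = P.reflectionPerm (w • j) (w • i) := by
  apply P.root.injective
  have h (x : V) (c : ℝ) : w • (c • x) = c • (w • x) := smul_comm (w : P.Aut) c x
  rw [root_smul, P.root_reflectionPerm, P.root_reflectionPerm, P.reflection_apply_root,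
    P.reflection_apply_root, pairing_smul, smul_sub, h, root_smul, root_smul]

lemma weylGroup_ext [P.IsRootSystem] {v w : P.weylGroup} (h : ∀ i : ι, v • i = w • i) : v = w := by
  apply Subtype.ext
  apply RootPairing.Equiv.weightHom_injective P
  apply LinearEquiv.toLinearMap_injective
  apply LinearMap.ext_on_range (v := P.root) RootPairing.IsRootSystem.span_root_eq_top
  intro i
  have hv := root_smul v i
  rw [h i, root_smul] at hv
  exact hv.symm

lemma ofIdx_mul_self [P.IsRootSystem] (i : ι) :
    RootPairing.weylGroup.ofIdx P i * RootPairing.weylGroup.ofIdx P i = 1 := by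
  apply weylGroup_ext
  intro j
  rw [mul_smul, ofIdx_smul_index, ofIdx_smul_index, P.reflectionPerm_self, one_smul]

lemma ofIdx_mul [P.IsRootSystem] (w : P.weylGroup) (i : ι) :
    RootPairing.weylGroup.ofIdx P (w • i) * w = w * RootPairing.weylGroup.ofIdx P i := by
  apply weylGroup_ext
  intro j
  rw [mul_smul, mul_smul, ofIdx_smul_index, ofIdx_smul_index, smul_reflectionPerm]

lemma height_reflectionPerm [P.IsCrystallographic] (b : P.Base) (i j : ι) :
    b.height (P.reflectionPerm j i) = b.height i - P.pairingIn ℤ i j * b.height j := by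
  have := P.reflection_apply_root' ℤ (i := j) (j := i)
  rw [← P.root_reflectionPerm, sub_eq_add_neg, ← neg_smul] at this
  rw [b.height_add_zsmul this, smul_eq_mul]
  ring

lemma pairingIn_smul [P.IsCrystallographic] (w : P.weylGroup) (i j : ι) :
    P.pairingIn ℤ (w • i) (w • j) = P.pairingIn ℤ i j := by
  apply (algebraMap ℤ ℝ).injective_int
  rw [P.algebraMap_pairingIn, P.algebraMap_pairingIn, pairing_smul]

lemma height_neg (b : P.Base) (i : ι) : b.height (P.reflectionPerm i i) = - b.height i :=
  b.height_reflectionPerm_self i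

lemma isPos_neg_iff (b : P.Base) (i : ι) : b.IsPos (P.reflectionPerm i i) ↔ ¬ b.IsPos i :=
  RootPairing.Base.IsPos.neg_iff_not b i

lemma neg_neg_index (i : ι) :
    P.reflectionPerm (P.reflectionPerm i i) (P.reflectionPerm i i) = i := by
  apply P.root.injective
  rw [P.root_reflectionPerm, P.reflection_apply_self, P.root_reflectionPerm,
    P.reflection_apply_self, neg_neg]

variable [Finite ι] [P.IsCrystallographic] [P.IsReduced] (b : P.Base)

/-- A nonsimple positive root has positive pairing with some simple root; reflecting in it gives a
positive root of smaller height, and the original root is the reflected one plus a positive multiple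
of that simple root. -/
lemma isPos_smul_of_simple (w : P.weylGroup) (h : ∀ j : b.support, b.IsPos (w • (j : ι))) (i : ι)
    (hi : b.IsPos i) : b.IsPos (w • i) := by
  induction hn : (b.height i).toNat using Nat.strongRecOn generalizing i with
  | ind n ih =>
    obtain ⟨j, hj, hj'⟩ := hi.exists_mem_support_pos_pairingIn
    rw [P.zero_lt_pairingIn_iff'] at hj'
    rcases eq_or_ne i j with rfl | hij
    · exact h ⟨i, hj⟩
    have h1 := hi.reflectionPerm hj hij
    have h2 := height_reflectionPerm b i j
    rw [RootPairing.Base.height_one_of_mem_support hj] at h2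
    have h3 := ih _ (by
      rw [← hn]
      rw [b.isPos_iff] at hi h1
      omega) _ h1 rfl
    rw [smul_reflectionPerm] at h3
    rw [b.isPos_iff] at h3 ⊢
    rw [height_reflectionPerm, pairingIn_smul] at h3
    have h4 := mul_pos hj' (h ⟨j, hj⟩)
    simp only at h4
    linarith

variable [P.IsRootSystem]

/-- The finite Weyl group with its simple reflections. -/
def finSys : ReflSys P.weylGroup b.support ι where
  s := finRefl b
  a i := i
  pos := b.IsPos
  neg i := P.reflectionPerm i i
  neg_neg := neg_neg_index
  smul_neg w i := smul_reflectionPerm w i i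
  pos_neg := isPos_neg_iff b
  pos_a i := RootPairing.Base.isPos_of_mem_support i.2
  s_mul_self i := ofIdx_mul_self (P := P) (i : ι)
  s_smul_a _ := rfl
  pos_s i _ hr h := hr.reflectionPerm i.2 h
  conj w i j h := by
    have := ofIdx_mul w (i : ι)
    rwa [h] at this
  finite_inv _ := Set.toFinite _
  pos_of w h r hr := isPos_smul_of_simple b w h r hr

/-- Every reflection is conjugate to a simple one by a product of simple reflections
(`induction_reflect`), and the reflections generate the Weyl group. -/
lemma exists_finSys_word (w : P.weylGroup) : ∃ L, (finSys b).wprod L = w ∧ (finSys b).IsRed L := by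
  suffices h : ∃ L, (finSys b).wprod L = w by
    obtain ⟨L, rfl⟩ := h
    exact (finSys b).exists_isRed L
  have hrefl (i : ι) : ∃ L, (finSys b).wprod L = RootPairing.weylGroup.ofIdx P i := by
    induction i using b.induction_reflect with
    | h₀ i hi =>
      obtain ⟨L, hL⟩ := hi
      refine ⟨L, hL.trans ?_⟩
      apply weylGroup_ext
      intro j
      rw [ofIdx_smul_index, ofIdx_smul_index]
      apply P.root.injective
      rw [P.root_reflectionPerm, P.root_reflectionPerm, P.reflection_apply_root,
        P.reflection_apply_root, P.root_reflectionPerm, P.reflection_apply_self,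
        P.pairing_reflectionPerm_self_right]
      simp
    | h₁ i hi => exact ⟨[⟨i, hi⟩], by simp [finSys, finRefl]⟩
    | h₂ i j hi hj =>
      obtain ⟨L, hL⟩ := hi
      refine ⟨⟨j, hj⟩ :: L ++ [⟨j, hj⟩], ?_⟩
      have h1 : (finSys b).s ⟨j, hj⟩ = RootPairing.weylGroup.ofIdx P j := rfl
      have h2 := ofIdx_mul (RootPairing.weylGroup.ofIdx P j) i
      rw [ofIdx_smul_index] at h2
      simp only [List.cons_append, ReflSys.wprod_cons, ReflSys.wprod_append, ReflSys.wprod_nil,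
        mul_one, hL, h1]
      rw [← mul_assoc, ← h2, mul_assoc, ofIdx_mul_self, mul_one]
  obtain ⟨w, hw⟩ := w
  induction hw using RootPairing.weylGroup.induction with
  | mem i => exact hrefl i
  | one => exact ⟨[], rfl⟩
  | mul v w hv hw h1 h2 =>
    obtain ⟨L, hL⟩ := h1
    obtain ⟨L', hL'⟩ := h2
    exact ⟨L ++ L', by rw [ReflSys.wprod_append, hL, hL']; rfl⟩

lemma finLen_eq_zero_iff (w : P.weylGroup) : finLen b w = 0 ↔ w = 1 := by
  constructor
  · intro h
    obtain ⟨L, rfl, -⟩ := exists_finSys_word b w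
    exact (finSys b).wprod_eq_one_of_len h
  · rintro rfl
    exact (finSys b).len_one

end Finite

/-! ### The affine Weyl group as a reflection system -/

section Affine

variable {P : RootPairing ι ℝ V N}

lemma smul_grad (g : ExtWeyl P) (a : AffRoot P) : (g • a).grad = g.right • a.grad := rfl

lemma smul_lvl (g : ExtWeyl P) (a : AffRoot P) :
    (g • a).lvl = a.lvl - pairZ P (g.right • a.grad) g.left.toAdd := rfl

lemma affRefl_smul_grad [P.IsCrystallographic] (a c : AffRoot P) :
    (affRefl P a • c).grad = P.reflectionPerm a.grad c.grad := by rw [affRefl_smul]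

lemma affRefl_smul_lvl [P.IsCrystallographic] (a c : AffRoot P) :
    (affRefl P a • c).lvl = c.lvl - P.pairingIn ℤ c.grad a.grad * a.lvl := by
  rw [affRefl_smul]
  have h := pairZ_smul_corootC (P := P) (P.reflectionPerm a.grad c.grad) a.grad a.lvl
  have h1 : P.pairing (P.reflectionPerm a.grad c.grad) a.grad = - P.pairing c.grad a.grad := by
    rw [← P.pairing_reflectionPerm, P.pairing_reflectionPerm_self_right]
  rw [h1, ← P.algebraMap_pairingIn ℤ] at h
  have h2 : pairZ P (P.reflectionPerm a.grad c.grad) (-(a.lvl • corootC P a.grad)) =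
      a.lvl * P.pairingIn ℤ c.grad a.grad := by
    have : ((pairZ P (P.reflectionPerm a.grad c.grad) (-(a.lvl • corootC P a.grad)) : ℤ) : ℝ) =
      ((a.lvl * P.pairingIn ℤ c.grad a.grad : ℤ) : ℝ) := by
      rw [h]; push_cast; simp
    exact_mod_cast this
  simp only [h2]
  ring

lemma pairZ_reflectionPerm [P.IsCrystallographic] (i j : ι) (x : coweights P) :
    pairZ P (P.reflectionPerm j i) x = pairZ P i x - P.pairingIn ℤ i j * pairZ P j x := by
  have : (pairZ P (P.reflectionPerm j i) x : ℝ) =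
      ((pairZ P i x - P.pairingIn ℤ i j * pairZ P j x : ℤ) : ℝ) := by
    push_cast
    rw [coe_pairZ, coe_pairZ, coe_pairZ]
    have h := P.reflection_apply_root' ℤ (i := j) (j := i)
    rw [← P.root_reflectionPerm] at h
    simp only [RootPairing.root', h, map_sub, map_zsmul, LinearMap.sub_apply,
      LinearMap.smul_apply, zsmul_eq_mul]
  exact_mod_cast this

lemma eq_zero_of_pairZ [P.IsRootSystem] {x : coweights P} (h : ∀ i, pairZ P i x = 0) : x = 0 := by
  apply Subtype.ext
  have h1 : P.toLinearMap.flip (x : N) = 0 := by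
    apply LinearMap.ext_on_range (v := P.root) RootPairing.IsRootSystem.span_root_eq_top
    intro i
    have := coe_pairZ P i x
    rw [h i] at this
    simpa [RootPairing.root'] using this.symm
  exact (LinearMap.IsPerfPair.bijective_right P.toLinearMap).injective (by simpa using h1)

/-- The extended affine Weyl group acts faithfully on affine roots: gradients determine the finite
part, and levels determine the translation because the roots span. Identities in the group can then
be checked on roots. -/
lemma extWeyl_ext [P.IsRootSystem] {g h : ExtWeyl P} (H : ∀ a : AffRoot P, g • a = h • a) :
    g = h := by
  have hr : g.right = h.right := weylGroup_ext fun i =>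
    congrArg AffRoot.grad (H ⟨i, 0⟩)
  apply SemidirectProduct.ext _ hr
  apply Multiplicative.toAdd.injective
  rw [← sub_eq_zero]
  apply eq_zero_of_pairZ
  intro i
  have h1 := congrArg AffRoot.lvl (H ⟨g.right⁻¹ • i, 0⟩)
  rw [smul_lvl, smul_lvl, ← hr] at h1
  simp only [smul_inv_smul] at h1
  rw [sub_eq_add_neg, pairZ_add, pairZ_neg]
  omega

lemma affRefl_mul [P.IsRootSystem] [P.IsCrystallographic] (g : ExtWeyl P) (a : AffRoot P) :
    affRefl P (g • a) * g = g * affRefl P a := by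
  apply extWeyl_ext
  intro c
  rw [mul_smul, mul_smul]
  apply AffRoot.ext
  · rw [affRefl_smul_grad, smul_grad, smul_grad, smul_grad, affRefl_smul_grad,
      smul_reflectionPerm]
  · rw [affRefl_smul_lvl, smul_lvl, smul_lvl, smul_lvl, affRefl_smul_lvl, smul_grad, smul_grad,
      pairingIn_smul, affRefl_smul_grad, smul_reflectionPerm, pairZ_reflectionPerm,
      pairingIn_smul]
    ring

end Affine

end AffHecke

end

noncomputable section

set_option linter.unusedSectionVars false

namespace AffHecke

variable {ι V N : Type*} [AddCommGroup V] [Module ℝ V] [AddCommGroup N] [Module ℝ N]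

/-! ### The highest root -/

section Highest

variable {P : RootPairing ι ℝ V N} [Finite ι] [P.IsRootSystem] [P.IsCrystallographic]
  [P.IsIrreducible] (b : P.Base)

lemma height_le_highest (i : ι) : b.height i ≤ b.height (highest b) :=
  haveI := nonempty_index P
  (Finite.exists_max b.height).choose_spec i

lemma neg_highest_le_height (i : ι) : - b.height (highest b) ≤ b.height i := by
  have := height_le_highest b (P.reflectionPerm i i)
  rw [height_neg] at this
  linarith

lemma height_highest_pos : 0 < b.height (highest b) := by
  have h1 := neg_highest_le_height b (highest b)
  have h2 := b.height_ne_zero (highest b)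
  omega

lemma isPos_highest : b.IsPos (highest b) := height_highest_pos b

/-- A negative pairing would make the sum of the root and φ a root higher than φ. -/
lemma pairingIn_highest_nonneg {i : ι} (hi : b.IsPos i) : 0 ≤ P.pairingIn ℤ i (highest b) := by
  by_contra! h
  rw [b.isPos_iff] at hi
  have hne : P.root i ≠ - P.root (highest b) := by
    intro e
    rw [RootPairing.root_eq_neg_iff] at e
    rw [e, height_neg] at hi
    have := height_highest_pos b
    omega
  obtain ⟨j, hj⟩ := P.root_add_root_mem_of_pairingIn_neg h hne
  have h1 := b.height_add hj
  have h2 := height_le_highest b j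
  omega

/-- If the pairing were p ≥ 2, then s_φ(α) has height at least -h(φ), so (p - 1) h(φ) ≤ h(α). But α
- φ is a root, so its height is nonzero and h(α) < h(φ), a contradiction. -/
lemma pairingIn_highest_le_one {i : ι} (hi : i ≠ highest b) :
    P.pairingIn ℤ i (highest b) ≤ 1 := by
  by_contra! h
  have h1 := height_reflectionPerm b i (highest b)
  have h2 := neg_highest_le_height b (P.reflectionPerm (highest b) i)
  have h3 := height_le_highest b i
  have h4 := height_highest_pos b
  obtain ⟨j, hj⟩ := P.root_sub_root_mem_of_pairingIn_pos (by omega) hi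
  have h5 := b.height_sub hj
  have h6 := b.height_ne_zero j
  nlinarith [lt_of_le_of_ne (show b.height i - b.height (highest b) ≤ 0 by omega) (by omega)]

lemma neg_one_le_pairingIn_highest {i : ι} (hi : i ≠ P.reflectionPerm (highest b) (highest b)) :
    -1 ≤ P.pairingIn ℤ i (highest b) := by
  have h := pairingIn_highest_le_one b (i := P.reflectionPerm i i) (by
    intro e
    apply hi
    rw [← e, neg_neg_index])
  rw [P.pairingIn_reflectionPerm_self_left] at h
  omega

variable [P.IsReduced]

/-- Dominance of φ excludes a negative combination, and irreducibility forces full support: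
otherwise the coroots in the support would span a proper nonzero reflection-stable subspace. Strict
positivity of every coefficient is what the affine descent argument uses. -/
lemma exists_coroot_highest : ∃ f : ι → ℤ, (∀ j ∈ b.support, 0 < f j) ∧
    P.coroot (highest b) = ∑ j ∈ b.support, f j • P.coroot j := by
  obtain ⟨f, hf0, hf1, hf2⟩ := b.flip.exists_root_eq_sum_int (highest b)
  change P.coroot (highest b) = ∑ j ∈ b.support, f j • P.coroot j at hf2
  change Function.support f ⊆ b.support at hf0
  have hsum (i : ι) : P.pairingIn ℤ i (highest b) = ∑ j ∈ b.support, f j * P.pairingIn ℤ i j := by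
    apply (algebraMap ℤ ℝ).injective_int
    rw [P.algebraMap_pairingIn, ← P.root_coroot_eq_pairing, hf2, map_sum, map_sum]
    refine Finset.sum_congr rfl fun j _ => ?_
    rw [map_zsmul, map_mul, P.algebraMap_pairingIn, P.root_coroot_eq_pairing, zsmul_eq_mul]
    simp
  have hdom (j : ι) (hj : j ∈ b.support) : 0 ≤ P.pairingIn ℤ (highest b) j := by
    by_contra! h
    rw [P.pairingIn_lt_zero_iff] at h
    have := pairingIn_highest_nonneg b (RootPairing.Base.isPos_of_mem_support hj)
    omega
  have hpos : 0 < f := by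
    refine hf1.resolve_right fun hneg => ?_
    have h1 := hsum (highest b)
    rw [P.pairingIn_same] at h1
    have h2 : ∑ j ∈ b.support, f j * P.pairingIn ℤ (highest b) j ≤ 0 :=
      Finset.sum_nonpos fun j hj => mul_nonpos_of_nonpos_of_nonneg (hneg.le j) (hdom j hj)
    omega
  refine ⟨f, fun i hi => ?_, hf2⟩
  by_contra h0
  have h0' : f i = 0 := le_antisymm (not_lt.mp h0) (hpos.le i)
  let s : Set ι := Function.support f
  -- For `j` outside the support, ⟨α_j, φ^∨⟩ ≥ 0 is a sum of nonpositive terms, so each term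
  -- vanishes.
  have horth (j : ι) (hj : j ∈ b.support) (hjs : j ∉ s) (l : ι) (hl : l ∈ s) :
      P.flip.IsOrthogonal j l := by
    have h1 := pairingIn_highest_nonneg b (RootPairing.Base.isPos_of_mem_support hj)
    have hterm (l : ι) (hl : l ∈ b.support) : f l * P.pairingIn ℤ j l ≤ 0 := by
      by_cases hls : l ∈ s
      · exact mul_nonpos_of_nonneg_of_nonpos (hpos.le l)
          (b.pairingIn_le_zero_of_ne (fun e => hjs (e ▸ hls)) hj hl)
      · rw [Function.notMem_support.mp hls, zero_mul]
    rw [hsum] at h1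
    have h2 := (Finset.sum_eq_zero_iff_of_nonpos hterm).mp
      (le_antisymm (Finset.sum_nonpos hterm) h1) l (hf0 hl)
    have h3 := (mul_eq_zero.mp h2).resolve_left hl
    have h4 : P.pairing j l = 0 := by rw [← P.algebraMap_pairingIn ℤ, h3, map_zero]
    exact ⟨(P.pairing_eq_zero_iff').mp h4, h4⟩
  let q : Submodule ℝ N := Submodule.span ℝ (P.flip.root '' s)
  have hq : ∀ j, q ∈ Module.End.invtSubmodule (P.flip.reflection j) := by
    rw [← b.flip.forall_mem_support_invtSubmodule_iff]
    intro j hj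
    by_cases hjs : j ∈ s
    · exact Submodule.mem_invtSubmodule_reflection_of_mem _ _
        (Submodule.subset_span (Set.mem_image_of_mem _ hjs))
    · refine (Module.End.mem_invtSubmodule _).mpr fun x hx => ?_
      rwa [Submodule.mem_comap, LinearEquiv.coe_coe,
        (P.flip.isFixedPt_reflection_of_isOrthogonal (horth j hj hjs) hx).eq]
  have hne : q ≠ ⊥ := by
    obtain ⟨j, hj⟩ : s.Nonempty := Function.support_nonempty_iff.mpr hpos.ne'
    intro e
    have h1 : P.flip.root j ∈ q := Submodule.subset_span (Set.mem_image_of_mem _ hj)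
    rw [e, Submodule.mem_bot] at h1
    exact P.flip.ne_zero j h1
  have htop := RootPairing.IsIrreducible.eq_top_of_invtSubmodule_reflection (P := P.flip) q hq hne
  have hli : LinearIndepOn ℝ P.coroot (insert i s) :=
    b.linearIndepOn_coroot.mono (Set.insert_subset hi hf0)
  apply hli.notMem_span_of_insert (Function.notMem_support.mpr h0')
  change P.coroot i ∈ q
  rw [htop]
  trivial

/-- The gradients of the simple affine roots are the α_j and -φ, and φ^∨ is a strictly positive
combination of the α_j^∨. If no pairing were positive, all would vanish, contrary to the existence
of a simple root with nonzero pairing. -/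
lemma exists_pairingIn_pos (i : ι) : ∃ j, 0 < P.pairingIn ℤ i (simpleAff b j).grad := by
  by_contra! h
  obtain ⟨f, hf, hf2⟩ := exists_coroot_highest b
  have h0 := h none
  simp only [simpleAff, P.pairingIn_reflectionPerm_self_right] at h0
  have hs (j : ι) (hj : j ∈ b.support) : P.pairingIn ℤ i j ≤ 0 := h (some ⟨j, hj⟩)
  have hsum : P.pairingIn ℤ i (highest b) = ∑ j ∈ b.support, f j * P.pairingIn ℤ i j := by
    apply (algebraMap ℤ ℝ).injective_int
    rw [P.algebraMap_pairingIn, ← P.root_coroot_eq_pairing, hf2, map_sum, map_sum]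
    refine Finset.sum_congr rfl fun j _ => ?_
    rw [map_zsmul, map_mul, P.algebraMap_pairingIn, P.root_coroot_eq_pairing, zsmul_eq_mul]
    simp
  have hterm (l : ι) (hl : l ∈ b.support) : f l * P.pairingIn ℤ i l ≤ 0 :=
    mul_nonpos_of_nonneg_of_nonpos (hf l hl).le (hs l hl)
  have h1 := (Finset.sum_eq_zero_iff_of_nonpos hterm).mp
    (le_antisymm (Finset.sum_nonpos hterm) (by rw [← hsum]; omega))
  obtain ⟨j, hj, hj'⟩ := b.exists_mem_support_pos_pairingIn_ne_zero i
  have h2 := (mul_eq_zero.mp (h1 j hj)).resolve_left (hf j hj).ne'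
  apply hj'
  have h4 : P.pairing i j = 0 := by rw [← P.algebraMap_pairingIn ℤ, h2, map_zero]
  rw [P.pairing_eq_zero_iff', ← P.algebraMap_pairingIn ℤ] at h4
  exact (algebraMap ℤ ℝ).injective_int (by rw [h4, map_zero])

/-! ### The affine reflection system -/

/-- The height of an affine root with respect to the simple affine roots. -/
def affHeight (a : AffRoot P) : ℤ := b.height a.grad + a.lvl * (b.height (highest b) + 1)

/-- Finite heights are at most h(φ) in absolute value and one level weighs h(φ) + 1, so the level
decides the sign whenever it is nonzero. -/
lemma affPos_iff (a : AffRoot P) : AffPos b a ↔ 0 < affHeight b a := by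
  have h1 := height_le_highest b a.grad
  have h2 := neg_highest_le_height b a.grad
  rw [AffPos, affHeight, b.isPos_iff]
  rcases lt_trichotomy a.lvl 0 with h | h | h
  · have h3 : ¬ (0 < b.height a.grad + a.lvl * (b.height (highest b) + 1)) := by nlinarith
    simp only [h3, iff_false]
    omega
  · simp [h]
  · simp only [h, true_or, true_iff]
    nlinarith

lemma affHeight_affRefl (a c : AffRoot P) : affHeight b (affRefl P a • c) =
    affHeight b c - P.pairingIn ℤ c.grad a.grad * affHeight b a := by
  rw [affHeight, affRefl_smul_grad, affRefl_smul_lvl, height_reflectionPerm, affHeight, affHeight]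
  ring

lemma affHeight_simpleAff (j : Option b.support) : affHeight b (simpleAff b j) = 1 := by
  rw [affHeight]
  cases j with
  | none => simp [simpleAff, height_neg]
  | some i => simp [simpleAff, RootPairing.Base.height_one_of_mem_support i.2]

lemma affPos_neg_iff (a : AffRoot P) : AffPos b (affNeg a) ↔ ¬ AffPos b a := by
  simp only [AffPos, affNeg, isPos_neg_iff]
  rcases lt_trichotomy a.lvl 0 with h | h | h
  · simp [h, h.not_gt, h.ne]
  · simp [h]
  · simp [h, h.not_gt, h.ne']

lemma affNeg_affNeg (a : AffRoot P) : affNeg (affNeg a) = a := by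
  apply AffRoot.ext
  · exact neg_neg_index _
  · simp [affNeg]

/-- The finite reflections keep the level. For s_0 the level changes by the pairing with φ, which
lies in {-1, 0, 1} except at ±φ; these two gradients are treated separately. -/
lemma affPos_simpleRefl (j : Option b.support) (a : AffRoot P) (ha : AffPos b a)
    (hj : a ≠ simpleAff b j) : AffPos b (simpleRefl b j • a) := by
  have hg := affRefl_smul_grad (simpleAff b j) a
  have hl := affRefl_smul_lvl (simpleAff b j) a
  rw [simpleRefl, AffPos, hg, hl]
  cases j with
  | some i =>
    simp only [simpleAff, mul_zero, sub_zero]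
    rcases ha with h | ⟨h, h'⟩
    · exact Or.inl h
    · refine Or.inr ⟨h, h'.reflectionPerm i.2 fun e => hj ?_⟩
      exact AffRoot.ext e h
  | none =>
    have hr : P.reflectionPerm (simpleAff b none).grad a.grad =
        P.reflectionPerm (highest b) a.grad := by
      apply P.root.injective
      simp only [simpleAff, P.root_reflectionPerm, P.reflection_apply_root,
        P.pairing_reflectionPerm_self_right]
      simp only [P.pairing_same]
      module
    have hh := height_reflectionPerm b a.grad (highest b)
    rw [hr]
    simp only [simpleAff, P.pairingIn_reflectionPerm_self_right, mul_one, sub_neg_eq_add,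
      b.isPos_iff]
    have hlpos : 0 ≤ a.lvl := by rcases ha with h | h <;> omega
    by_cases h1 : a.grad = highest b
    · rw [h1, P.pairingIn_same]
      left; omega
    by_cases h2 : a.grad = P.reflectionPerm (highest b) (highest b)
    · have h3 : a.lvl ≠ 1 := fun e => hj (AffRoot.ext h2 e)
      have h4 : a.lvl ≠ 0 := by
        intro e
        rcases ha with h | h
        · omega
        · have h5 := h.2
          rw [h2, isPos_neg_iff] at h5
          exact h5 (isPos_highest b)
      have h5 := height_highest_pos b
      rw [h2, P.pairingIn_reflectionPerm_self_left, P.pairingIn_same, P.reflectionPerm_self]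
      omega
    have h3 := pairingIn_highest_le_one b h1
    have h4 := neg_one_le_pairingIn_highest b h2
    have h5 := b.height_ne_zero (P.reflectionPerm (highest b) a.grad)
    have h6 := neg_highest_le_height b a.grad
    obtain h7 | h7 | h7 : P.pairingIn ℤ a.grad (highest b) = -1 ∨
      P.pairingIn ℤ a.grad (highest b) = 0 ∨ P.pairingIn ℤ a.grad (highest b) = 1 := by omega
    -- With pairing -1 the gradient is negative, so the level is at least 1. If it drops to 0, the
    -- new gradient α + φ has height that is nonnegative and nonzero.
    · have h8 : ¬ b.IsPos a.grad := fun h => by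
        have := pairingIn_highest_nonneg b h
        omega
      have h9 : 0 < a.lvl := by
        rcases ha with h | h
        · exact h
        · exact absurd h.2 h8
      rw [h7] at hh ⊢
      omega
    · rw [h7] at hh ⊢
      rw [hh]
      rw [AffPos, b.isPos_iff] at ha
      omega
    · rw [h7]; omega

lemma finite_affInv (g : ExtWeyl P) : {a : AffRoot P | AffPos b a ∧ ¬ AffPos b (g • a)}.Finite := by
  have hfin : (⋃ i : ι, (fun r => (⟨i, r⟩ : AffRoot P)) ''
      Set.Icc 0 (pairZ P (g.right • i) g.left.toAdd)).Finite :=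
    Set.finite_iUnion fun i => (Set.finite_Icc _ _).image _
  refine hfin.subset ?_
  rintro a ⟨h1, h2⟩
  rw [Set.mem_iUnion]
  refine ⟨a.grad, a.lvl, ⟨?_, ?_⟩, rfl⟩
  · rcases h1 with h | h <;> omega
  · by_contra h
    apply h2
    left
    rw [smul_lvl]
    omega

/-- The descent of `isPos_smul_of_simple`, with `affHeight` as measure and `exists_pairingIn_pos`
supplying the simple affine root to reflect in. -/
lemma affPos_smul_of_simple (g : ExtWeyl P) (h : ∀ j, AffPos b (g • simpleAff b j))
    (a : AffRoot P) (ha : AffPos b a) : AffPos b (g • a) := by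
  induction hn : (affHeight b a).toNat using Nat.strongRecOn generalizing a with
  | ind n ih =>
    obtain ⟨j, hj⟩ := exists_pairingIn_pos b a.grad
    by_cases haj : a = simpleAff b j
    · rw [haj]; exact h j
    have h1 := affPos_simpleRefl b j a ha haj
    have h2 := affHeight_affRefl b (simpleAff b j) a
    rw [affHeight_simpleAff] at h2
    have h3 := ih _ (by
      rw [← hn]
      rw [affPos_iff] at h1 ha
      rw [← simpleRefl] at h2
      omega) (simpleRefl b j • a) h1 rfl
    rw [← mul_smul, simpleRefl, ← affRefl_mul, mul_smul, affPos_iff, affHeight_affRefl] at h3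
    have h4 := h j
    rw [affPos_iff] at h4 ⊢
    rw [smul_grad, smul_grad, pairingIn_smul] at h3
    nlinarith [mul_pos hj h4]

/-- The extended affine Weyl group with its simple reflections. -/
def affSys : ReflSys (ExtWeyl P) (Option b.support) (AffRoot P) where
  s := simpleRefl b
  a := simpleAff b
  pos := AffPos b
  neg := affNeg
  neg_neg := affNeg_affNeg
  smul_neg := smul_affNeg
  pos_neg := affPos_neg_iff b
  pos_a j := by rw [affPos_iff, affHeight_simpleAff]; exact one_pos
  s_mul_self j := affRefl_mul_self (simpleAff b j)
  s_smul_a j := affRefl_smul_self (simpleAff b j)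
  pos_s := affPos_simpleRefl b
  conj g i j h := by
    have := affRefl_mul g (simpleAff b i)
    rwa [h] at this
  finite_inv := finite_affInv b
  pos_of := affPos_smul_of_simple b

end Highest

end AffHecke

end

noncomputable section

set_option linter.unusedSectionVars false

namespace AffHecke

variable {ι V N : Type*} [AddCommGroup V] [Module ℝ V] [AddCommGroup N] [Module ℝ N]
  {P : RootPairing ι ℝ V N} [Finite ι] [P.IsRootSystem] [P.IsCrystallographic] [P.IsIrreducible]
  (b : P.Base) (k : Mult P)

/-! ### Relations in the Hecke algebra -/

lemma quad_iff {A : Type*} [Ring A] [Algebra ℂ A] (T : A) (z : ℂˣ) :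
    (T - algebraMap ℂ A (z : ℂ)) * (T + algebraMap ℂ A ((z⁻¹ : ℂˣ) : ℂ)) = 0 ↔
      T * T = ((z : ℂ) - ((z⁻¹ : ℂˣ) : ℂ)) • T + 1 := by
  rw [sub_mul, mul_add, mul_add, ← map_mul, ← Algebra.commutes, ← Algebra.smul_def,
    ← Algebra.smul_def, Units.mul_inv, map_one, sub_smul, ← sub_eq_zero (a := T * T)]
  rw [show T * T + ((z⁻¹ : ℂˣ) : ℂ) • T - ((z : ℂ) • T + 1) =
    T * T - ((z : ℂ) • T - ((z⁻¹ : ℂˣ) : ℂ) • T + 1) by abel]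

/-- The number `k_j - k_j⁻¹`. -/
def kdiff (j : Option b.support) : ℂ :=
  (kSimple b k j : ℂ) - (((kSimple b k j)⁻¹ : ℂˣ) : ℂ)

lemma genT_braid (i j : Option b.support) (hij : i ≠ j)
    (hf : IsOfFinOrder (simpleRefl b i * simpleRefl b j)) :
    altProd (orderOf (simpleRefl b i * simpleRefl b j)) (genT b k i) (genT b k j) =
      altProd (orderOf (simpleRefl b i * simpleRefl b j)) (genT b k j) (genT b k i) := by
  have h := RingQuot.mkAlgHom_rel ℂ (HeckeRel.braid (k := k) i j hij hf)
  rwa [map_altProd, map_altProd] at h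

lemma genT_mul_self (j : Option b.support) :
    genT b k j * genT b k j = kdiff b k j • genT b k j + 1 := by
  have h := RingQuot.mkAlgHom_rel ℂ (HeckeRel.quad (k := k) j)
  rw [map_mul, map_sub, map_add, map_zero, AlgHom.commutes, AlgHom.commutes] at h
  exact (quad_iff (genT b k j) (kSimple b k j)).mp h

lemma genO_one (ω : Omega b) (h : ω.1 = 1) : genO b k ω = 1 := by
  have := RingQuot.mkAlgHom_rel ℂ (HeckeRel.omega_one (k := k) ω h)
  rwa [map_one] at this

lemma genO_mul (ω₁ ω₂ ω₃ : Omega b) (h : ω₁.1 * ω₂.1 = ω₃.1) :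
    genO b k ω₁ * genO b k ω₂ = genO b k ω₃ := by
  have := RingQuot.mkAlgHom_rel ℂ (HeckeRel.omega_mul (k := k) ω₁ ω₂ ω₃ h)
  rwa [map_mul] at this

lemma genO_mul_genT (ω : Omega b) (i j : Option b.support)
    (h : ω.1 • simpleAff b i = simpleAff b j) :
    genO b k ω * genT b k i = genT b k j * genO b k ω := by
  have := RingQuot.mkAlgHom_rel ℂ (HeckeRel.omega_conj (k := k) ω i j h)
  rwa [map_mul, map_mul] at this

/-- The unit `T_j`. -/
def unitT (j : Option b.support) : (Hecke b k)ˣ where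
  val := genT b k j
  inv := genT b k j - algebraMap ℂ _ (kdiff b k j)
  val_inv := by
    rw [mul_sub, genT_mul_self, ← Algebra.commutes, ← Algebra.smul_def, add_sub_cancel_left]
  inv_val := by
    rw [sub_mul, genT_mul_self, ← Algebra.smul_def, add_sub_cancel_left]

variable [P.IsReduced]

lemma isUnit_genO (ω : Omega b) : IsUnit (genO b k ω) := by
  have h1 : affLen b 1 = 0 := (affSys b).len_one
  let ω' : Omega b := ⟨ω.1⁻¹, (affSys b).len_inv_of_len ω.2⟩
  refine ⟨⟨genO b k ω, genO b k ω', ?_, ?_⟩, rfl⟩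
  · rw [genO_mul b k ω ω' ⟨1, h1⟩ (mul_inv_cancel _), genO_one b k _ rfl]
  · rw [genO_mul b k ω' ω ⟨1, h1⟩ (inv_mul_cancel _), genO_one b k _ rfl]

lemma IsReducedExpr.isRed {w : ExtWeyl P} {L : List (Option b.support)} {ω : Omega b}
    (h : IsReducedExpr b w L ω) : (affSys b).IsRed L := by
  obtain ⟨h1, h2⟩ := h
  rw [ReflSys.IsRed, h1, ← h2]
  exact (affSys b).len_mul_of_len_right ω.2

/-- This makes the choice in the definition harmless: two reduced expressions have the same
length-zero part, and their words have equal products by Matsumoto's theorem. -/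
lemma heckeT_eq {w : ExtWeyl P} {L : List (Option b.support)} {ω : Omega b}
    (h : IsReducedExpr b w L ω) : heckeT b k w = (L.map (genT b k)).prod * genO b k ω := by
  have hex : ∃ t, ∃ L ω, IsReducedExpr b w L ω ∧ t = (L.map (genT b k)).prod * genO b k ω :=
    ⟨_, L, ω, h, rfl⟩
  obtain ⟨L', ω', h', e⟩ := Classical.epsilon_spec hex
  change heckeT b k w = _ at e
  rw [e]
  obtain ⟨h1, h2⟩ := (affSys b).eq_of_wprod_mul_eq (L := L') (L' := L) ω'.2 ω.2
    (h'.2.trans h.2.symm)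
  rw [Subtype.ext h2, (affSys b).matsumoto (genT b k) (genT_braid b k) h'.isRed h.isRed h1]

lemma exists_isReducedExpr (w : ExtWeyl P) : ∃ L ω, IsReducedExpr b w L ω := by
  obtain ⟨L, o, h1, h2, h3⟩ := (affSys b).exists_expr w
  exact ⟨L, ⟨o, h1⟩, h3, h2⟩

lemma heckeT_omega (ω : Omega b) : heckeT b k ω.1 = genO b k ω := by
  rw [heckeT_eq b k (L := []) (ω := ω) ⟨by simp [ω.2], by simp⟩]
  simp

lemma heckeT_one : heckeT b k 1 = 1 := by
  have h1 : affLen b (1 : ExtWeyl P) = 0 := (affSys b).len_one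
  rw [heckeT_omega b k ⟨1, h1⟩, genO_one b k _ rfl]

lemma heckeT_simpleRefl (j : Option b.support) : heckeT b k (simpleRefl b j) = genT b k j := by
  have h1 : affLen b (1 : ExtWeyl P) = 0 := (affSys b).len_one
  have h2 : affLen b (simpleRefl b j) = 1 := (affSys b).len_s j
  rw [heckeT_eq b k (L := [j]) (ω := ⟨1, h1⟩) ⟨by simp [h2], by simp⟩, genO_one b k _ rfl]
  simp

/-- Length-zero elements permute the simple affine roots, so ω moves past a word by relabelling its
letters, simultaneously in the group and in the algebra. -/
lemma genO_mul_word (ω : Omega b) (L : List (Option b.support)) : ∃ L' : List (Option b.support),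
    L'.length = L.length ∧
    ω.1 * (affSys b).wprod L = (affSys b).wprod L' * ω.1 ∧
    genO b k ω * (L.map (genT b k)).prod = (L'.map (genT b k)).prod * genO b k ω := by
  induction L with
  | nil => exact ⟨[], rfl, by simp, by simp⟩
  | cons j L ih =>
    obtain ⟨L', h1, h2, h3⟩ := ih
    obtain ⟨i, hi⟩ := (affSys b).exists_smul_a_eq ω.2 j
    refine ⟨i :: L', by simp [h1], ?_, ?_⟩
    · rw [ReflSys.wprod_cons, ReflSys.wprod_cons, ← mul_assoc, ← (affSys b).conj _ _ _ hi,
        mul_assoc, h2, mul_assoc]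
    · simp only [List.map_cons, List.prod_cons]
      rw [← mul_assoc, genO_mul_genT b k ω j i hi, mul_assoc, h3, mul_assoc]

lemma heckeT_mul {u v : ExtWeyl P} (h : affLen b (u * v) = affLen b u + affLen b v) :
    heckeT b k u * heckeT b k v = heckeT b k (u * v) := by
  obtain ⟨L, ω, hu⟩ := exists_isReducedExpr b u
  obtain ⟨L', ω', hv⟩ := exists_isReducedExpr b v
  obtain ⟨L'', h1, h2, h3⟩ := genO_mul_word b k ω L'
  let ω'' : Omega b := ⟨ω.1 * ω'.1, ((affSys b).len_mul_of_len_left ω.2).trans ω'.2⟩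
  have huv : IsReducedExpr b (u * v) (L ++ L'') ω'' := by
    refine ⟨by rw [List.length_append, h1, h, hu.1, hv.1], ?_⟩
    have e1 : (affSys b).wprod L * ω.1 = u := hu.2
    have e2 : (affSys b).wprod L' * ω'.1 = v := hv.2
    change (affSys b).wprod (L ++ L'') * (ω.1 * ω'.1) = _
    rw [← e1, ← e2, ReflSys.wprod_append, mul_assoc, ← mul_assoc ((affSys b).wprod L''), ← h2]
    simp only [mul_assoc]
  rw [heckeT_eq b k hu, heckeT_eq b k hv, heckeT_eq b k huv, ← genO_mul b k ω ω' ω'' rfl,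
    List.map_append, List.prod_append, mul_assoc, ← mul_assoc (genO b k ω), h3]
  simp only [mul_assoc]

lemma heckeT_mul_of_forall {u v : ExtWeyl P}
    (h : ∀ a : AffRoot P, AffPos b a → ¬ AffPos b (v • a) → ¬ AffPos b (u • v • a)) :
    heckeT b k u * heckeT b k v = heckeT b k (u * v) :=
  heckeT_mul b k ((affSys b).len_mul_of_forall h)

lemma isUnit_heckeT (w : ExtWeyl P) : IsUnit (heckeT b k w) := by
  obtain ⟨L, ω, h⟩ := exists_isReducedExpr b w
  rw [heckeT_eq b k h]
  refine IsUnit.mul ?_ (isUnit_genO b k ω)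
  change _ ∈ IsUnit.submonoid (Hecke b k)
  exact Submonoid.list_prod_mem _ fun t ht => by
    obtain ⟨j, -, rfl⟩ := List.mem_map.mp ht
    exact ⟨unitT b k j, rfl⟩

/-! ### The regular representation -/

lemma kdiff_eq_of_smul (g : ExtWeyl P) (i j : Option b.support)
    (h : g • simpleAff b i = simpleAff b j) : kdiff b k i = kdiff b k j := by
  rw [kdiff, kdiff, kSimple, kSimple, ← h, k.invariant]

/-- The action of the generators in the regular representation. -/
def regGen : Gen b → Module.End ℂ (ExtWeyl P →₀ ℂ)
  | Sum.inl j => (affSys b).leftOp (kdiff b k) j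
  | Sum.inr ω => ReflSys.leftTr ω.1

lemma regGen_rel {x y : FreeAlgebra ℂ (Gen b)} (h : HeckeRel b k x y) :
    FreeAlgebra.lift ℂ (regGen b k) x = FreeAlgebra.lift ℂ (regGen b k) y := by
  have hT (j) : FreeAlgebra.lift ℂ (regGen b k) (freeT b j) =
      (affSys b).leftOp (kdiff b k) j := by
    simp [freeT, regGen]
  have hO (ω) : FreeAlgebra.lift ℂ (regGen b k) (freeO b ω) = ReflSys.leftTr ω.1 := by
    simp [freeO, regGen]
  cases h with
  | braid i j hij hfin =>
    rw [map_altProd, map_altProd, hT, hT]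
    exact (affSys b).leftOp_braid (kdiff b k) (kdiff_eq_of_smul b k) i j
  | quad j =>
    simp only [map_mul, map_sub, map_add, hT, map_zero, AlgHom.commutes]
    exact (quad_iff ((affSys b).leftOp (kdiff b k) j) (kSimple b k j)).mpr
      ((affSys b).leftOp_sq (kdiff b k) j)
  | omega_one ω h =>
    rw [hO, h, map_one]
    exact ReflSys.ext_ev fun w => by rw [ReflSys.leftTr_ev]; simp
  | omega_mul ω₁ ω₂ ω₃ h =>
    rw [map_mul, hO, hO, hO, ← h]
    exact ReflSys.ext_ev fun w => by
      simp only [Module.End.mul_apply, ReflSys.leftTr_ev, mul_assoc]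
  | omega_conj ω i j h =>
    rw [map_mul, map_mul, hO, hT, hT]
    exact (affSys b).leftTr_mul_leftOp (kdiff b k) ω.1 h (kdiff_eq_of_smul b k _ _ _ h)

/-- The regular representation of `H(k)` on the free module on `W`. -/
def regRep : Hecke b k →ₐ[ℂ] Module.End ℂ (ExtWeyl P →₀ ℂ) :=
  RingQuot.liftAlgHom ℂ ⟨FreeAlgebra.lift ℂ (regGen b k), fun _ _ h => regGen_rel b k h⟩

lemma regRep_genT (j : Option b.support) :
    regRep b k (genT b k j) = (affSys b).leftOp (kdiff b k) j := by
  unfold regRep genT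
  rw [RingQuot.liftAlgHom_mkAlgHom_apply]
  simp [freeT, regGen]

lemma regRep_genO (ω : Omega b) : regRep b k (genO b k ω) = ReflSys.leftTr ω.1 := by
  unfold regRep genO
  rw [RingQuot.liftAlgHom_mkAlgHom_apply]
  simp [freeO, regGen]

lemma regRep_heckeT (w : ExtWeyl P) :
    regRep b k (heckeT b k w) (ReflSys.ev 1) = ReflSys.ev w := by
  obtain ⟨L, ω, h⟩ := exists_isReducedExpr b w
  rw [heckeT_eq b k h, map_mul, regRep_genO, Module.End.mul_apply, ReflSys.leftTr_ev, mul_one,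
    map_list_prod, List.map_map]
  have h1 : (regRep b k) ∘ genT b k = (affSys b).leftOp (kdiff b k) :=
    funext fun j => regRep_genT b k j
  rw [h1]
  have h2 : Commute (L.map ((affSys b).leftOp (kdiff b k))).prod (ReflSys.rightTr ω.1) := by
    apply Commute.list_prod_left
    intro x hx
    obtain ⟨j, -, rfl⟩ := List.mem_map.mp hx
    exact (affSys b).leftOp_comm_rightTr _ j ω.2
  rw [← one_mul ω.1, ← ReflSys.rightTr_ev, ← Module.End.mul_apply, h2.eq, Module.End.mul_apply,
    (affSys b).leftOp_word_ev_one _ h.isRed, ReflSys.rightTr_ev]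
  exact congrArg ReflSys.ev h.2

/-- In the regular representation T_w carries the vector of `1` to the vector of `w`. -/
lemma linearIndependent_heckeT : LinearIndependent ℂ (heckeT b k) := by
  let f : Hecke b k →ₗ[ℂ] (ExtWeyl P →₀ ℂ) :=
    (LinearMap.applyₗ (ReflSys.ev (1 : ExtWeyl P))).comp (regRep b k).toLinearMap
  apply LinearIndependent.of_comp f
  have h : f ∘ heckeT b k = fun w => Finsupp.single w 1 := funext fun w => regRep_heckeT b k w
  rw [h]
  exact Finsupp.linearIndependent_single_one ℂ _

/-! ### The finite part -/

lemma inr_smul (w : P.weylGroup) (a : AffRoot P) :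
    (SemidirectProduct.inr w : ExtWeyl P) • a = ⟨w • a.grad, a.lvl⟩ := by
  apply AffRoot.ext
  · rfl
  · rw [smul_lvl]
    change a.lvl - pairZ P _ 0 = a.lvl
    rw [pairZ_zero, sub_zero]

lemma affPos_mk_zero (i : ι) : AffPos b ⟨i, 0⟩ ↔ b.IsPos i := by simp [AffPos]

lemma affLen_inr (w : P.weylGroup) :
    affLen b (SemidirectProduct.inr w : ExtWeyl P) = finLen b w := by
  rw [affLen, finLen, ← Set.ncard_image_of_injective (f := fun i => (⟨i, 0⟩ : AffRoot P)) _
    (fun i j h => congrArg AffRoot.grad h)]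
  congr 1
  ext a
  simp only [Set.mem_ofPred_eq, Set.mem_image, inr_smul]
  constructor
  · rintro ⟨h1, h2⟩
    rcases h1 with h1 | ⟨h1, h1'⟩
    · exact absurd (Or.inl h1) h2
    · refine ⟨a.grad, ⟨h1', fun h => h2 (Or.inr ⟨h1, h⟩)⟩, AffRoot.ext rfl h1.symm⟩
  · rintro ⟨i, ⟨h1, h2⟩, rfl⟩
    exact ⟨Or.inr ⟨rfl, h1⟩, by rwa [affPos_mk_zero]⟩

lemma simpleRefl_some (i : b.support) :
    simpleRefl b (some i) = SemidirectProduct.inr (finRefl b i) := by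
  simp only [simpleRefl, affRefl, simpleAff, zero_smul, neg_zero, tau, finRefl]
  rw [ofAdd_zero, map_one, one_mul]

lemma finT_one : finT b k 1 = 1 := by rw [finT, map_one, heckeT_one]

lemma finT_finRefl (i : b.support) : finT b k (finRefl b i) = genT b k (some i) := by
  rw [finT, ← simpleRefl_some, heckeT_simpleRefl]

lemma finT_mul {u v : P.weylGroup} (h : finLen b (u * v) = finLen b u + finLen b v) :
    finT b k u * finT b k v = finT b k (u * v) := by
  rw [finT, finT, finT, map_mul]
  apply heckeT_mul
  rw [← map_mul, affLen_inr, affLen_inr, affLen_inr, h]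

lemma genT_mul_finT {i : b.support} {w : P.weylGroup} (h : b.IsPos (w⁻¹ • (i : ι))) :
    genT b k (some i) * finT b k w = finT b k (finRefl b i * w) := by
  rw [← finT_finRefl]
  apply finT_mul
  have h1 : finLen b (finRefl b i * w) = finLen b w + 1 := (finSys b).len_s_mul h
  have h2 : finLen b (finRefl b i) = 1 := (finSys b).len_s i
  rw [h1, h2, add_comm]

lemma finT_mul_genT {i : b.support} {w : P.weylGroup} (h : b.IsPos (w • (i : ι))) :
    finT b k w * genT b k (some i) = finT b k (w * finRefl b i) := by
  rw [← finT_finRefl]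
  apply finT_mul
  have h1 : finLen b (w * finRefl b i) = finLen b w + 1 := (finSys b).len_mul_s h
  have h2 : finLen b (finRefl b i) = 1 := (finSys b).len_s i
  rw [h1, h2]

lemma genT_mul_finT_of_not {i : b.support} {w : P.weylGroup} (h : ¬ b.IsPos (w⁻¹ • (i : ι))) :
    genT b k (some i) * finT b k w =
      finT b k (finRefl b i * w) + kdiff b k (some i) • finT b k w := by
  have h1 := genT_mul_finT b k (i := i) (w := finRefl b i * w) (by
    have := (finSys b).pos_neg (w⁻¹ • (i : ι))
    rw [mul_inv_rev, mul_smul]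
    have e : (finRefl b i)⁻¹ • (i : ι) = P.reflectionPerm (i : ι) (i : ι) := by
      have := (finSys b).s_inv i
      change (finRefl b i)⁻¹ = finRefl b i at this
      rw [this]; rfl
    rw [e, smul_reflectionPerm, isPos_neg_iff]
    exact h)
  have h2 : finRefl b i * (finRefl b i * w) = w := (finSys b).s_mul_cancel i w
  rw [h2] at h1
  rw [← h1, ← mul_assoc, genT_mul_self, add_mul, one_mul, smul_mul_assoc, add_comm]

lemma finT_mul_genT_of_not {i : b.support} {w : P.weylGroup} (h : ¬ b.IsPos (w • (i : ι))) :
    finT b k w * genT b k (some i) =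
      finT b k (w * finRefl b i) + kdiff b k (some i) • finT b k w := by
  have h1 := finT_mul_genT b k (i := i) (w := w * finRefl b i) (by
    rw [mul_smul]
    have e : finRefl b i • (i : ι) = P.reflectionPerm (i : ι) (i : ι) := rfl
    rw [e, smul_reflectionPerm, isPos_neg_iff]
    exact h)
  have h2 : w * finRefl b i * finRefl b i = w := (finSys b).mul_s_cancel i w
  rw [h2] at h1
  rw [← h1, mul_assoc, genT_mul_self, mul_add, mul_one, mul_smul_comm, add_comm]

end AffHecke

end

noncomputable section

set_option linter.unusedSectionVars false

namespace AffHecke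

/-- A map which is additive on a submonoid of an abelian group that generates it by differences
extends to a homomorphism. -/
lemma exists_hom_of_submonoid {A G : Type*} [AddCommGroup A] [Group G] (D : AddSubmonoid A)
    (hD : ∀ x, ∃ d ∈ D, ∃ e ∈ D, x = d - e) (f : A → G)
    (hf : ∀ d ∈ D, ∀ e ∈ D, f (d + e) = f d * f e) :
    ∃ F : Multiplicative A →* G, ∀ d ∈ D, F (Multiplicative.ofAdd d) = f d := by
  have hcomm (d) (hd : d ∈ D) (e) (he : e ∈ D) : Commute (f d) (f e) := by
    rw [Commute, SemiconjBy, ← hf d hd e he, ← hf e he d hd, add_comm]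
  have key (d) (hd : d ∈ D) (e) (he : e ∈ D) (d') (hd' : d' ∈ D) (e') (he' : e' ∈ D)
      (h : d - e = d' - e') : f d * (f e)⁻¹ = f d' * (f e')⁻¹ := by
    have h1 : d + e' = d' + e := by
      rw [sub_eq_sub_iff_add_eq_add] at h; exact h
    have h2 : f d * f e' = f d' * f e := by rw [← hf d hd e' he', ← hf d' hd' e he, h1]
    rw [mul_inv_eq_iff_eq_mul, mul_assoc, ((hcomm e' he' e he).inv_left).eq, ← mul_assoc, ← h2,
      mul_inv_cancel_right]
  choose p hp q hq hpq using hD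
  have h0 : f 0 = 1 := by
    have := hf 0 D.zero_mem 0 D.zero_mem
    rw [add_zero] at this
    exact left_eq_mul.mp this
  refine ⟨MonoidHom.mk' (fun x => f (p x.toAdd) * (f (q x.toAdd))⁻¹) ?_, ?_⟩
  · intro x y
    rw [key _ (hp _) _ (hq _) _ (D.add_mem (hp x.toAdd) (hp y.toAdd)) _
      (D.add_mem (hq x.toAdd) (hq y.toAdd)) (by
        rw [← hpq, toAdd_mul, add_sub_add_comm, ← hpq, ← hpq]),
      hf _ (hp _) _ (hp _), hf _ (hq _) _ (hq _), mul_inv_rev]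
    have h1 := (hcomm _ (hq x.toAdd) _ (hq y.toAdd)).inv_inv
    have h2 := (hcomm _ (hp y.toAdd) _ (hq x.toAdd)).inv_right
    rw [← h1.eq, mul_assoc, ← mul_assoc (f (p y.toAdd)), h2.eq]
    simp only [mul_assoc]
  · intro d hd
    change f (p d) * (f (q d))⁻¹ = f d
    rw [key _ (hp _) _ (hq _) d hd 0 D.zero_mem (by rw [← hpq, sub_zero]), h0, inv_one, mul_one]

variable {ι V N : Type*} [AddCommGroup V] [Module ℝ V] [AddCommGroup N] [Module ℝ N]
  {P : RootPairing ι ℝ V N}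

/-! ### Coweights -/

/-- The pairing with a root as a homomorphism. -/
def pairHom (i : ι) : coweights P →+ ℤ where
  toFun := pairZ P i
  map_zero' := pairZ_zero P i
  map_add' := pairZ_add P i

/-- The action of the finite Weyl group on the coweight lattice, in additive notation. -/
def wact (w : P.weylGroup) : coweights P →+ coweights P :=
  MonoidHom.toAdditive (weylCow P w).toMonoidHom

lemma wact_mul (v w : P.weylGroup) (x : coweights P) : wact (v * w) x = wact v (wact w x) := by
  change (weylCow P (v * w) (Multiplicative.ofAdd x)).toAdd = _
  rw [map_mul]
  rfl

lemma wact_one (x : coweights P) : wact (1 : P.weylGroup) x = x := by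
  change (weylCow P 1 (Multiplicative.ofAdd x)).toAdd = _
  rw [map_one]
  rfl

lemma wact_inv_wact (w : P.weylGroup) (x : coweights P) : wact w⁻¹ (wact w x) = x := by
  rw [← wact_mul, inv_mul_cancel, wact_one]

lemma wact_wact_inv (w : P.weylGroup) (x : coweights P) : wact w (wact w⁻¹ x) = x := by
  rw [← wact_mul, mul_inv_cancel, wact_one]

lemma pairZ_wact (w : P.weylGroup) (i : ι) (x : coweights P) :
    pairZ P (w • i) (wact w x) = pairZ P i x := pairZ_weylCow P w i (Multiplicative.ofAdd x)

lemma tau_add (x y : coweights P) : tau P (x + y) = tau P x * tau P y := by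
  rw [tau, ofAdd_add, map_mul]
  rfl

lemma tau_smul (x : coweights P) (a : AffRoot P) :
    tau P x • a = ⟨a.grad, a.lvl - pairZ P a.grad x⟩ := by
  apply AffRoot.ext
  · exact one_smul _ a.grad
  · rw [smul_lvl]
    change a.lvl - pairZ P ((1 : P.weylGroup) • a.grad) x = _
    rw [one_smul]

lemma inr_mul_tau (w : P.weylGroup) (x : coweights P) :
    (SemidirectProduct.inr w : ExtWeyl P) * tau P x = tau P (wact w x) *
      SemidirectProduct.inr w := by
  have h := SemidirectProduct.inl_aut (φ := weylCow P) w (Multiplicative.ofAdd x)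
  change tau P (wact w x) = _ at h
  rw [h, map_inv, inv_mul_cancel_right]
  rfl

lemma wact_corootC [P.IsCrystallographic] (w : P.weylGroup) (i : ι) :
    wact w (corootC P i) = corootC P (w • i) :=
  Subtype.ext (weylN_coroot w i)

lemma pairZ_corootC [P.IsCrystallographic] (i j : ι) :
    pairZ P j (corootC P i) = P.pairingIn ℤ j i := by
  have h3 := coe_pairZ P j (corootC P i)
  change _ = P.root' j (P.coroot i) at h3
  rw [P.root'_coroot_eq_pairing, ← P.algebraMap_pairingIn ℤ] at h3
  exact (algebraMap ℤ ℝ).injective_int h3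

lemma wact_ofIdx [P.IsCrystallographic] [P.IsRootSystem] (i : ι) (x : coweights P) :
    wact (RootPairing.weylGroup.ofIdx P i) x = x - pairZ P i x • corootC P i := by
  rw [← sub_eq_zero]
  apply eq_zero_of_pairZ
  intro j
  have h1 := pairZ_wact (RootPairing.weylGroup.ofIdx P i) (P.reflectionPerm i j) x
  rw [ofIdx_smul_index, P.reflectionPerm_self, pairZ_reflectionPerm] at h1
  change pairHom j _ = 0
  rw [map_sub, map_sub, map_zsmul]
  change pairZ P j _ - (pairZ P j x - pairZ P i x • pairZ P j _) = 0
  rw [h1, pairZ_corootC, smul_eq_mul]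
  ring

lemma pairZ_eq_sum (b : P.Base) {i : ι} {f : ι → ℤ}
    (h : P.root i = ∑ j ∈ b.support, f j • P.root j) (x : coweights P) :
    pairZ P i x = ∑ j ∈ b.support, f j * pairZ P j x := by
  have : (pairZ P i x : ℝ) = ((∑ j ∈ b.support, f j * pairZ P j x : ℤ) : ℝ) := by
    push_cast
    simp only [coe_pairZ, RootPairing.root', h, map_sum, map_zsmul, LinearMap.sum_apply,
      LinearMap.smul_apply, zsmul_eq_mul]
  exact_mod_cast this

lemma eq_of_pairZ_simple [P.IsRootSystem] (b : P.Base) {x y : coweights P}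
    (h : ∀ j ∈ b.support, pairZ P j x = pairZ P j y) : x = y := by
  rw [← sub_eq_zero]
  apply eq_zero_of_pairZ
  intro i
  obtain ⟨f, -, -, hf⟩ := b.exists_root_eq_sum_int i
  rw [pairZ_eq_sum b hf]
  apply Finset.sum_eq_zero
  intro j hj
  rw [sub_eq_add_neg, pairZ_add, pairZ_neg, h j hj, add_neg_cancel, mul_zero]

/-- The dominant coweights. -/
def dom (b : P.Base) : AddSubmonoid (coweights P) where
  carrier := {x | ∀ i, b.IsPos i → 0 ≤ pairZ P i x}
  zero_mem' i _ := (pairZ_zero P i).ge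
  add_mem' {x y} hx hy i hi := by
    rw [pairZ_add]
    exact add_nonneg (hx i hi) (hy i hi)

lemma mem_dom_of_simple (b : P.Base) {x : coweights P} (h : ∀ j ∈ b.support, 0 ≤ pairZ P j x) :
    x ∈ dom b := by
  intro i hi
  obtain ⟨f, hf0, hf1, hf2⟩ := b.exists_root_eq_sum_int i
  have hpos : 0 < f := by
    refine hf1.resolve_right fun hneg => ?_
    rw [b.isPos_iff, RootPairing.Base.height_eq_sum hf2] at hi
    exact absurd hi (not_lt.mpr (Finset.sum_nonpos fun j _ => hneg.le j))
  rw [pairZ_eq_sum b hf2]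
  exact Finset.sum_nonneg fun j hj => mul_nonneg (hpos.le j) (h j hj)

/-- The coordinate functional of the simple-root basis is represented in `N` by perfectness of the
pairing. It is a coweight because each root is an integral combination of simple roots. -/
lemma exists_fundCow [P.IsRootSystem] (b : P.Base) (i : b.support) : ∃ x : coweights P,
    pairZ P i x = 1 ∧ ∀ j ∈ b.support, j ≠ i → pairZ P j x = 0 := by
  classical
  obtain ⟨n, hn⟩ := (LinearMap.IsPerfPair.bijective_right P.toLinearMap).surjective
    (b.toWeightBasis.coord i)
  have hv (j : b.support) : P.root' j n = if j = i then 1 else 0 := by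
    have h1 := LinearMap.congr_fun hn (P.root j)
    rw [LinearMap.flip_apply] at h1
    rw [RootPairing.root', h1, ← b.toWeightBasis_apply]
    simp [Finsupp.single_apply]
  have hmem : n ∈ coweights P := by
    intro l
    obtain ⟨f, -, -, hf⟩ := b.exists_root_eq_sum_int l
    refine ⟨∑ j ∈ b.support, f j * if j = (i : ι) then 1 else 0, ?_⟩
    simp only [RootPairing.root', hf, map_sum, map_zsmul, LinearMap.sum_apply,
      LinearMap.smul_apply, zsmul_eq_mul]
    push_cast
    refine Finset.sum_congr rfl fun j hj => ?_
    have := hv ⟨j, hj⟩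
    rw [RootPairing.root'] at this
    rw [this]
    simp [Subtype.ext_iff]
  refine ⟨⟨n, hmem⟩, ?_, ?_⟩
  · have := coe_pairZ P i ⟨n, hmem⟩
    rw [hv, if_pos rfl] at this
    exact_mod_cast this
  · intro j hj hji
    have := coe_pairZ P j ⟨n, hmem⟩
    have h2 := hv ⟨j, hj⟩
    rw [if_neg (fun e => hji (congrArg Subtype.val e))] at h2
    simp only at h2 this
    rw [h2] at this
    exact_mod_cast this

section Fundamental

variable [P.IsRootSystem] (b : P.Base)

/-- The fundamental coweight dual to a simple root. -/
def fundCow (i : b.support) : coweights P := (exists_fundCow b i).choose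

lemma pairZ_fundCow_self (i : b.support) : pairZ P i (fundCow b i) = 1 :=
  (exists_fundCow b i).choose_spec.1

lemma pairZ_fundCow_ne (i : b.support) {j : ι} (hj : j ∈ b.support) (h : j ≠ i) :
    pairZ P j (fundCow b i) = 0 :=
  (exists_fundCow b i).choose_spec.2 j hj h

lemma fundCow_mem_dom (i : b.support) : fundCow b i ∈ dom b := by
  apply mem_dom_of_simple
  intro j hj
  by_cases h : j = i
  · rw [h, pairZ_fundCow_self]; exact zero_le_one
  · rw [pairZ_fundCow_ne b i hj h]

lemma pairZ_sum_fundCow (c : b.support → ℤ) (j : b.support) :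
    pairZ P j (∑ i, c i • fundCow b i) = c j := by
  change pairHom (j : ι) _ = _
  rw [map_sum, Finset.sum_eq_single j]
  · rw [map_zsmul]
    change c j • pairZ P j _ = _
    rw [pairZ_fundCow_self, smul_eq_mul, mul_one]
  · intro i _ hij
    rw [map_zsmul]
    change c i • pairZ P j _ = _
    rw [pairZ_fundCow_ne b i j.2 (fun e => hij (Subtype.ext e.symm)), smul_zero]
  · simp

lemma eq_sum_fundCow (x : coweights P) : x = ∑ i : b.support, pairZ P i x • fundCow b i := by
  apply eq_of_pairZ_simple b
  intro j hj
  exact (pairZ_sum_fundCow b (fun i => pairZ P i x) ⟨j, hj⟩).symm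

/-- Adding the combination of fundamental coweights with coefficients |⟨x, α_i⟩| makes any coweight
dominant. -/
lemma exists_dom_sub (x : coweights P) : ∃ d ∈ dom b, ∃ e ∈ dom b, x = d - e := by
  let e := ∑ i : b.support, |pairZ P i x| • fundCow b i
  have he (j : ι) (hj : j ∈ b.support) : pairZ P j e = |pairZ P j x| :=
    pairZ_sum_fundCow b (fun i => |pairZ P i x|) ⟨j, hj⟩
  refine ⟨x + e, mem_dom_of_simple b fun j hj => ?_, e, mem_dom_of_simple b fun j hj => ?_,
    by rw [add_sub_cancel_right]⟩
  · rw [pairZ_add, he j hj]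
    have := neg_abs_le (pairZ P j x)
    omega
  · rw [he j hj]; exact abs_nonneg _

end Fundamental

/-! ### The elements `Y^λ` -/

variable [Finite ι] [P.IsRootSystem] [P.IsCrystallographic] [P.IsIrreducible] [P.IsReduced]
  (b : P.Base) (k : Mult P)

/-- A dominant translation lowers the level of roots with positive gradient only, so its inversions
have positive gradient. Length additivity for products with dominant translations on the right rests
on this. -/
lemma of_not_affPos_tau {x : coweights P} (hx : x ∈ dom b) {a : AffRoot P} (ha : AffPos b a)
    (h : ¬ AffPos b (tau P x • a)) : b.IsPos a.grad ∧ a.lvl - pairZ P a.grad x < 0 := by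
  rw [tau_smul] at h
  simp only [AffPos, not_or, not_and] at h
  have hp : b.IsPos a.grad := by
    by_contra hn
    have h1 := hx _ ((isPos_neg_iff b a.grad).mpr hn)
    rw [pairZ_neg_left] at h1
    rcases ha with h2 | h2
    · omega
    · exact hn h2.2
  refine ⟨hp, ?_⟩
  by_contra h1
  exact h.2 (by omega) hp

lemma heckeT_tau_mul {x y : coweights P} (hx : x ∈ dom b) (hy : y ∈ dom b) :
    heckeT b k (tau P x) * heckeT b k (tau P y) = heckeT b k (tau P (x + y)) := by
  rw [tau_add]
  apply heckeT_mul_of_forall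
  intro a h1 h2
  obtain ⟨h3, h4⟩ := of_not_affPos_tau b hy h1 h2
  have h5 := hx _ h3
  rw [tau_smul, tau_smul]
  simp only [AffPos, not_or, not_and]
  omega

/-- On dominant coweights λ ↦ T_{τ(λ)} is multiplicative with invertible values, and dominant
coweights generate the lattice by differences, so the homomorphism chosen in the definition exists.
-/
lemma heckeY_spec (x : coweights P) (hx : x ∈ dom b) : Yel b k x = heckeT b k (tau P x) := by
  have hex : ∃ Y : Multiplicative (coweights P) →* (Hecke b k)ˣ, ∀ x : coweights P,
      (∀ i, b.IsPos i → 0 ≤ pairZ P i x) →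
      (Y (Multiplicative.ofAdd x) : Hecke b k) = heckeT b k (tau P x) := by
    obtain ⟨F, hF⟩ := exists_hom_of_submonoid (dom b) (exists_dom_sub b)
      (fun x => (isUnit_heckeT b k (tau P x)).unit) (by
        intro d hd e he
        apply Units.ext
        exact (heckeT_tau_mul b k hd he).symm)
    exact ⟨F, fun x hx => by rw [hF x hx]; rfl⟩
  exact Classical.epsilon_spec hex x hx

lemma Yel_add (x y : coweights P) : Yel b k (x + y) = Yel b k x * Yel b k y := by
  rw [Yel, ofAdd_add, map_mul, Units.val_mul]
  rfl

lemma Yel_zero : Yel b k 0 = 1 := by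
  rw [Yel, ofAdd_zero, map_one, Units.val_one]

lemma Yel_comm (x y : coweights P) : Commute (Yel b k x) (Yel b k y) := by
  rw [Commute, SemiconjBy, ← Yel_add, ← Yel_add, add_comm]

lemma Yel_mul_neg (x : coweights P) : Yel b k x * Yel b k (-x) = 1 := by
  rw [← Yel_add, add_neg_cancel, Yel_zero]

lemma Yel_neg_mul (x : coweights P) : Yel b k (-x) * Yel b k x = 1 := by
  rw [← Yel_add, neg_add_cancel, Yel_zero]

end AffHecke

end

noncomputable section

set_option linter.unusedSectionVars false

namespace AffHecke

lemma braid_add_aux {A : Type*} [Ring A] [Algebra ℂ A] {T y y' z z' D E : A} {c : ℂ}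
    (h1 : T * y = y' * T + c • D) (h2 : T * z = z' * T + c • E) :
    T * (y * z) = y' * z' * T + c • (y' * E + D * z) := by
  rw [← mul_assoc, h1, add_mul, mul_assoc, h2, mul_add, smul_add, mul_smul_comm, smul_mul_assoc,
    mul_assoc, add_assoc]

variable {ι V N : Type*} [AddCommGroup V] [Module ℝ V] [AddCommGroup N] [Module ℝ N]
  {P : RootPairing ι ℝ V N} [Finite ι] [P.IsRootSystem] [P.IsCrystallographic] [P.IsIrreducible]
  (b : P.Base) (k : Mult P)

/-- The span of the elements `Y^λ`. -/
def ySpan : Submodule ℂ (Hecke b k) := Submodule.span ℂ (Set.range (Yel b k))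

variable [P.IsReduced]

lemma Yel_mem_ySpan (x : coweights P) : Yel b k x ∈ ySpan b k := Submodule.subset_span ⟨x, rfl⟩

lemma Yel_mul_mem_ySpan (x : coweights P) {D : Hecke b k} (hD : D ∈ ySpan b k) :
    Yel b k x * D ∈ ySpan b k := by
  induction hD using Submodule.span_induction with
  | mem D h =>
    obtain ⟨y, rfl⟩ := h
    rw [← Yel_add]
    exact Yel_mem_ySpan b k _
  | zero => rw [mul_zero]; exact zero_mem _
  | add D E _ _ h1 h2 => rw [mul_add]; exact add_mem h1 h2
  | smul c D _ h => rw [mul_smul_comm]; exact Submodule.smul_mem _ _ h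

lemma commute_Yel_of_mem_ySpan (x : coweights P) {D : Hecke b k} (hD : D ∈ ySpan b k) :
    Commute D (Yel b k x) := by
  induction hD using Submodule.span_induction with
  | mem D h =>
    obtain ⟨y, rfl⟩ := h
    exact Yel_comm b k y x
  | zero => exact Commute.zero_left _
  | add D E _ _ h1 h2 => exact h1.add_left h2
  | smul c D _ h => exact h.smul_left c

/-! ### The Bernstein relations -/

/-- The Bernstein relation between `T_i` and `Y^λ`; here `D` is
`(Y^λ - Y^{s_i λ}) / (1 - Y^{-α_i^∨})`. -/
def BernsteinRel (i : b.support) (x : coweights P) : Prop :=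
  ∃ D ∈ ySpan b k,
    genT b k (some i) * Yel b k x =
      Yel b k (wact (finRefl b i) x) * genT b k (some i) + kdiff b k (some i) • D ∧
    D * (1 - Yel b k (-corootC P i)) = Yel b k x - Yel b k (wact (finRefl b i) x)

lemma bernsteinRel_zero (i : b.support) : BernsteinRel b k i 0 := by
  refine ⟨0, zero_mem _, ?_, ?_⟩
  · rw [map_zero, Yel_zero, smul_zero, add_zero, one_mul, mul_one]
  · rw [map_zero, zero_mul, sub_self]

/-- The divided difference satisfies the twisted Leibniz rule D_{x+y} = Y^{s_i x} D_y + D_x Y^y.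
With negation this makes the valid coweights a subgroup, so fundamental coweights suffice. -/
lemma BernsteinRel.add {i : b.support} {x y : coweights P} (hx : BernsteinRel b k i x)
    (hy : BernsteinRel b k i y) : BernsteinRel b k i (x + y) := by
  obtain ⟨D, hD, h1, h2⟩ := hx
  obtain ⟨E, hE, h3, h4⟩ := hy
  refine ⟨Yel b k (wact (finRefl b i) x) * E + D * Yel b k y,
    add_mem (Yel_mul_mem_ySpan b k _ hE) ?_, ?_, ?_⟩
  · rw [(commute_Yel_of_mem_ySpan b k y hD).eq]
    exact Yel_mul_mem_ySpan b k _ hD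
  · rw [map_add, Yel_add, Yel_add]
    exact braid_add_aux h1 h3
  · have h5 : Commute (Yel b k y) (1 - Yel b k (-corootC P i)) :=
      (Commute.one_right _).sub_right (Yel_comm b k _ _)
    rw [add_mul, mul_assoc, h4, mul_assoc D, h5.eq, ← mul_assoc D, h2, map_add, Yel_add, Yel_add,
      mul_sub, sub_mul]
    abel

/-- Multiplying the relation for x by Y^{-s_i x} on the left and Y^{-x} on the right gives the one
for -x, with D replaced by -Y^{-s_i x} D Y^{-x}. -/
lemma BernsteinRel.neg {i : b.support} {x : coweights P} (hx : BernsteinRel b k i x) :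
    BernsteinRel b k i (-x) := by
  obtain ⟨D, hD, h1, h2⟩ := hx
  have hc := (commute_Yel_of_mem_ySpan b k (-x) hD).eq
  refine ⟨-(Yel b k (-wact (finRefl b i) x) * (D * Yel b k (-x))), ?_, ?_, ?_⟩
  · rw [hc]
    exact neg_mem (Yel_mul_mem_ySpan b k _ (Yel_mul_mem_ySpan b k _ hD))
  · have h3 := congrArg (fun z => Yel b k (-wact (finRefl b i) x) * z * Yel b k (-x)) h1
    simp only [mul_add, add_mul, mul_smul_comm, smul_mul_assoc] at h3
    rw [← mul_assoc, mul_assoc _ (Yel b k x), Yel_mul_neg, mul_one, ← mul_assoc, Yel_neg_mul,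
      one_mul, mul_assoc _ D] at h3
    rw [map_neg, h3, smul_neg, add_neg_cancel_right]
  · have h5 : Commute (Yel b k (-x)) (1 - Yel b k (-corootC P i)) :=
      (Commute.one_right _).sub_right (Yel_comm b k _ _)
    rw [neg_mul (Yel b k (-wact (finRefl b i) x) * (D * Yel b k (-x))), mul_assoc,
      mul_assoc D, h5.eq, ← mul_assoc D, h2, sub_mul, Yel_mul_neg, mul_sub, mul_one, ← Yel_add, ← Yel_add, map_neg]
    rw [show -wact (finRefl b i) x + (wact (finRefl b i) x + -x) = -x by abel]
    abel

/-! ### Bernstein relations for fundamental coweights. -/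

lemma wact_finRefl (i : b.support) (x : coweights P) :
    wact (finRefl b i) x = x - pairZ P i x • corootC P i := wact_ofIdx (i : ι) x

lemma inv_finRefl (i : b.support) : (finRefl b i)⁻¹ = finRefl b i := (finSys b).s_inv i

lemma heckeT_mul_genT {g : ExtWeyl P} {i : b.support}
    (h : AffPos b (g • simpleAff b (some i))) :
    heckeT b k g * genT b k (some i) = heckeT b k (g * simpleRefl b (some i)) := by
  rw [← heckeT_simpleRefl]
  apply heckeT_mul
  have h1 := (affSys b).len_mul_s (j := some i) h
  have h2 := (affSys b).len_s (some i)
  change affLen b (g * simpleRefl b (some i)) = _ at h1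
  change affLen b (simpleRefl b (some i)) = _ at h2
  rw [h1, h2]
  rfl

lemma simpleRefl_mul_tau (i : b.support) (x : coweights P) :
    simpleRefl b (some i) * tau P x =
      tau P (wact (finRefl b i) x) * simpleRefl b (some i) := by
  rw [simpleRefl_some, inr_mul_tau]

/-- Here s_i fixes the coweight, and both orders of multiplication are length-additive, so T_i and
Y^λ commute: both products equal T_{τ(λ) s_i}. -/
lemma bernsteinRel_fundCow_ne {i j : b.support} (hij : i ≠ j) :
    BernsteinRel b k i (fundCow b j) := by
  have hp : pairZ P i (fundCow b j) = 0 :=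
    pairZ_fundCow_ne b j i.2 fun e => hij (Subtype.ext e)
  have hw : wact (finRefl b i) (fundCow b j) = fundCow b j := by
    rw [wact_finRefl, hp, zero_smul, sub_zero]
  have hd := fundCow_mem_dom b j
  refine ⟨0, zero_mem _, ?_, by rw [hw, sub_self, zero_mul]⟩
  rw [hw, smul_zero, add_zero, heckeY_spec b k _ hd, heckeT_mul_genT, ← heckeT_simpleRefl]
  · have e : tau P (fundCow b j) * simpleRefl b (some i) =
        simpleRefl b (some i) * tau P (fundCow b j) := by rw [simpleRefl_mul_tau, hw]
    rw [e]
    apply heckeT_mul_of_forall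
    intro a h1 h2
    obtain ⟨h3, h4⟩ := of_not_affPos_tau b hd h1 h2
    rw [simpleRefl_some, inr_smul, tau_smul]
    simp only [AffPos, not_or, not_and]
    omega
  · rw [tau_smul]
    simp only [AffPos, simpleAff, hp]
    exact Or.inr ⟨by simp, RootPairing.Base.isPos_of_mem_support i.2⟩

/-- The content is T_i⁻¹ Y^x = Y^{s_i x} T_i. It comes from computing T_{τ(x) s_i τ(x)} in two ways:
as T_{τ(x) s_i} Y^x with T_{τ(x) s_i} T_i = Y^x, and as Y^{x + s_i x} T_i. The quadratic relation
then introduces the factor k_i - k_i⁻¹, and D is Y^x because s_i x = x - α_i^∨. -/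
lemma bernsteinRel_fundCow_self (i : b.support) : BernsteinRel b k i (fundCow b i) := by
  set x := fundCow b i with hx
  have hp : pairZ P i x = 1 := pairZ_fundCow_self b i
  have hw : wact (finRefl b i) x = x - corootC P i := by
    rw [wact_finRefl, hp, one_smul]
  have hd : x ∈ dom b := fundCow_mem_dom b i
  have hpi : b.IsPos i := RootPairing.Base.isPos_of_mem_support i.2
  -- The coweight 2x - α_i^∨ pairs to 0 with α_i and nonnegatively with the other simple roots. Its
  -- dominance allows Y to be replaced by T on it.
  have hν : x + wact (finRefl b i) x ∈ dom b := by
    apply mem_dom_of_simple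
    intro j hj
    rw [hw, pairZ_add, sub_eq_add_neg, pairZ_add, pairZ_neg, pairZ_corootC]
    by_cases hji : j = i
    · rw [hji, hp, P.pairingIn_same]; norm_num
    · rw [pairZ_fundCow_ne b i hj hji]
      have := b.pairingIn_le_zero_of_ne hji hj i.2
      omega
  have hνi : pairZ P i (x + wact (finRefl b i) x) = 0 := by
    rw [hw, pairZ_add, sub_eq_add_neg, pairZ_add, pairZ_neg, pairZ_corootC, hp, P.pairingIn_same]
    norm_num
  have hss : simpleRefl b (some i) • simpleAff b (some i) = affNeg (simpleAff b (some i)) :=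
    affRefl_smul_self _
  have hA : heckeT b k (tau P x * simpleRefl b (some i)) * genT b k (some i) =
      Yel b k x := by
    have h2 : tau P x * simpleRefl b (some i) * simpleRefl b (some i) = tau P x :=
      (affSys b).mul_s_cancel (some i) _
    rw [heckeT_mul_genT, h2, heckeY_spec b k x hd]
    rw [mul_smul, hss, smul_affNeg, affPos_neg_iff, tau_smul]
    simp [AffPos, simpleAff, hp]
  have hB : heckeT b k (tau P x * simpleRefl b (some i)) * Yel b k x =
      heckeT b k (tau P x * simpleRefl b (some i) * tau P x) := by
    rw [heckeY_spec b k x hd]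
    apply heckeT_mul_of_forall
    intro a h1 h2
    obtain ⟨h3, h4⟩ := of_not_affPos_tau b hd h1 h2
    rw [mul_smul, simpleRefl_some, tau_smul, inr_smul, tau_smul]
    have he : finRefl b i • a.grad = P.reflectionPerm (i : ι) a.grad := rfl
    simp only [AffPos, not_or, not_and, he]
    by_cases hai : a.grad = i
    · have h0 : 0 ≤ a.lvl := by rcases h1 with h | h <;> omega
      rw [hai, pairZ_neg_left, isPos_neg_iff]
      rw [hai] at h4
      exact ⟨by omega, fun _ => not_not.mpr hpi⟩
    · have := hd _ (h3.reflectionPerm i.2 hai)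
      omega
  have hC : Yel b k (x + wact (finRefl b i) x) * genT b k (some i) =
      heckeT b k (tau P (x + wact (finRefl b i) x) * simpleRefl b (some i)) := by
    rw [heckeY_spec b k _ hν, heckeT_mul_genT]
    rw [tau_smul]
    simp only [AffPos, simpleAff, hνi]
    exact Or.inr ⟨by simp, hpi⟩
  have hD : heckeT b k (tau P x * simpleRefl b (some i)) * Yel b k x =
      Yel b k x * (Yel b k (wact (finRefl b i) x) * genT b k (some i)) := by
    rw [hB, mul_assoc (tau P x), simpleRefl_mul_tau, ← mul_assoc, ← tau_add, ← hC, Yel_add,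
      mul_assoc]
  refine ⟨Yel b k x, Yel_mem_ySpan b k x, ?_, ?_⟩
  -- The relation is proved after left multiplication by T_i and then by the unit T_{τ(x) s_i},
  -- which avoids writing T_i⁻¹.
  · have h1 : genT b k (some i) * (genT b k (some i) * Yel b k x) =
        genT b k (some i) * (Yel b k (wact (finRefl b i) x) * genT b k (some i) +
          kdiff b k (some i) • Yel b k x) := by
      apply (isUnit_heckeT b k (tau P x * simpleRefl b (some i))).mul_left_cancel
      rw [← mul_assoc _ (genT b k (some i)) (genT b k (some i) * _), hA,
        ← mul_assoc _ (genT b k (some i)) (_ + _), hA, mul_add, ← hD, mul_smul_comm]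
      have h2 : Yel b k x * (genT b k (some i) * Yel b k x) =
          heckeT b k (tau P x * simpleRefl b (some i)) *
            (genT b k (some i) * genT b k (some i)) * Yel b k x := by
        rw [← hA]
        simp only [mul_assoc]
      rw [h2, genT_mul_self, mul_add, mul_smul_comm, hA, mul_one, add_mul, smul_mul_assoc,
        add_comm]
    exact (unitT b k (some i)).isUnit.mul_left_cancel h1
  · rw [hw, mul_sub, mul_one, ← Yel_add, sub_eq_add_neg x]

theorem bernsteinRel (i : b.support) (x : coweights P) : BernsteinRel b k i x := by
  let S : AddSubgroup (coweights P) :=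
    { carrier := {x | BernsteinRel b k i x}
      zero_mem' := bernsteinRel_zero b k i
      add_mem' := BernsteinRel.add b k
      neg_mem' := BernsteinRel.neg b k }
  have h : x ∈ S := by
    rw [eq_sum_fundCow b x]
    refine sum_mem fun j _ => zsmul_mem ?_ _
    by_cases hij : i = j
    · subst hij; exact bernsteinRel_fundCow_self b k i
    · exact bernsteinRel_fundCow_ne b k hij
  exact h

end AffHecke

end

noncomputable section

set_option linter.unusedSectionVars false

namespace AffHecke

variable {ι V N : Type*} [AddCommGroup V] [Module ℝ V] [AddCommGroup N] [Module ℝ N]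
  {P : RootPairing ι ℝ V N} [Finite ι] [P.IsRootSystem] [P.IsCrystallographic] [P.IsIrreducible]
  [P.IsReduced] (b : P.Base) (k : Mult P)

@[elab_as_elim]
lemma weyl_induction {motive : P.weylGroup → Prop} (w : P.weylGroup) (one : motive 1)
    (mul : ∀ (i : b.support) (w : P.weylGroup), b.IsPos (w⁻¹ • (i : ι)) → motive w →
      motive (finRefl b i * w)) : motive w := by
  obtain ⟨L, rfl, hL⟩ := exists_finSys_word b w
  induction L with
  | nil => exact one
  | cons i L ih =>
    rw [ReflSys.wprod_cons]
    obtain ⟨h1, h2⟩ := hL.tail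
    exact mul i _ h2 (ih h1)

/-! ### The length filtration on the span of the elements `T_w Y^λ` -/

/-- The span of the elements `T_v Y^λ` with `l(v) < n`. -/
def lenFil (n : ℕ) : Submodule ℂ (Hecke b k) :=
  Submodule.span ℂ {h | ∃ v x, finLen b v < n ∧ h = finT b k v * Yel b k x}

lemma finT_mul_Yel_mem {n : ℕ} {v : P.weylGroup} (h : finLen b v < n) (x : coweights P) :
    finT b k v * Yel b k x ∈ lenFil b k n := Submodule.subset_span ⟨v, x, h, rfl⟩

lemma finT_mem {n : ℕ} {v : P.weylGroup} (h : finLen b v < n) : finT b k v ∈ lenFil b k n := by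
  have := finT_mul_Yel_mem b k h 0
  rwa [Yel_zero, mul_one] at this

lemma lenFil_mono {m n : ℕ} (h : m ≤ n) : lenFil b k m ≤ lenFil b k n := by
  apply Submodule.span_mono
  rintro _ ⟨v, x, hv, rfl⟩
  exact ⟨v, x, hv.trans_le h, rfl⟩

lemma lenFil_zero : lenFil b k 0 = ⊥ := by
  rw [lenFil, Submodule.span_eq_bot]
  rintro _ ⟨v, x, hv, -⟩
  exact absurd hv (Nat.not_lt_zero _)

lemma mul_Yel_mem {n : ℕ} {h : Hecke b k} (hh : h ∈ lenFil b k n) (x : coweights P) :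
    h * Yel b k x ∈ lenFil b k n := by
  induction hh using Submodule.span_induction with
  | mem h hm =>
    obtain ⟨v, y, hv, rfl⟩ := hm
    rw [mul_assoc, ← Yel_add]
    exact finT_mul_Yel_mem b k hv _
  | zero => rw [zero_mul]; exact zero_mem _
  | add h h' _ _ h1 h2 => rw [add_mul]; exact add_mem h1 h2
  | smul c h _ h1 => rw [smul_mul_assoc]; exact Submodule.smul_mem _ _ h1

lemma finLen_finRefl_mul {i : b.support} {w : P.weylGroup} (h : b.IsPos (w⁻¹ • (i : ι))) :
    finLen b (finRefl b i * w) = finLen b w + 1 := (finSys b).len_s_mul h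

lemma finLen_finRefl_mul_of_not {i : b.support} {w : P.weylGroup}
    (h : ¬ b.IsPos (w⁻¹ • (i : ι))) :
    finLen b w = finLen b (finRefl b i * w) + 1 := ((finSys b).len_s_mul_of_not h).symm

lemma genT_mul_mem {n : ℕ} {h : Hecke b k} (hh : h ∈ lenFil b k n) (i : b.support) :
    genT b k (some i) * h ∈ lenFil b k (n + 1) := by
  induction hh using Submodule.span_induction with
  | mem h hm =>
    obtain ⟨v, y, hv, rfl⟩ := hm
    rw [← mul_assoc]
    by_cases hp : b.IsPos (v⁻¹ • (i : ι))
    · rw [genT_mul_finT b k hp]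
      apply finT_mul_Yel_mem
      rw [finLen_finRefl_mul b hp]
      omega
    · rw [genT_mul_finT_of_not b k hp, add_mul, smul_mul_assoc]
      have := finLen_finRefl_mul_of_not b hp
      exact add_mem (finT_mul_Yel_mem b k (by omega) _)
        (Submodule.smul_mem _ _ (finT_mul_Yel_mem b k (by omega) _))
  | zero => rw [mul_zero]; exact zero_mem _
  | add h h' _ _ h1 h2 => rw [mul_add]; exact add_mem h1 h2
  | smul c h _ h1 => rw [mul_smul_comm]; exact Submodule.smul_mem _ _ h1

lemma Yel_mul_genT (x : coweights P) (i : b.support) : ∃ D ∈ ySpan b k,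
    Yel b k x * genT b k (some i) =
      genT b k (some i) * Yel b k (wact (finRefl b i) x) - kdiff b k (some i) • D := by
  obtain ⟨D, hD, h, -⟩ := bernsteinRel b k i (wact (finRefl b i) x)
  refine ⟨D, hD, ?_⟩
  have hs : finRefl b i * finRefl b i = 1 := (finSys b).s_mul_self i
  rw [h, ← wact_mul, hs, wact_one, add_sub_cancel_right]

lemma ySpan_mul_mem {n : ℕ} {h D : Hecke b k}
    (hh : ∀ x, Yel b k x * h ∈ lenFil b k n) (hD : D ∈ ySpan b k) : D * h ∈ lenFil b k n := by
  induction hD using Submodule.span_induction with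
  | mem D h => obtain ⟨y, rfl⟩ := h; exact hh y
  | zero => rw [zero_mul]; exact zero_mem _
  | add D E _ _ h1 h2 => rw [add_mul]; exact add_mem h1 h2
  | smul c D _ h => rw [smul_mul_assoc]; exact Submodule.smul_mem _ _ h

/-- Modulo elements of smaller length, `Y^λ T_w` is `T_w Y^{w⁻¹ λ}`. -/
lemma Yel_mul_finT_sub_mem (w : P.weylGroup) (x : coweights P) :
    Yel b k x * finT b k w - finT b k w * Yel b k (wact w⁻¹ x) ∈ lenFil b k (finLen b w) := by
  induction w using weyl_induction b generalizing x with
  | one =>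
    rw [finT_one, inv_one, wact_one, mul_one, one_mul, sub_self]
    exact zero_mem _
  | mul i w hpos ih =>
    rw [finLen_finRefl_mul b hpos, ← genT_mul_finT b k hpos]
    obtain ⟨D, hD, h1⟩ := Yel_mul_genT b k x i
    have h2 := genT_mul_mem b k (ih (wact (finRefl b i) x)) i
    have hY (y : coweights P) : Yel b k y * finT b k w ∈ lenFil b k (finLen b w + 1) := by
      have := add_mem (lenFil_mono b k (Nat.le_succ _) (ih y))
        (finT_mul_Yel_mem b k (Nat.lt_succ_self (finLen b w)) (wact w⁻¹ y))
      rwa [sub_add_cancel] at this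
    have h3 := Submodule.smul_mem _ (kdiff b k (some i)) (ySpan_mul_mem b k hY hD)
    have h4 := sub_mem h2 h3
    rw [mul_inv_rev, inv_finRefl, wact_mul, ← mul_assoc, h1]
    convert h4 using 1
    rw [sub_mul, mul_sub, smul_mul_assoc, mul_assoc, mul_assoc]
    abel

lemma Yel_mul_mem {n : ℕ} {h : Hecke b k} (hh : h ∈ lenFil b k n) (x : coweights P) :
    Yel b k x * h ∈ lenFil b k n := by
  induction hh using Submodule.span_induction with
  | mem h hm =>
    obtain ⟨v, y, hv, rfl⟩ := hm
    have h1 := mul_Yel_mem b k (Yel_mul_finT_sub_mem b k v x) y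
    have h2 := add_mem (lenFil_mono b k hv.le h1)
      (finT_mul_Yel_mem b k hv (wact v⁻¹ x + y))
    rwa [Yel_add, ← mul_assoc, ← add_mul, sub_add_cancel, mul_assoc] at h2
  | zero => rw [mul_zero]; exact zero_mem _
  | add h h' _ _ h1 h2 => rw [mul_add]; exact add_mem h1 h2
  | smul c h _ h1 => rw [mul_smul_comm]; exact Submodule.smul_mem _ _ h1

/-- The subalgebra generated by the `Y^λ` and the `T_i`, `1 ≤ i ≤ n`. -/
abbrev bern : Subalgebra ℂ (Hecke b k) := parabolic b Set.univ k

lemma parabolic_le_bern (I : Set b.support) : parabolic b I k ≤ bern b k :=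
  Algebra.adjoin_mono (Set.union_subset_union_right _ (Set.image_mono (Set.subset_univ I)))

lemma Yel_mem_bern (x : coweights P) : Yel b k x ∈ bern b k := Yel_mem_parabolic b _ k x

lemma genT_mem_bern (i : b.support) : genT b k (some i) ∈ bern b k :=
  genT_mem_parabolic b _ k (Set.mem_univ i)

/-- Left multiplication by a generator raises the filtration degree by at most one. Starting from
`1`, every element of `bern` is therefore reached by some step of the filtration, so the T_w Y^λ
span `bern`. -/
lemma bern_mul_mem {a : Hecke b k} (ha : a ∈ bern b k) :
    ∀ (n : ℕ) (h : Hecke b k), h ∈ lenFil b k n → ∃ m, a * h ∈ lenFil b k m := by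
  induction ha using Algebra.adjoin_induction with
  | mem a ha =>
    rcases ha with ⟨x, rfl⟩ | ⟨i, -, rfl⟩
    · exact fun n h hh => ⟨n, Yel_mul_mem b k hh x⟩
    · exact fun n h hh => ⟨n + 1, genT_mul_mem b k hh i⟩
  | algebraMap c =>
    intro n h hh
    rw [← Algebra.smul_def]
    exact ⟨n, Submodule.smul_mem _ _ hh⟩
  | add a a' _ _ h1 h2 =>
    intro n h hh
    obtain ⟨m1, h1⟩ := h1 n h hh
    obtain ⟨m2, h2⟩ := h2 n h hh
    rw [add_mul]
    exact ⟨max m1 m2, add_mem (lenFil_mono b k (le_max_left _ _) h1)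
      (lenFil_mono b k (le_max_right _ _) h2)⟩
  | mul a a' _ _ h1 h2 =>
    intro n h hh
    obtain ⟨m2, h2⟩ := h2 n h hh
    rw [mul_assoc]
    exact h1 m2 _ h2

lemma exists_mem_lenFil {a : Hecke b k} (ha : a ∈ bern b k) : ∃ n, a ∈ lenFil b k n := by
  have h1 : (1 : Hecke b k) ∈ lenFil b k 1 := by
    rw [← finT_one b k]
    apply finT_mem
    rw [(finLen_eq_zero_iff b 1).mpr rfl]
    exact zero_lt_one
  obtain ⟨m, h⟩ := bern_mul_mem b k ha 1 1 h1
  exact ⟨m, by rwa [mul_one] at h⟩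

lemma finT_mem_bern (w : P.weylGroup) : finT b k w ∈ bern b k := by
  induction w using weyl_induction b with
  | one => rw [finT_one]; exact one_mem _
  | mul i w hpos ih =>
    rw [← genT_mul_finT b k hpos]
    exact mul_mem (genT_mem_bern b k i) ih

/-- Linear maps on `bern` are compared on the spanning set T_w Y^λ; most later identities for
`coords`, `psi` and `indMk` are proved this way. -/
lemma bern_ext {M : Type*} [AddCommGroup M] [Module ℂ M] {f g : Hecke b k →ₗ[ℂ] M}
    (H : ∀ w x, f (finT b k w * Yel b k x) = g (finT b k w * Yel b k x)) {a : Hecke b k}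
    (ha : a ∈ bern b k) : f a = g a := by
  obtain ⟨n, hn⟩ := exists_mem_lenFil b k ha
  clear ha
  induction hn using Submodule.span_induction with
  | mem h hm => obtain ⟨v, y, hv, rfl⟩ := hm; exact H v y
  | zero => rw [map_zero, map_zero]
  | add h h' _ _ h1 h2 => rw [map_add, map_add, h1, h2]
  | smul c h _ h1 => rw [map_smul, map_smul, h1]

end AffHecke

end

noncomputable section

set_option linter.unusedSectionVars false

namespace AffHecke

variable {ι V N : Type*} [AddCommGroup V] [Module ℝ V] [AddCommGroup N] [Module ℝ N]
  {P : RootPairing ι ℝ V N}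

/-! ### The group algebra of the coweight lattice -/

/-- The group algebra of the coweight lattice. -/
abbrev CowAlg (P : RootPairing ι ℝ V N) : Type _ := AddMonoidAlgebra ℂ (coweights P)

/-- The basis element `e^λ` of the group algebra. -/
def eX (x : coweights P) : CowAlg P := AddMonoidAlgebra.single x 1

lemma eX_add (x y : coweights P) : eX (x + y) = eX x * eX y := by
  rw [eX, eX, eX, AddMonoidAlgebra.single_mul_single, one_mul]

lemma eX_zero : eX (0 : coweights P) = 1 := rfl

lemma eX_injective : Function.Injective (eX : coweights P → CowAlg P) :=
  AddMonoidAlgebra.single_left_injective one_ne_zero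

lemma single_eq_smul_eX (x : coweights P) (c : ℂ) :
    (AddMonoidAlgebra.single x c : CowAlg P) = c • eX x := by
  rw [eX, AddMonoidAlgebra.smul_single, smul_eq_mul, mul_one]

/-- The coweight lattice embeds in a rational vector space, which has the two-unique-sums property.
The absence of zero divisors permits cancellation of factors such as 1 - e^{α^∨}. -/
instance : NoZeroDivisors (CowAlg P) := by
  let _ : Module ℚ N := Module.compHom N (algebraMap ℚ ℝ)
  have : TwoUniqueSums (coweights P) :=
    TwoUniqueSums.of_injective_addHom (coweights P).subtype.toAddHom Subtype.val_injective
      inferInstance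
  infer_instance

variable [Finite ι] [P.IsRootSystem] [P.IsCrystallographic] [P.IsIrreducible]
  (b : P.Base) (k : Mult P)

/-- The homomorphism `e^λ ↦ Y^λ`. -/
def yHom : CowAlg P →ₐ[ℂ] Hecke b k :=
  AddMonoidAlgebra.lift ℂ (Hecke b k) (coweights P) ((Units.coeHom _).comp (heckeY b k))

@[simp] lemma yHom_eX (x : coweights P) : yHom b k (eX x) = Yel b k x := by
  rw [yHom, eX, AddMonoidAlgebra.lift_single, one_smul]
  rfl

lemma exists_yHom_eq {D : Hecke b k} (hD : D ∈ ySpan b k) : ∃ d, yHom b k d = D := by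
  have h : ySpan b k ≤ LinearMap.range (yHom b k).toLinearMap := by
    rw [ySpan, Submodule.span_le]
    rintro _ ⟨x, rfl⟩
    exact ⟨eX x, yHom_eX b k x⟩
  exact h hD

/-- The linear map `(q_w)_w ↦ ∑ T_w q_w(Y)`. -/
def tyMap : (P.weylGroup →₀ CowAlg P) →ₗ[ℂ] Hecke b k :=
  Finsupp.lsum ℂ fun w => (LinearMap.mulLeft ℂ (finT b k w)).comp (yHom b k).toLinearMap

lemma tyMap_single (w : P.weylGroup) (q : CowAlg P) :
    tyMap b k (Finsupp.single w q) = finT b k w * yHom b k q := by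
  simp [tyMap]

variable [P.IsReduced]

/-! ### The Bernstein basis -/

lemma finT_mul_heckeT_tau (w : P.weylGroup) {x : coweights P} (hx : x ∈ dom b) :
    finT b k w * heckeT b k (tau P x) = heckeT b k (SemidirectProduct.inr w * tau P x) := by
  apply heckeT_mul_of_forall
  intro a h1 h2
  obtain ⟨h3, h4⟩ := of_not_affPos_tau b hx h1 h2
  rw [tau_smul, inr_smul]
  simp only [AffPos, not_or, not_and]
  omega

lemma exists_forall_add_mem_dom (s : Finset (coweights P)) :
    ∃ m, ∀ x ∈ s, x + m ∈ dom b := by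
  choose d hd e he hde using exists_dom_sub b
  refine ⟨∑ x ∈ s, e x, fun x hx => ?_⟩
  classical
  rw [← Finset.add_sum_erase s e hx, ← add_assoc]
  have : x + e x = d x := by
    nth_rewrite 1 [hde x]
    exact sub_add_cancel _ _
  rw [this]
  exact add_mem (hd x) (sum_mem fun y _ => he y)

lemma inr_mul_tau_injective :
    Function.Injective fun p : P.weylGroup × coweights P =>
      (SemidirectProduct.inr p.1 * tau P p.2 : ExtWeyl P) := by
  rintro ⟨v, x⟩ ⟨w, y⟩ h
  have hr : v = w := by
    have := congrArg SemidirectProduct.right h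
    simpa [tau] using this
  subst hr
  have h2 : tau P x = tau P y := mul_left_cancel h
  have h3 := SemidirectProduct.inl_injective h2
  rw [Multiplicative.ofAdd.injective h3]

/-- Right multiplication by Y^m, with m so dominant that all exponents in a given relation become
dominant, turns each T_w Y^λ into T_{w τ(λ+m)}. These are distinct members of the independent family
of the T's. -/
theorem linearIndependent_finT_mul_Yel :
    LinearIndependent ℂ fun p : P.weylGroup × coweights P => finT b k p.1 * Yel b k p.2 := by
  classical
  rw [linearIndependent_iff']
  intro s g hg p hp
  obtain ⟨m, hm⟩ := exists_forall_add_mem_dom b (s.image Prod.snd)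
  have hinj : Function.Injective fun p : P.weylGroup × coweights P =>
      (SemidirectProduct.inr p.1 * tau P (p.2 + m) : ExtWeyl P) := by
    intro p q h
    have := inr_mul_tau_injective (P := P) (a₁ := (p.1, p.2 + m)) (a₂ := (q.1, q.2 + m)) h
    rw [Prod.mk.injEq, add_left_inj] at this
    exact Prod.ext this.1 this.2
  have hli := (linearIndependent_heckeT b k).comp _ hinj
  rw [linearIndependent_iff'] at hli
  refine hli s g ?_ p hp
  have h2 := congrArg (· * Yel b k m) hg
  simp only [zero_mul, Finset.sum_mul] at h2
  rw [← h2]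
  refine Finset.sum_congr rfl fun q hq => ?_
  have hd := hm q.2 (Finset.mem_image_of_mem _ hq)
  rw [Function.comp_apply, ← finT_mul_heckeT_tau b k _ hd, ← heckeY_spec b k _ hd, Yel_add,
    smul_mul_assoc, mul_assoc]

lemma tyMap_injective : Function.Injective (tyMap b k) := by
  let e : (P.weylGroup × coweights P →₀ ℂ) ≃ₗ[ℂ] (P.weylGroup →₀ CowAlg P) :=
    (Finsupp.curryLinearEquiv ℂ).trans
      (Finsupp.mapRange.linearEquiv (AddMonoidAlgebra.coeffLinearEquiv ℂ).symm)
  have h : (tyMap b k).comp e.toLinearMap =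
      Finsupp.linearCombination ℂ fun p => finT b k p.1 * Yel b k p.2 := by
    have h1 (w : P.weylGroup) (x : coweights P) :
        e (Finsupp.single (w, x) 1) = Finsupp.single w (eX x) := by
      simp [e, eX]
    ext ⟨w, x⟩
    simp [h1, tyMap_single]
  have h2 := linearIndependent_finT_mul_Yel b k
  rw [LinearIndependent, ← h] at h2
  intro q q' hq
  apply e.symm.injective
  apply h2
  simpa using hq

/-- The coordinates with respect to the elements `T_w Y^λ`, as a left inverse of `tyMap`. -/
def coords : Hecke b k →ₗ[ℂ] (P.weylGroup →₀ CowAlg P) :=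
  ((tyMap b k).exists_leftInverse_of_injective
    (LinearMap.ker_eq_bot.mpr (tyMap_injective b k))).choose

lemma coords_tyMap (q : P.weylGroup →₀ CowAlg P) : coords b k (tyMap b k q) = q :=
  LinearMap.congr_fun ((tyMap b k).exists_leftInverse_of_injective
    (LinearMap.ker_eq_bot.mpr (tyMap_injective b k))).choose_spec q

lemma coords_finT_mul_yHom (w : P.weylGroup) (q : CowAlg P) :
    coords b k (finT b k w * yHom b k q) = Finsupp.single w q := by
  rw [← tyMap_single, coords_tyMap]

lemma coords_finT_mul_Yel (w : P.weylGroup) (x : coweights P) :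
    coords b k (finT b k w * Yel b k x) = Finsupp.single w (eX x) := by
  rw [← yHom_eX, coords_finT_mul_yHom]

lemma yHom_injective : Function.Injective (yHom b k) := by
  intro p q h
  have h1 := coords_finT_mul_yHom b k 1 p
  rw [h, coords_finT_mul_yHom] at h1
  exact (Finsupp.single_injective _ h1).symm

lemma tyMap_coords {h : Hecke b k} (hh : h ∈ bern b k) : tyMap b k (coords b k h) = h := by
  refine bern_ext b k (f := (tyMap b k).comp (coords b k)) (g := LinearMap.id) ?_ hh
  intro w x
  rw [LinearMap.comp_apply, coords_finT_mul_Yel, tyMap_single, yHom_eX]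
  rfl

lemma eq_zero_of_coords {h : Hecke b k} (hh : h ∈ bern b k) (h0 : coords b k h = 0) : h = 0 := by
  rw [← tyMap_coords b k hh, h0, map_zero]

lemma coords_mul_yHom {h : Hecke b k} (hh : h ∈ bern b k) (p : CowAlg P) (w : P.weylGroup) :
    coords b k (h * yHom b k p) w = coords b k h w * p := by
  classical
  refine bern_ext b k
    (f := (Finsupp.lapply w).comp ((coords b k).comp (LinearMap.mulRight ℂ (yHom b k p))))
    (g := (LinearMap.mulRight ℂ p).comp ((Finsupp.lapply w).comp (coords b k))) ?_ hh
  intro v x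
  simp only [LinearMap.comp_apply, LinearMap.mulRight_apply, Finsupp.lapply_apply]
  rw [mul_assoc, ← yHom_eX, ← map_mul, coords_finT_mul_yHom, coords_finT_mul_yHom,
    Finsupp.single_apply, Finsupp.single_apply, ite_mul, zero_mul]

lemma yHom_mem_bern (p : CowAlg P) : yHom b k p ∈ bern b k := by
  induction p using AddMonoidAlgebra.induction_linear with
  | zero => rw [map_zero]; exact zero_mem _
  | add p q h1 h2 => rw [map_add]; exact add_mem h1 h2
  | single x c =>
    rw [single_eq_smul_eX, map_smul, yHom_eX]
    exact Subalgebra.smul_mem _ (Yel_mem_bern b k x) c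

/-- Right multiplication by a nonzero combination of the `Y^λ` is injective. -/
lemma eq_zero_of_mul_yHom {h : Hecke b k} (hh : h ∈ bern b k) {p : CowAlg P} (hp : p ≠ 0)
    (h0 : h * yHom b k p = 0) : h = 0 := by
  apply eq_zero_of_coords b k hh
  ext1 w
  have h1 := coords_mul_yHom b k hh p w
  rw [h0, map_zero, Finsupp.zero_apply] at h1
  exact (mul_eq_zero.mp h1.symm).resolve_right hp

lemma lenFil_le_bern (n : ℕ) {h : Hecke b k} (hh : h ∈ lenFil b k n) : h ∈ bern b k := by
  have h1 : lenFil b k n ≤ Subalgebra.toSubmodule (bern b k) := by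
    rw [lenFil, Submodule.span_le]
    rintro _ ⟨v, x, -, rfl⟩
    exact Subalgebra.mul_mem _ (finT_mem_bern b k v) (Yel_mem_bern b k x)
  exact h1 hh

lemma coords_eq_zero_of_mem_lenFil {n : ℕ} {h : Hecke b k} (hh : h ∈ lenFil b k n)
    {w : P.weylGroup} (hw : n ≤ finLen b w) : coords b k h w = 0 := by
  induction hh using Submodule.span_induction with
  | mem h hm =>
    obtain ⟨v, y, hv, rfl⟩ := hm
    rw [coords_finT_mul_Yel, Finsupp.single_eq_of_ne]
    rintro rfl
    omega
  | zero => rw [map_zero, Finsupp.zero_apply]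
  | add h h' _ _ h1 h2 => rw [map_add, Finsupp.add_apply, h1, h2, add_zero]
  | smul c h _ h1 => rw [map_smul, Finsupp.smul_apply, h1, smul_zero]

lemma finT_mul_yHom_mem {n : ℕ} {v : P.weylGroup} (hv : finLen b v < n) (p : CowAlg P) :
    finT b k v * yHom b k p ∈ lenFil b k n := by
  induction p using AddMonoidAlgebra.induction_linear with
  | zero => rw [map_zero, mul_zero]; exact zero_mem _
  | add p q h1 h2 => rw [map_add, mul_add]; exact add_mem h1 h2
  | single x c =>
    rw [single_eq_smul_eX, map_smul, yHom_eX, mul_smul_comm]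
    exact Submodule.smul_mem _ _ (finT_mul_Yel_mem b k hv x)

lemma mem_lenFil_of_coords {n : ℕ} {h : Hecke b k} (hh : h ∈ bern b k)
    (h0 : ∀ w, n ≤ finLen b w → coords b k h w = 0) : h ∈ lenFil b k n := by
  rw [← tyMap_coords b k hh, tyMap, Finsupp.lsum_apply, Finsupp.sum]
  refine sum_mem fun w _ => ?_
  by_cases hw : n ≤ finLen b w
  · rw [h0 w hw, map_zero]
    exact zero_mem _
  · exact finT_mul_yHom_mem b k (not_le.mp hw) _

/-- The Bernstein relation, with `d = (e^λ - e^{s_i λ}) / (1 - e^{-α_i^∨})`. -/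
theorem exists_bernstein (i : b.support) (x : coweights P) : ∃ d : CowAlg P,
    genT b k (some i) * Yel b k x =
      Yel b k (wact (finRefl b i) x) * genT b k (some i) + kdiff b k (some i) • yHom b k d ∧
    d * (1 - eX (-corootC P i)) = eX x - eX (wact (finRefl b i) x) := by
  obtain ⟨D, hD, h1, h2⟩ := bernsteinRel b k i x
  obtain ⟨d, rfl⟩ := exists_yHom_eq b k hD
  refine ⟨d, h1, yHom_injective b k ?_⟩
  rw [map_mul, map_sub, map_one, map_sub, yHom_eX, yHom_eX, yHom_eX, h2]

end AffHecke

end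

noncomputable section

set_option linter.unusedSectionVars false

namespace AffHecke

variable {ι V N : Type*} [AddCommGroup V] [Module ℝ V] [AddCommGroup N] [Module ℝ N]
  {P : RootPairing ι ℝ V N} [Finite ι] [P.IsRootSystem] [P.IsCrystallographic] [P.IsIrreducible]
  [P.IsReduced] (b : P.Base) (k : Mult P)

/-! ### Inversion sets -/

/-- The inversion set of an element of the finite Weyl group. -/
def invSet (w : P.weylGroup) : Finset ι :=
  (Set.toFinite {i : ι | b.IsPos i ∧ ¬ b.IsPos (w • i)}).toFinset

@[simp] lemma mem_invSet {w : P.weylGroup} {i : ι} :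
    i ∈ invSet b w ↔ b.IsPos i ∧ ¬ b.IsPos (w • i) := by
  simp [invSet]

lemma invSet_one : invSet b (1 : P.weylGroup) = ∅ := by
  ext i
  simp

lemma inv_smul_notMem_invSet (i : b.support) (w : P.weylGroup) :
    w⁻¹ • (i : ι) ∉ invSet b w := by
  rw [mem_invSet, smul_inv_smul]
  exact fun h => h.2 (RootPairing.Base.isPos_of_mem_support i.2)

lemma invSet_finRefl_mul {i : b.support} {w : P.weylGroup} (h : b.IsPos (w⁻¹ • (i : ι))) :
    invSet b (finRefl b i * w) =
      Finset.cons (w⁻¹ • (i : ι)) (invSet b w) (inv_smul_notMem_invSet b i w) := by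
  ext j
  rw [Finset.mem_cons, mem_invSet, mem_invSet, mul_smul]
  constructor
  · rintro ⟨h1, h2⟩
    by_cases h3 : b.IsPos (w • j)
    · left
      have := (finSys b).eq_a_of_pos_of_not_pos (j := i) (r := w • j) h3 h2
      rw [eq_inv_smul_iff]
      exact this
    · exact Or.inr ⟨h1, h3⟩
  · rintro (rfl | ⟨h1, h2⟩)
    · refine ⟨h, ?_⟩
      rw [smul_inv_smul]
      exact (finSys b).not_pos_s_smul_a i
    · refine ⟨h1, fun h3 => ?_⟩
      have h4 := (finSys b).eq_a_of_pos_of_not_pos (j := i) (r := finRefl b i • w • j) h3 (by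
        change ¬ b.IsPos ((finSys b).s i • (finSys b).s i • w • j)
        rwa [ReflSys.s_smul_s_smul])
      have h5 : w • j = (finSys b).neg (i : ι) := by
        have h6 := congrArg (fun r => finRefl b i • r) h4
        have h7 := (finSys b).s_smul_s_smul i (w • j)
        exact h7.symm.trans (h6.trans ((finSys b).s_smul_a i))
      have h8 : j = (finSys b).neg (w⁻¹ • (i : ι)) := by
        rw [← (finSys b).smul_neg, ← h5, inv_smul_smul]
      rw [h8] at h1
      exact (finSys b).not_pos_neg h h1

/-- The leading coefficient `∏ (1 - e^{β^∨})` of the intertwiner, over the inversions `β`. -/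
def qInv (w : P.weylGroup) : CowAlg P := ∏ i ∈ invSet b w, (1 - eX (corootC P i))

/-! ### Intertwiners -/

lemma mul_yHom_mem {n : ℕ} {h : Hecke b k} (hh : h ∈ lenFil b k n) (p : CowAlg P) :
    h * yHom b k p ∈ lenFil b k n := by
  apply mem_lenFil_of_coords b k (mul_mem (lenFil_le_bern b k n hh) (yHom_mem_bern b k p))
  intro w hw
  rw [coords_mul_yHom b k (lenFil_le_bern b k n hh), coords_eq_zero_of_mem_lenFil b k hh hw,
    zero_mul]

lemma simpleInt_eq (i : b.support) : simpleInt b k i =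
    genT b k (some i) * (1 - Yel b k (corootC P i)) +
      kdiff b k (some i) • Yel b k (corootC P i) := rfl

lemma simpleInt_mem_bern (i : b.support) : simpleInt b k i ∈ bern b k :=
  add_mem (mul_mem (genT_mem_bern b k i) (sub_mem (one_mem _) (Yel_mem_bern b k _)))
    (Subalgebra.smul_mem _ (Yel_mem_bern b k _) _)

lemma intertwine_aux {A : Type*} [Ring A] [Algebra ℂ A] {T y y' u D : A} {c : ℂ}
    (h1 : T * y = y' * T + c • D) (h2 : D * (1 - u) = -((y - y') * u)) (hu : Commute y u) :
    (T * (1 - u) + c • u) * y = y' * (T * (1 - u) + c • u) := by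
  have e : (T * (1 - u) + c • u) * y = T * y * (1 - u) + c • (y * u) := by
    rw [add_mul, smul_mul_assoc, hu.eq, mul_assoc, mul_assoc, sub_mul, mul_sub y, one_mul, mul_one,
      hu.eq]
  rw [e, h1, add_mul, smul_mul_assoc, h2, mul_add, mul_smul_comm, sub_mul, mul_assoc]
  module

/-- The term (k_i - k_i⁻¹) Y^{α_i^∨} in I_i is exactly what cancels the correction in the Bernstein
relation after multiplying that relation by 1 - Y^{α_i^∨}. -/
lemma simpleInt_mul_Yel (i : b.support) (x : coweights P) :
    simpleInt b k i * Yel b k x = Yel b k (wact (finRefl b i) x) * simpleInt b k i := by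
  obtain ⟨D, -, h1, h2⟩ := bernsteinRel b k i x
  rw [simpleInt_eq]
  refine intertwine_aux h1 ?_ (Yel_comm b k _ _)
  rw [← h2, mul_assoc, sub_mul, one_mul, Yel_neg_mul, ← mul_neg D, neg_sub]

lemma simpleInt_mul_mem {n : ℕ} {h : Hecke b k} (hh : h ∈ lenFil b k n) (i : b.support) :
    simpleInt b k i * h ∈ lenFil b k (n + 1) := by
  have h1 : simpleInt b k i * h = genT b k (some i) * (h - Yel b k (corootC P i) * h) +
      kdiff b k (some i) • (Yel b k (corootC P i) * h) := by
    rw [simpleInt_eq, add_mul, smul_mul_assoc, mul_assoc, sub_mul, one_mul]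
  rw [h1]
  have h2 := Yel_mul_mem b k hh (corootC P i)
  exact add_mem (genT_mul_mem b k (sub_mem hh h2) i)
    (Submodule.smul_mem _ _ (lenFil_mono b k (Nat.le_succ n) h2))

/-- The characterisation of `I_w` by its commutation with the `Y^λ` and its leading term. -/
structure IsIntertwiner (w : P.weylGroup) (h : Hecke b k) : Prop where
  mem : h ∈ bern b k
  mul_Yel : ∀ x, h * Yel b k x = Yel b k (wact w x) * h
  sub_mem : h - finT b k w * yHom b k (qInv b w) ∈ lenFil b k (finLen b w)

lemma isIntertwiner_one : IsIntertwiner b k 1 1 where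
  mem := one_mem _
  mul_Yel x := by rw [wact_one, one_mul, mul_one]
  sub_mem := by
    rw [qInv, invSet_one, Finset.prod_empty, map_one, finT_one, mul_one, sub_self]
    exact zero_mem _

lemma leading_aux {A : Type*} [Ring A] [Algebra ℂ A] (T u t v q h : A) (c : ℂ) :
    (T * (1 - u) + c • u) * h - T * t * ((1 - v) * q) =
      (T * (1 - u) + c • u) * (h - t * q) - T * ((u * t - t * v) * q) + c • (u * (t * q)) := by
  simp only [add_mul, mul_sub, sub_mul, smul_mul_assoc, one_mul, mul_one, mul_assoc]
  abel

/-- The new factor 1 - Y^{α_i^∨}, moved to the right through T_w, becomes 1 - Y^{β^∨} with β =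
w⁻¹α_i modulo shorter terms, and β is the one inversion that s_i w has beyond those of w. -/
lemma IsIntertwiner.simpleInt_mul {w : P.weylGroup} {h : Hecke b k} (hh : IsIntertwiner b k w h)
    {i : b.support} (hi : b.IsPos (w⁻¹ • (i : ι))) :
    IsIntertwiner b k (finRefl b i * w) (simpleInt b k i * h) where
  mem := mul_mem (simpleInt_mem_bern b k i) hh.mem
  mul_Yel x := by
    rw [mul_assoc, hh.mul_Yel, ← mul_assoc, simpleInt_mul_Yel, wact_mul, mul_assoc]
  sub_mem := by
    have hq : yHom b k (qInv b (finRefl b i * w)) =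
        (1 - Yel b k (wact w⁻¹ (corootC P i))) * yHom b k (qInv b w) := by
      rw [qInv, invSet_finRefl_mul b hi, Finset.prod_cons, map_mul, map_sub, map_one, yHom_eX,
        wact_corootC]
      rfl
    rw [finLen_finRefl_mul b hi, ← genT_mul_finT b k hi, hq, simpleInt_eq, leading_aux,
      ← simpleInt_eq]
    refine add_mem (_root_.sub_mem ?_ ?_) (Submodule.smul_mem _ _ ?_)
    · exact simpleInt_mul_mem b k hh.sub_mem i
    · exact genT_mul_mem b k (mul_yHom_mem b k (Yel_mul_finT_sub_mem b k w _) _) i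
    · exact Yel_mul_mem b k (finT_mul_yHom_mem b k (Nat.lt_succ_self _) _) _

/-- At the top length, moving Y^y through T_v only twists the exponent to v⁻¹y; the corrections lie
in strictly smaller length and do not reach this coordinate. -/
lemma coords_Yel_mul {n : ℕ} {h : Hecke b k} (hh : h ∈ lenFil b k (n + 1)) {v : P.weylGroup}
    (hv : n ≤ finLen b v) (y : coweights P) :
    coords b k (Yel b k y * h) v = coords b k h v * eX (wact v⁻¹ y) := by
  classical
  induction hh using Submodule.span_induction with
  | mem h hm =>
    obtain ⟨u, x, hu, rfl⟩ := hm
    have h1 := mul_Yel_mem b k (Yel_mul_finT_sub_mem b k u y) x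
    have h2 := coords_eq_zero_of_mem_lenFil b k h1 (w := v) (by omega)
    rw [sub_mul, map_sub, Finsupp.sub_apply, sub_eq_zero, mul_assoc, mul_assoc, ← Yel_add,
      coords_finT_mul_Yel] at h2
    rw [h2, coords_finT_mul_Yel]
    by_cases huv : u = v
    · subst huv
      rw [Finsupp.single_eq_same, Finsupp.single_eq_same, eX_add, mul_comm]
    · rw [Finsupp.single_eq_of_ne (Ne.symm huv), Finsupp.single_eq_of_ne (Ne.symm huv), zero_mul]
  | zero => rw [mul_zero, map_zero, Finsupp.zero_apply, zero_mul]
  | add h h' _ _ h1 h2 =>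
    rw [mul_add, map_add, map_add, Finsupp.add_apply, Finsupp.add_apply, h1, h2, add_mul]
  | smul c h _ h1 =>
    rw [mul_smul_comm, map_smul, map_smul, Finsupp.smul_apply, Finsupp.smul_apply, h1,
      smul_mul_assoc]

lemma corootC_injective : Function.Injective (corootC P) := fun _ _ h =>
  P.coroot.injective (congrArg Subtype.val h)

lemma exists_wact_ne {v w : P.weylGroup} (h : v ≠ w) : ∃ x, wact v⁻¹ (wact w x) ≠ x := by
  by_contra! H
  apply h
  apply weylGroup_ext
  intro i
  apply corootC_injective (P := P)
  rw [← wact_corootC, ← wact_corootC]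
  nth_rewrite 1 [← H (corootC P i)]
  rw [wact_wact_inv]

/-- Rigidity: a top coefficient at v with l(v) < l(w) is annihilated by e^x - e^{v⁻¹wx} for all x.
Since v ≠ w, some such factor is nonzero, and the group algebra has no zero divisors. Descending
through the filtration kills the element. -/
lemma eq_zero_of_intertwine {n : ℕ} {w : P.weylGroup} (hn : n ≤ finLen b w) {h : Hecke b k}
    (hh : h ∈ lenFil b k n) (hY : ∀ x, h * Yel b k x = Yel b k (wact w x) * h) : h = 0 := by
  induction n with
  | zero => rwa [lenFil_zero, Submodule.mem_bot] at hh
  | succ n ih =>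
    refine ih (by omega) (mem_lenFil_of_coords b k (lenFil_le_bern b k _ hh) fun v hv => ?_)
    rcases hv.eq_or_lt with hv' | hv'
    · obtain ⟨x, hx⟩ := exists_wact_ne (P := P) (v := v) (w := w) (by rintro rfl; omega)
      have h1 := congrArg (fun z => coords b k z v) (hY x)
      rw [coords_Yel_mul b k hh hv, ← yHom_eX, coords_mul_yHom b k (lenFil_le_bern b k _ hh),
        ← sub_eq_zero, ← mul_sub] at h1
      refine (mul_eq_zero.mp h1).resolve_right fun h2 => hx ?_
      exact (eX_injective (sub_eq_zero.mp h2)).symm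
    · exact coords_eq_zero_of_mem_lenFil b k hh hv'

lemma IsIntertwiner.eq {w : P.weylGroup} {h h' : Hecke b k} (hh : IsIntertwiner b k w h)
    (hh' : IsIntertwiner b k w h') : h = h' := by
  rw [← sub_eq_zero]
  refine eq_zero_of_intertwine b k le_rfl (w := w) ?_ fun x => ?_
  · have := _root_.sub_mem hh.sub_mem hh'.sub_mem
    rwa [sub_sub_sub_cancel_right] at this
  · rw [sub_mul, mul_sub, hh.mul_Yel, hh'.mul_Yel]

lemma isIntertwiner_word {L : List b.support} (hL : (finSys b).IsRed L) :
    IsIntertwiner b k ((finSys b).wprod L) (L.map (simpleInt b k)).prod := by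
  induction L with
  | nil => exact isIntertwiner_one b k
  | cons i L ih =>
    obtain ⟨h1, h2⟩ := hL.tail
    rw [ReflSys.wprod_cons, List.map_cons, List.prod_cons]
    exact (ih h1).simpleInt_mul b k h2

theorem isIntertwiner_intertwiner (w : P.weylGroup) : IsIntertwiner b k w (intertwiner b k w) := by
  have hex : ∃ t, ∃ L : List b.support, L.length = finLen b w ∧
      (L.map (finRefl b)).prod = w ∧ t = (L.map (simpleInt b k)).prod := by
    obtain ⟨L, h1, h2⟩ := exists_finSys_word b w
    refine ⟨_, L, ?_, h1, rfl⟩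
    rw [← h1]
    exact h2
  obtain ⟨L, h1, h2, h3⟩ := Classical.epsilon_spec hex
  change IsIntertwiner b k w (Classical.epsilon _)
  rw [h3]
  have h4 : (finSys b).wprod L = w := h2
  have h5 : (finSys b).IsRed L := by
    rw [ReflSys.IsRed, h4]; exact h1
  have := isIntertwiner_word b k h5
  rwa [h4] at this

lemma intertwiner_mem_bern (w : P.weylGroup) : intertwiner b k w ∈ bern b k :=
  (isIntertwiner_intertwiner b k w).mem

lemma intertwiner_mul_Yel (w : P.weylGroup) (x : coweights P) :
    intertwiner b k w * Yel b k x = Yel b k (wact w x) * intertwiner b k w :=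
  (isIntertwiner_intertwiner b k w).mul_Yel x

lemma intertwiner_finRefl_mul {i : b.support} {w : P.weylGroup} (h : b.IsPos (w⁻¹ • (i : ι))) :
    intertwiner b k (finRefl b i * w) = simpleInt b k i * intertwiner b k w :=
  (isIntertwiner_intertwiner b k _).eq b k ((isIntertwiner_intertwiner b k w).simpleInt_mul b k h)

/-- The definition builds words from the left. Uniqueness of intertwiners makes every reduced word
admissible, in particular one ending in the letter `i`. -/
lemma intertwiner_mul_finRefl {i : b.support} {w : P.weylGroup} (h : b.IsPos (w • (i : ι))) :
    intertwiner b k (w * finRefl b i) = intertwiner b k w * simpleInt b k i := by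
  obtain ⟨L, rfl, hL⟩ := exists_finSys_word b w
  have h1 := isIntertwiner_word b k (ReflSys.IsRed.concat _ hL h)
  rw [ReflSys.wprod_append, List.map_append, List.prod_append] at h1
  have h2 := (isIntertwiner_word b k hL).eq b k (isIntertwiner_intertwiner b k _)
  rw [h2] at h1
  have h3 := (isIntertwiner_intertwiner b k _).eq b k h1
  simp only [ReflSys.wprod_cons, ReflSys.wprod_nil, mul_one, List.map_cons, List.map_nil,
    List.prod_cons, List.prod_nil] at h3
  exact h3

lemma kSimple_eq_of_smul {i j : b.support} {w : P.weylGroup} (h : w • (j : ι) = i) :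
    kSimple b k (some j) = kSimple b k (some i) := by
  have := k.invariant (SemidirectProduct.inr w) (simpleAff b (some j))
  rw [inr_smul] at this
  rw [kSimple, kSimple, ← this]
  simp only [simpleAff, h]

/-- Expanding I_i I_w = I_w I_j, the Y-terms agree because X moves v into u. What remains is T_i I_w
= I_w T_j up to the right factor 1 - Y^{α_j^∨}, which can be cancelled. -/
lemma intertwiner_comm_aux {A : Type*} [Ring A] [Algebra ℂ A] {T T' u v X : A} {c : ℂ}
    (h : (T * (1 - u) + c • u) * X = X * (T' * (1 - v) + c • v)) (hX : X * v = u * X) :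
    (T * X - X * T') * (1 - v) = 0 := by
  have h1 : (T * (1 - u) + c • u) * X = T * X * (1 - v) + c • (X * v) := by
    rw [add_mul, smul_mul_assoc, mul_assoc, sub_mul, one_mul, ← hX, mul_assoc T X, mul_sub X,
      mul_one]
  rw [h1, mul_add, mul_smul_comm, add_left_inj, ← mul_assoc] at h
  rw [sub_mul, h, sub_self]

/-- If `w α_j = α_i` then `T_i I_w = I_w T_j`. -/
lemma genT_mul_intertwiner {i j : b.support} {w : P.weylGroup} (h : w • (j : ι) = i) :
    genT b k (some i) * intertwiner b k w = intertwiner b k w * genT b k (some j) := by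
  have hpos (l : b.support) : b.IsPos (l : ι) := RootPairing.Base.isPos_of_mem_support l.2
  have h1 : b.IsPos (w⁻¹ • (i : ι)) := by
    rw [← h, inv_smul_smul]; exact hpos j
  have h2 : finRefl b i * w = w * finRefl b j := (finSys b).conj w j i h
  have h3 := intertwiner_finRefl_mul b k h1
  rw [h2, intertwiner_mul_finRefl b k (by rw [h]; exact hpos i), simpleInt_eq, simpleInt_eq] at h3
  have hk : kdiff b k (some j) = kdiff b k (some i) := by
    rw [kdiff, kdiff, kSimple_eq_of_smul b k h]
  rw [hk] at h3
  have h4 := intertwiner_comm_aux h3.symm (by rw [intertwiner_mul_Yel, wact_corootC, h])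
  rw [← sub_eq_zero]
  have h5 : (1 : Hecke b k) - Yel b k (corootC P j) = yHom b k (1 - eX (corootC P j)) := by
    rw [map_sub, map_one, yHom_eX]
  rw [h5] at h4
  refine eq_zero_of_mul_yHom b k ?_ ?_ h4
  · exact sub_mem (mul_mem (genT_mem_bern b k i) (intertwiner_mem_bern b k w))
      (mul_mem (intertwiner_mem_bern b k w) (genT_mem_bern b k j))
  · rw [sub_ne_zero, ← eX_zero]
    intro h6
    exact P.ne_zero' j (congrArg Subtype.val (eX_injective h6)).symm

end AffHecke

end

noncomputable section

set_option linter.unusedSectionVars false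

namespace AffHecke

variable {ι V N : Type*} [AddCommGroup V] [Module ℝ V] [AddCommGroup N] [Module ℝ N]
  {P : RootPairing ι ℝ V N} [Finite ι] [P.IsRootSystem] [P.IsCrystallographic] [P.IsIrreducible]
  [P.IsReduced] (b : P.Base) (I : Set b.support)

/-! ### Parabolic subgroups and minimal coset representatives -/

/-- The parabolic subgroup generated by the `s_i`, `i ∈ I`. -/
def parGrp : Subgroup P.weylGroup := Subgroup.closure (finRefl b '' I)

lemma finRefl_mem_parGrp {i : b.support} (hi : i ∈ I) : finRefl b i ∈ parGrp b I :=
  Subgroup.subset_closure ⟨i, hi, rfl⟩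

lemma pairZ_eq_sum_fundCow (i : ι) (x : coweights P) :
    pairZ P i x = ∑ j : b.support, pairZ P j x * pairZ P i (fundCow b j) := by
  change pairHom i x = _
  nth_rewrite 1 [eq_sum_fundCow b x]
  rw [map_sum]
  refine Finset.sum_congr rfl fun j _ => ?_
  rw [map_zsmul]
  rfl

lemma isPos_of_pairZ_fundCow_pos {i : ι} {l : b.support} (h : 0 < pairZ P i (fundCow b l)) :
    b.IsPos i := by
  by_contra hn
  have h1 := fundCow_mem_dom b l _ ((isPos_neg_iff b i).mpr hn)
  rw [pairZ_neg_left] at h1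
  omega

lemma pairZ_fundCow_nonpos {i : ι} (h : ¬ b.IsPos i) (l : b.support) :
    pairZ P i (fundCow b l) ≤ 0 := by
  by_contra hn
  exact h (isPos_of_pairZ_fundCow_pos b (not_le.mp hn))

lemma exists_pairZ_fundCow_ne_zero (i : ι) : ∃ l : b.support, pairZ P i (fundCow b l) ≠ 0 := by
  by_contra! H
  have h1 := pairZ_eq_sum_fundCow b i (corootC P i)
  rw [Finset.sum_eq_zero fun j _ => by rw [H j, mul_zero], pairZ_corootC, P.pairingIn_same] at h1
  omega

lemma wact_fundCow_of_mem_parGrp {v : P.weylGroup} (hv : v ∈ parGrp b I) {l : b.support}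
    (hl : l ∉ I) : wact v (fundCow b l) = fundCow b l := by
  induction hv using Subgroup.closure_induction with
  | mem v h =>
    obtain ⟨j, hj, rfl⟩ := h
    rw [wact_finRefl, pairZ_fundCow_ne b l j.2 (fun e => hl (Subtype.ext e ▸ hj)), zero_smul,
      sub_zero]
  | one => exact wact_one _
  | mul v w _ _ h1 h2 => rw [wact_mul, h2, h1]
  | inv v _ h => nth_rewrite 1 [← h]; rw [wact_inv_wact]

lemma pairZ_smul_fundCow {v : P.weylGroup} (hv : v ∈ parGrp b I) {l : b.support}
    (hl : l ∉ I) (i : ι) : pairZ P (v • i) (fundCow b l) = pairZ P i (fundCow b l) := by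
  nth_rewrite 1 [← wact_fundCow_of_mem_parGrp b I hv hl]
  rw [pairZ_wact]

/-- The fundamental coweights read off the simple-root coefficients. This translates membership in
R₀^I into the vanishing of pairings with coweights that the parabolic subgroup fixes. -/
lemma root_mem_closure_iff (i : ι) :
    P.root i ∈ AddSubgroup.closure ((fun j : b.support => P.root j) '' I) ↔
      ∀ l ∉ I, pairZ P i (fundCow b l) = 0 := by
  constructor
  · intro h l hl
    have h1 (v : V) (hv : v ∈ AddSubgroup.closure ((fun j : b.support => P.root j) '' I)) :
        P.toLinearMap v (fundCow b l : N) = 0 := by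
      induction hv using AddSubgroup.closure_induction with
      | mem v h =>
        obtain ⟨j, hj, rfl⟩ := h
        have h2 := coe_pairZ P j (fundCow b l)
        rw [pairZ_fundCow_ne b l j.2 (fun e => hl (Subtype.ext e ▸ hj)), Int.cast_zero] at h2
        exact h2.symm
      | zero => rw [map_zero, LinearMap.zero_apply]
      | add v w _ _ h1 h2 => rw [map_add, LinearMap.add_apply, h1, h2, add_zero]
      | neg v _ h => rw [map_neg, LinearMap.neg_apply, h, neg_zero]
    have h2 := coe_pairZ P i (fundCow b l)
    rw [RootPairing.root', h1 _ h] at h2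
    exact_mod_cast h2
  · intro h
    obtain ⟨f, -, -, hf⟩ := b.exists_root_eq_sum_int i
    rw [hf]
    refine sum_mem fun j hj => ?_
    by_cases hjI : (⟨j, hj⟩ : b.support) ∈ I
    · have hm : P.root j ∈ (fun j : b.support => P.root j) '' I := ⟨⟨j, hj⟩, hjI, rfl⟩
      exact zsmul_mem (AddSubgroup.subset_closure hm) _
    · have h1 := h _ hjI
      rw [pairZ_eq_sum b hf, Finset.sum_eq_single j] at h1
      · rw [pairZ_fundCow_self b ⟨j, hj⟩, mul_one] at h1
        rw [h1, zero_smul]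
        exact zero_mem _
      · intro l hl hlj
        rw [pairZ_fundCow_ne b ⟨j, hj⟩ hl hlj, mul_zero]
      · exact fun hn => absurd hj hn

lemma mem_posOutside {i : ι} :
    i ∈ posOutside b I ↔ ∃ l ∉ I, 0 < pairZ P i (fundCow b l) := by
  rw [posOutside, Set.Finite.mem_toFinset, Set.mem_ofPred_eq, root_mem_closure_iff]
  push Not
  constructor
  · rintro ⟨h1, l, hl, h2⟩
    exact ⟨l, hl, lt_of_le_of_ne (fundCow_mem_dom b l i h1) h2.symm⟩
  · rintro ⟨l, hl, h⟩
    exact ⟨isPos_of_pairZ_fundCow_pos b h, l, hl, h.ne'⟩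

lemma isPos_of_mem_posOutside {i : ι} (h : i ∈ posOutside b I) : b.IsPos i := by
  obtain ⟨l, -, h⟩ := (mem_posOutside b I).mp h
  exact isPos_of_pairZ_fundCow_pos b h

/-- The parabolic subgroup fixes the fundamental coweights outside `I`, and one positive coefficient
already forces a root to be positive. -/
lemma smul_mem_posOutside {v : P.weylGroup} (hv : v ∈ parGrp b I) {i : ι}
    (h : i ∈ posOutside b I) : v • i ∈ posOutside b I := by
  obtain ⟨l, hl, h⟩ := (mem_posOutside b I).mp h
  refine (mem_posOutside b I).mpr ⟨l, hl, ?_⟩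
  rwa [pairZ_smul_fundCow b I hv hl]

lemma mem_posOutside_of_notMem {j : b.support} (hj : j ∉ I) : (j : ι) ∈ posOutside b I :=
  (mem_posOutside b I).mpr ⟨j, hj, by rw [pairZ_fundCow_self]; exact zero_lt_one⟩

lemma mem_minReps {w : P.weylGroup} : w ∈ minReps b I ↔ ∀ i ∈ I, b.IsPos (w • (i : ι)) := by
  rw [minReps, Set.Finite.mem_toFinset, Set.mem_ofPred_eq]
  exact forall₂_congr fun i _ => (finSys b).len_mul_s_iff

/-- A minimal coset representative maps the positive roots of `R₀^I` to positive roots. -/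
lemma isPos_smul_of_mem_minReps {u : P.weylGroup} (hu : u ∈ minReps b I) {i : ι} (hi : b.IsPos i)
    (h : i ∉ posOutside b I) : b.IsPos (u • i) := by
  by_contra hn
  obtain ⟨l, hl⟩ := exists_pairZ_fundCow_ne_zero b (u • i)
  apply hl
  apply le_antisymm (pairZ_fundCow_nonpos b hn l)
  -- The pairing of u i with a fundamental coweight is expanded along the simple roots of i: for j ∈
  -- I the factor from u α_j is nonnegative by minimality, and for j ∉ I the coefficient of i
  -- vanishes.
  rw [← wact_wact_inv u (fundCow b l), pairZ_wact, pairZ_eq_sum_fundCow b]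
  refine Finset.sum_nonneg fun j _ => ?_
  by_cases hj : j ∈ I
  · refine mul_nonneg ?_ (fundCow_mem_dom b j i hi)
    rw [← pairZ_wact u, wact_wact_inv]
    exact fundCow_mem_dom b l _ ((mem_minReps b I).mp hu j hj)
  · rw [mem_posOutside] at h
    push Not at h
    rw [le_antisymm (h j hj) (fundCow_mem_dom b j i hi), mul_zero]

lemma exists_not_isPos {v : P.weylGroup} (hv : v ≠ 1) :
    ∃ j : b.support, ¬ b.IsPos (v • (j : ι)) := by
  by_contra! H
  apply hv
  rw [← finLen_eq_zero_iff b, finLen, Set.ncard_eq_zero]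
  ext i
  simp only [Set.mem_ofPred_eq, Set.mem_empty_iff_false, iff_false, not_and, not_not]
  exact isPos_smul_of_simple b v H i

/-- Distinct minimal coset representatives lie in distinct cosets. -/
lemma eq_of_mem_minReps {u w : P.weylGroup} (hu : u ∈ minReps b I) (hw : w ∈ minReps b I)
    (h : u⁻¹ * w ∈ parGrp b I) : u = w := by
  by_contra hne
  obtain ⟨j, hj⟩ := exists_not_isPos b (v := u⁻¹ * w) (fun e => hne (inv_mul_eq_one.mp e))
  have hjI : j ∈ I := by
    by_contra hjI
    exact hj (isPos_of_mem_posOutside b I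
      (smul_mem_posOutside b I h (mem_posOutside_of_notMem b I hjI)))
  have h1 := (isPos_neg_iff b ((u⁻¹ * w) • (j : ι))).mpr hj
  -- Since j ∈ I, the positive root -(u⁻¹w) α_j lies in R₀^I, so u keeps it positive. But u sends it
  -- to -w α_j, which is negative because w is minimal.
  have h2 : P.reflectionPerm ((u⁻¹ * w) • (j : ι)) ((u⁻¹ * w) • (j : ι)) ∉ posOutside b I := by
    rw [mem_posOutside]
    rintro ⟨l, hl, hp⟩
    rw [pairZ_neg_left, pairZ_smul_fundCow b I h hl, pairZ_fundCow_ne b l j.2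
      (fun e => hl (Subtype.ext e ▸ hjI)), neg_zero] at hp
    exact lt_irrefl 0 hp
  have h4 := isPos_smul_of_mem_minReps b I hu h1 h2
  rw [smul_reflectionPerm, mul_smul, smul_inv_smul, isPos_neg_iff] at h4
  exact h4 ((mem_minReps b I).mp hw j hjI)

lemma isPos_simple (i : b.support) : b.IsPos (i : ι) := RootPairing.Base.isPos_of_mem_support i.2

lemma finRefl_smul_self (i : b.support) :
    finRefl b i • (i : ι) = P.reflectionPerm (i : ι) (i : ι) := rfl

lemma finRefl_mul_inv_smul (i : b.support) (w : P.weylGroup) :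
    (finRefl b i * w)⁻¹ • (i : ι) =
      P.reflectionPerm (w⁻¹ • (i : ι)) (w⁻¹ • (i : ι)) := by
  rw [mul_inv_rev, inv_finRefl, mul_smul, finRefl_smul_self, smul_reflectionPerm]

lemma finRefl_mul_cancel (i : b.support) (w : P.weylGroup) :
    finRefl b i * (finRefl b i * w) = w := (finSys b).s_mul_cancel i w

/-- Leaving the minimal representatives under s_i means that some positive root w α_j, j ∈ I, is
made negative by s_i, and α_i is the only such root. Then s_i w = w s_j stays in the same coset. -/
lemma exists_smul_eq_of_notMem {w : P.weylGroup} (hw : w ∈ minReps b I) {i : b.support}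
    (h : finRefl b i * w ∉ minReps b I) : ∃ j ∈ I, w • ((j : b.support) : ι) = i := by
  rw [mem_minReps] at h
  push Not at h
  obtain ⟨j, hj, hn⟩ := h
  rw [mul_smul] at hn
  exact ⟨j, hj, (finSys b).eq_a_of_pos_of_not_pos ((mem_minReps b I).mp hw j hj) hn⟩

lemma finRefl_mul_mem_minReps {w : P.weylGroup} (hw : w ∈ minReps b I) {i : b.support}
    (h : ¬ b.IsPos (w⁻¹ • (i : ι))) : finRefl b i * w ∈ minReps b I := by
  by_contra hn
  obtain ⟨j, hj, e⟩ := exists_smul_eq_of_notMem b I hw hn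
  rw [← e, inv_smul_smul] at h
  exact h (isPos_simple b j)

lemma inv_smul_mem_posOutside {w : P.weylGroup} {i : b.support}
    (h : finRefl b i * w ∈ minReps b I) (hp : b.IsPos (w⁻¹ • (i : ι))) :
    w⁻¹ • (i : ι) ∈ posOutside b I := by
  by_contra hn
  have h1 := isPos_smul_of_mem_minReps b I h hp hn
  rw [mul_smul, smul_inv_smul, finRefl_smul_self, isPos_neg_iff] at h1
  exact h1 (isPos_simple b i)

/-- Whether s_i lengthens an element is thereby constant on a coset of W_I whenever w⁻¹α_i lies
outside R₀^I. -/
lemma isPos_inv_smul_of_coset {w w' : P.weylGroup} {i : ι}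
    (h : w⁻¹ • i ∈ posOutside b I) (hw : w⁻¹ * w' ∈ parGrp b I) : b.IsPos (w'⁻¹ • i) := by
  have h1 := smul_mem_posOutside b I (inv_mem hw) h
  rw [mul_inv_rev, inv_inv, mul_smul, smul_inv_smul] at h1
  exact isPos_of_mem_posOutside b I h1

lemma invSet_subset_posOutside {u : P.weylGroup} (hu : u ∈ minReps b I) :
    invSet b u ⊆ posOutside b I := by
  intro i hi
  rw [mem_invSet] at hi
  by_contra hn
  exact hi.2 (isPos_smul_of_mem_minReps b I hu hi.1 hn)

lemma card_invSet (w : P.weylGroup) : (invSet b w).card = finLen b w := by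
  rw [finLen, invSet, Set.ncard_eq_toFinset_card]

/-- All inversions of a minimal representative lie outside R₀^I, a set of positive roots stable
under W_I; translating them injects the inversions of u into those of w. -/
lemma finLen_le_of_coset {u w : P.weylGroup} (hu : u ∈ minReps b I) (h : u⁻¹ * w ∈ parGrp b I) :
    finLen b u ≤ finLen b w := by
  rw [← card_invSet, ← card_invSet]
  refine Finset.card_le_card_of_injOn (fun i => (u⁻¹ * w)⁻¹ • i) (fun i hi => ?_)
    (MulAction.injective _).injOn
  have h1 := smul_mem_posOutside b I (inv_mem h) (invSet_subset_posOutside b I hu hi)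
  have h2 : i ∈ invSet b u := hi
  rw [mem_invSet] at h2
  refine (mem_invSet b).mpr ⟨isPos_of_mem_posOutside b I h1, ?_⟩
  change ¬ b.IsPos (w • (u⁻¹ * w)⁻¹ • i)
  rw [mul_inv_rev, inv_inv, mul_smul, smul_inv_smul]
  exact h2.2

lemma one_mem_minReps : (1 : P.weylGroup) ∈ minReps b I :=
  (mem_minReps b I).mpr fun i _ => by rw [one_smul]; exact isPos_simple b i

/-- The longest minimal coset representative inverts all positive roots outside `R₀^I`. -/
lemma exists_longest : ∃ u ∈ minReps b I, (∀ w ∈ minReps b I, finLen b w ≤ finLen b u) ∧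
    invSet b u = posOutside b I := by
  obtain ⟨u, hu, hmax⟩ := Finset.exists_max_image (minReps b I) (finLen b) ⟨1, one_mem_minReps b I⟩
  refine ⟨u, hu, hmax, (invSet_subset_posOutside b I hu).antisymm fun i hi => ?_⟩
  rw [mem_invSet]
  refine ⟨isPos_of_mem_posOutside b I hi, fun hpos => ?_⟩
  obtain ⟨l, hl, hp⟩ := (mem_posOutside b I).mp hi
  -- If u i stayed positive, the pairing of i with the fundamental coweight of l would be a sum of
  -- terms with factors ⟨u⁻¹α_j, ω_l⟩. By maximality of u, each u⁻¹α_j is negative or a simple root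
  -- from I, so none of these factors is positive.
  apply absurd hp
  rw [not_lt, ← inv_smul_smul u i, ← wact_wact_inv u⁻¹ (fundCow b l), pairZ_wact,
    pairZ_eq_sum_fundCow b]
  refine Finset.sum_nonpos fun j _ => ?_
  refine mul_nonpos_of_nonpos_of_nonneg ?_ (fundCow_mem_dom b j _ hpos)
  rw [← pairZ_wact u⁻¹, wact_wact_inv]
  by_cases hj : b.IsPos (u⁻¹ • (j : ι))
  · by_cases hm : finRefl b j * u ∈ minReps b I
    · have h1 := hmax _ hm
      rw [finLen_finRefl_mul b hj] at h1
      omega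
    · obtain ⟨j', hj', e⟩ := exists_smul_eq_of_notMem b I hu hm
      rw [← e, inv_smul_smul, pairZ_fundCow_ne b l j'.2 (fun e => hl (Subtype.ext e ▸ hj'))]
  · exact pairZ_fundCow_nonpos b hj l

/-- Every coset of the parabolic subgroup has a minimal representative. -/
lemma exists_minRep (w : P.weylGroup) : ∃ u ∈ minReps b I, u⁻¹ * w ∈ parGrp b I := by
  obtain ⟨u, hu, hmin⟩ := Set.exists_min_image {u | u⁻¹ * w ∈ parGrp b I} (finLen b)
    (Set.toFinite _) ⟨w, by
      rw [Set.mem_ofPred_eq, inv_mul_cancel]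
      exact one_mem _⟩
  refine ⟨u, (mem_minReps b I).mpr fun i hi => ?_, hu⟩
  by_contra hn
  have h1 := hmin (u * finRefl b i) (by
    rw [Set.mem_ofPred_eq, mul_inv_rev, mul_assoc]
    exact mul_mem (inv_mem (finRefl_mem_parGrp b I hi)) hu)
  have h2 : finLen b (u * finRefl b i) + 1 = finLen b u := (finSys b).len_mul_s_of_not hn
  omega

end AffHecke

end

noncomputable section

set_option linter.unusedSectionVars false

namespace AffHecke

/-! ### The parameters `± k^{± 1}` -/

lemma sgnPow_mul_inv (σ : ℤˣ) (z : ℂˣ) :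
    sgnPow σ z * (((σ : ℤ) : ℂ) * ((z ^ (-(σ : ℤ)) : ℂˣ) : ℂ)) = 1 := by
  rcases Int.units_eq_one_or σ with rfl | rfl <;> simp [sgnPow]

lemma sgnPow_ne_zero (σ : ℤˣ) (z : ℂˣ) : sgnPow σ z ≠ 0 :=
  left_ne_zero_of_mul_eq_one (sgnPow_mul_inv σ z)

lemma inv_sgnPow (σ : ℤˣ) (z : ℂˣ) :
    (sgnPow σ z)⁻¹ = ((σ : ℤ) : ℂ) * ((z ^ (-(σ : ℤ)) : ℂˣ) : ℂ) :=
  inv_eq_of_mul_eq_one_right (sgnPow_mul_inv σ z)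

/-- Both k and -k⁻¹ are roots of the quadratic relation of T_j, so κ - κ⁻¹ = k - k⁻¹ for either
sign. From here on the two signs are treated uniformly through κ. -/
lemma sgnPow_sub_inv (σ : ℤˣ) (z : ℂˣ) :
    sgnPow σ z - (sgnPow σ z)⁻¹ = (z : ℂ) - ((z⁻¹ : ℂˣ) : ℂ) := by
  rw [inv_sgnPow]
  rcases Int.units_eq_one_or σ with rfl | rfl
  · simp [sgnPow]
  · simp [sgnPow]
    ring

lemma sgnPow_mul_self (σ : ℤˣ) (z : ℂˣ) :
    sgnPow σ z * sgnPow σ z = (((z ^ (σ : ℤ)) ^ 2 : ℂˣ) : ℂ) := by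
  rcases Int.units_eq_one_or σ with rfl | rfl <;> simp [sgnPow, sq]

variable {ι V N : Type*} [AddCommGroup V] [Module ℝ V] [AddCommGroup N] [Module ℝ N]
  {P : RootPairing ι ℝ V N} [Finite ι] [P.IsRootSystem] [P.IsCrystallographic] [P.IsIrreducible]
  [P.IsReduced] (b : P.Base) (I : Set b.support) (k : Mult P) (σ : ℤˣ) (γ : Torus P)

/-- The parameter `± k_i^{± 1}`. -/
def kap (i : b.support) : ℂ := sgnPow σ (kSimple b k (some i))

lemma kap_ne_zero (i : b.support) : kap b k σ i ≠ 0 := sgnPow_ne_zero _ _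

lemma kdiff_eq (i : b.support) : kdiff b k (some i) = kap b k σ i - (kap b k σ i)⁻¹ :=
  (sgnPow_sub_inv σ _).symm

lemma eps_genT_some (i : b.support) : eps b k σ (genT b k (some i)) = kap b k σ i :=
  eps_genT b k σ _

/-- The scalar `ε_±(T_w)`. -/
def epsT (w : P.weylGroup) : ℂ := eps b k σ (finT b k w)

lemma epsT_ne_zero (w : P.weylGroup) : epsT b k σ w ≠ 0 :=
  ((isUnit_heckeT b k (SemidirectProduct.inr w)).map (eps b k σ)).ne_zero

lemma epsT_one : epsT b k σ (1 : P.weylGroup) = 1 := by rw [epsT, finT_one, map_one]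

lemma epsT_finRefl_mul {i : b.support} {w : P.weylGroup} (h : b.IsPos (w⁻¹ • (i : ι))) :
    epsT b k σ (finRefl b i * w) = kap b k σ i * epsT b k σ w := by
  rw [epsT, ← genT_mul_finT b k h, map_mul, eps_genT_some, epsT]

lemma epsT_mul_finRefl {i : b.support} {w : P.weylGroup} (h : b.IsPos (w • (i : ι))) :
    epsT b k σ (w * finRefl b i) = kap b k σ i * epsT b k σ w := by
  rw [epsT, ← finT_mul_genT b k h, map_mul, eps_genT_some, epsT, mul_comm]

lemma mul_finRefl_cancel (i : b.support) (w : P.weylGroup) :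
    w * finRefl b i * finRefl b i = w := (finSys b).mul_s_cancel i w

lemma isPos_mul_finRefl {i : b.support} {w : P.weylGroup} (h : ¬ b.IsPos (w • (i : ι))) :
    b.IsPos ((w * finRefl b i) • (i : ι)) := by
  rw [mul_smul, finRefl_smul_self, smul_reflectionPerm, isPos_neg_iff]
  exact h

lemma isPos_finRefl_mul_inv {i : b.support} {w : P.weylGroup} (h : ¬ b.IsPos (w⁻¹ • (i : ι))) :
    b.IsPos ((finRefl b i * w)⁻¹ • (i : ι)) := by
  rw [finRefl_mul_inv_smul, isPos_neg_iff]
  exact h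

lemma kRoot_inv_smul (i : b.support) (w : P.weylGroup) :
    kRoot k (w⁻¹ • (i : ι)) = kSimple b k (some i) := by
  have := k.invariant (SemidirectProduct.inr w⁻¹) (simpleAff b (some i))
  rw [inr_smul] at this
  exact this

/-- Prepending s_i multiplies by κ_i and adds the inversion w⁻¹α_i, whose parameter is k_i by
invariance. This identifies ε(T_u) for the longest u with the numerator of `coeff0`. -/
lemma epsT_eq_prod (w : P.weylGroup) :
    epsT b k σ w = ∏ i ∈ invSet b w, sgnPow σ (kRoot k i) := by
  induction w using weyl_induction b with
  | one => rw [epsT_one, invSet_one, Finset.prod_empty]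
  | mul i w h ih =>
    rw [epsT_finRefl_mul b k σ h, invSet_finRefl_mul b h, Finset.prod_cons, ih, kRoot_inv_smul]
    rfl

/-! ### Evaluation at a point of the torus -/

/-- Evaluation of the group algebra at `γ`. -/
def evalT : CowAlg P →ₐ[ℂ] ℂ :=
  AddMonoidAlgebra.lift ℂ ℂ (coweights P) ((Units.coeHom ℂ).comp γ)

@[simp] lemma evalT_eX (x : coweights P) : evalT γ (eX x) = tpow γ x := by
  rw [evalT, eX, AddMonoidAlgebra.lift_single, one_smul]
  rfl

/-- The functional `T_w Y^λ ↦ γ^λ ε(T_w) [w W_I]`. -/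
def psi : Hecke b k →ₗ[ℂ] (P.weylGroup ⧸ parGrp b I →₀ ℂ) :=
  (Finsupp.lsum ℂ fun w : P.weylGroup =>
    (epsT b k σ w • Finsupp.lsingle (QuotientGroup.mk w)).comp (evalT γ).toLinearMap).comp
    (coords b k)

lemma psi_finT_mul_yHom (w : P.weylGroup) (q : CowAlg P) :
    psi b I k σ γ (finT b k w * yHom b k q) =
      Finsupp.single (QuotientGroup.mk w) (epsT b k σ w * evalT γ q) := by
  rw [psi, LinearMap.comp_apply, coords_finT_mul_yHom]
  simp

lemma psi_finT (w : P.weylGroup) :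
    psi b I k σ γ (finT b k w) = Finsupp.single (QuotientGroup.mk w) (epsT b k σ w) := by
  have := psi_finT_mul_yHom b I k σ γ w 1
  rwa [map_one, map_one, mul_one, mul_one] at this

lemma psi_mul_yHom {h : Hecke b k} (hh : h ∈ bern b k) (p : CowAlg P) :
    psi b I k σ γ (h * yHom b k p) = evalT γ p • psi b I k σ γ h := by
  refine bern_ext b k (f := (psi b I k σ γ).comp (LinearMap.mulRight ℂ (yHom b k p)))
    (g := evalT γ p • psi b I k σ γ) ?_ hh
  intro w x
  rw [LinearMap.comp_apply, LinearMap.mulRight_apply, LinearMap.smul_apply, mul_assoc, ← yHom_eX,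
    ← map_mul, psi_finT_mul_yHom, psi_finT_mul_yHom, Finsupp.smul_single, map_mul, smul_eq_mul]
  congr 1
  ring

lemma psi_mul_Yel {h : Hecke b k} (hh : h ∈ bern b k) (x : coweights P) :
    psi b I k σ γ (h * Yel b k x) = tpow γ x • psi b I k σ γ h := by
  rw [← yHom_eX, psi_mul_yHom b I k σ γ hh, evalT_eX]

variable {γ}

lemma mk_mul_finRefl {i : b.support} (hi : i ∈ I) (w : P.weylGroup) :
    (QuotientGroup.mk (w * finRefl b i) : P.weylGroup ⧸ parGrp b I) = QuotientGroup.mk w := by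
  rw [eq_comm, QuotientGroup.eq, inv_mul_cancel_left]
  exact finRefl_mem_parGrp b I hi

/-- Right multiplication by s_i, i ∈ I, does not change the coset. Thus only the weights ε(T_w) are
compared, and when the length drops κ⁻¹ + (κ - κ⁻¹) = κ. -/
lemma psi_finT_mul_genT {i : b.support} (hi : i ∈ I) (w : P.weylGroup) :
    psi b I k σ γ (finT b k w * genT b k (some i)) = kap b k σ i • psi b I k σ γ (finT b k w) := by
  by_cases h : b.IsPos (w • (i : ι))
  · rw [finT_mul_genT b k h, psi_finT, psi_finT, mk_mul_finRefl b I hi, epsT_mul_finRefl b k σ h,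
      Finsupp.smul_single, smul_eq_mul]
  · have h1 := epsT_mul_finRefl b k σ (isPos_mul_finRefl b h)
    rw [mul_finRefl_cancel] at h1
    rw [finT_mul_genT_of_not b k h, map_add, map_smul, psi_finT, psi_finT, mk_mul_finRefl b I hi,
      Finsupp.smul_single, Finsupp.smul_single, ← Finsupp.single_add, kdiff_eq b k σ, h1]
    congr 1
    have := kap_ne_zero b k σ i
    simp only [smul_eq_mul]
    field_simp
    ring

/-- On the torus in question γ^{-α_i^∨} = κ⁻², and κ - κ⁻¹ = κ (1 - κ⁻²). No division by 1 -
γ^{-α_i^∨} occurs, so κ² = 1 is allowed. -/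
lemma evalT_bernstein (hγ : γ ∈ torusI b I k σ) {i : b.support} (hi : i ∈ I) {d p : CowAlg P}
    (h : d * (1 - eX (-corootC P i)) = p) :
    kdiff b k (some i) * evalT γ d = kap b k σ i * evalT γ p := by
  have h1 : tpow γ (-corootC P i) = (kap b k σ i)⁻¹ * (kap b k σ i)⁻¹ := by
    rw [← mul_inv, kap, sgnPow_mul_self, ← hγ i hi, tpow, ofAdd_neg, map_inv,
      Units.val_inv_eq_inv_val]
  rw [← h, map_mul, map_sub, map_one, evalT_eX, h1, kdiff_eq b k σ]
  have := kap_ne_zero b k σ i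
  field_simp

/-- After Y^x T_i is rewritten by the Bernstein relation, evaluation at γ gives κ γ^{s_i x} - κ
(γ^{s_i x} - γ^x) = κ γ^x. -/
lemma psi_mul_genT (hγ : γ ∈ torusI b I k σ) {i : b.support} (hi : i ∈ I) {h : Hecke b k}
    (hh : h ∈ bern b k) :
    psi b I k σ γ (h * genT b k (some i)) = kap b k σ i • psi b I k σ γ h := by
  refine bern_ext b k (f := (psi b I k σ γ).comp (LinearMap.mulRight ℂ (genT b k (some i))))
    (g := kap b k σ i • psi b I k σ γ) ?_ hh
  intro w x
  obtain ⟨d, h1, h2⟩ := exists_bernstein b k i (wact (finRefl b i) x)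
  have hs : finRefl b i * finRefl b i = 1 := (finSys b).s_mul_self i
  rw [← wact_mul, hs, wact_one] at h1 h2
  have h3 : Yel b k x * genT b k (some i) = genT b k (some i) * Yel b k (wact (finRefl b i) x) -
      kdiff b k (some i) • yHom b k d := by rw [h1, add_sub_cancel_right]
  have hw := finT_mem_bern b k w
  have h4 := evalT_bernstein b I k σ hγ hi h2
  rw [map_sub, evalT_eX, evalT_eX] at h4
  rw [LinearMap.comp_apply, LinearMap.mulRight_apply, LinearMap.smul_apply, mul_assoc, h3, mul_sub,
    mul_smul_comm, ← mul_assoc, map_sub, map_smul, psi_mul_yHom b I k σ γ hw,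
    psi_mul_Yel b I k σ γ (mul_mem hw (genT_mem_bern b k i)), psi_mul_Yel b I k σ γ hw,
    psi_finT_mul_genT b I k σ hi, smul_smul, smul_smul, smul_smul, h4, ← sub_smul]
  congr 1
  ring

/-! ### The character of the parabolic subalgebra -/

lemma psi_one : psi b I k σ γ 1 = Finsupp.single (QuotientGroup.mk 1) 1 := by
  rw [← finT_one b k, psi_finT, epsT_one]

/-- Generators of H_I(k) act on the right through scalars, hence so do all its elements. The scalar
attached to `a` is the value at `a` of the character sought, and its multiplicativity is automatic.
-/
lemma psi_mul_of_mem_parabolic (hγ : γ ∈ torusI b I k σ) {a : Hecke b k}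
    (ha : a ∈ parabolic b I k) {h : Hecke b k} (hh : h ∈ bern b k) :
    psi b I k σ γ (h * a) = psi b I k σ γ a (QuotientGroup.mk 1) • psi b I k σ γ h := by
  -- The mere existence of a scalar is stable under the algebra operations; testing on `h = 1`
  -- identifies it afterwards.
  suffices H : ∃ c : ℂ, ∀ h ∈ bern b k, psi b I k σ γ (h * a) = c • psi b I k σ γ h by
    obtain ⟨c, hc⟩ := H
    have h1 := hc 1 (one_mem _)
    rw [one_mul, psi_one] at h1
    rw [h1, hc h hh]
    simp
  induction ha using Algebra.adjoin_induction with
  | mem a ha =>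
    rcases ha with ⟨x, rfl⟩ | ⟨i, hi, rfl⟩
    · exact ⟨_, fun h hh => psi_mul_Yel b I k σ γ hh x⟩
    · exact ⟨_, fun h hh => psi_mul_genT b I k σ hγ hi hh⟩
  | algebraMap c =>
    refine ⟨c, fun h _ => ?_⟩
    rw [← Algebra.commutes, ← Algebra.smul_def, map_smul]
  | add a a' _ _ h1 h2 =>
    obtain ⟨c, hc⟩ := h1
    obtain ⟨d, hd⟩ := h2
    refine ⟨c + d, fun h hh => ?_⟩
    rw [mul_add, map_add, hc h hh, hd h hh, add_smul]
  | mul a a' ha _ h1 h2 =>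
    obtain ⟨c, hc⟩ := h1
    obtain ⟨d, hd⟩ := h2
    refine ⟨d * c, fun h hh => ?_⟩
    rw [← mul_assoc, hd _ (mul_mem hh (parabolic_le_bern b k I ha)), hc h hh, smul_smul]

/-- The character `χ_γ` of the parabolic subalgebra. -/
def chiOf (hγ : γ ∈ torusI b I k σ) : parabolic b I k →ₐ[ℂ] ℂ :=
  AlgHom.ofLinearMap
    (((Finsupp.lapply (QuotientGroup.mk 1)).comp (psi b I k σ γ)).comp
      (Subalgebra.toSubmodule (parabolic b I k)).subtype)
    (by
      change psi b I k σ γ 1 (QuotientGroup.mk 1) = 1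
      rw [psi_one, Finsupp.single_eq_same])
    (by
      intro x y
      change psi b I k σ γ (x.1 * y.1) (QuotientGroup.mk 1) =
        psi b I k σ γ x.1 (QuotientGroup.mk 1) * psi b I k σ γ y.1 (QuotientGroup.mk 1)
      rw [psi_mul_of_mem_parabolic b I k σ hγ y.2 (parabolic_le_bern b k I x.2),
        Finsupp.smul_apply, smul_eq_mul, mul_comm])

lemma isChi_chiOf (hγ : γ ∈ torusI b I k σ) : IsChi b I k σ γ (chiOf b I k σ hγ) := by
  constructor
  · intro x
    change psi b I k σ γ (Yel b k x) (QuotientGroup.mk 1) = _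
    rw [← one_mul (Yel b k x), psi_mul_Yel b I k σ γ (one_mem _), psi_one]
    simp
  · intro i hi
    change psi b I k σ γ (genT b k (some i)) (QuotientGroup.mk 1) = _
    rw [← one_mul (genT b k (some i)), psi_mul_genT b I k σ hγ hi (one_mem _), psi_one]
    simp [kap]

lemma IsChi.unique {χ χ' : parabolic b I k →ₐ[ℂ] ℂ} (h : IsChi b I k σ γ χ)
    (h' : IsChi b I k σ γ χ') : χ = χ' := by
  apply AlgHom.adjoin_ext
  rintro x (⟨y, rfl⟩ | ⟨i, hi, rfl⟩)
  · exact (h.1 y).trans (h'.1 y).symm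
  · exact (h.2 i hi).trans (h'.2 i hi).symm

theorem existsUnique_isChi (hγ : γ ∈ torusI b I k σ) :
    ∃! χ : parabolic b I k →ₐ[ℂ] ℂ, IsChi b I k σ γ χ :=
  ⟨_, isChi_chiOf b I k σ hγ, fun _ h => h.unique b I k σ (isChi_chiOf b I k σ hγ)⟩

end AffHecke

end

noncomputable section

set_option linter.unusedSectionVars false

namespace AffHecke

lemma inv_mul_smul_smul {M : Type*} [AddCommGroup M] [Module ℂ M] {c : ℂ} (hc : c ≠ 0) (d : ℂ)
    (m : M) : (c * d)⁻¹ • c • m = d⁻¹ • m := by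
  rw [smul_smul, mul_inv, mul_right_comm, inv_mul_cancel₀ hc, one_mul]

variable {ι V N : Type*} [AddCommGroup V] [Module ℝ V] [AddCommGroup N] [Module ℝ N]
  {P : RootPairing ι ℝ V N} [Finite ι] [P.IsRootSystem] [P.IsCrystallographic] [P.IsIrreducible]
  [P.IsReduced] (b : P.Base) (I : Set b.support) (k : Mult P) (σ : ℤˣ) {γ : Torus P}

/-! ### The kernel of `psi` and the induced module -/

section Induced

variable {χ : parabolic b I k →ₐ[ℂ] ℂ}

/-- The class of an element of `H(k)` in the induced module. -/
def indMk (χ : parabolic b I k →ₐ[ℂ] ℂ) : Hecke b k →ₗ[ℂ] Ind b I k χ :=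
  (indIdeal b I k χ).mkQ.restrictScalars ℂ

lemma indMk_mul (x : Hecke b k) (a : parabolic b I k) :
    indMk b I k χ (x * a) = χ a • indMk b I k χ x := by
  rw [← map_smul, ← sub_eq_zero, ← map_sub]
  refine (Submodule.Quotient.mk_eq_zero _).mpr ?_
  have h : x * a - χ a • x = x • ((a : Hecke b k) - algebraMap ℂ (Hecke b k) (χ a)) := by
    rw [smul_eq_mul, mul_sub, ← Algebra.commutes, ← Algebra.smul_def]
  rw [h]
  exact Submodule.smul_mem _ _ (Submodule.subset_span ⟨a, rfl⟩)

lemma indMk_mul_Yel (hχ : IsChi b I k σ γ χ) (h : Hecke b k) (x : coweights P) :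
    indMk b I k χ (h * Yel b k x) = tpow γ x • indMk b I k χ h := by
  rw [← hχ.1 x, ← indMk_mul]

lemma indMk_mul_genT (hχ : IsChi b I k σ γ χ) (h : Hecke b k) {i : b.support} (hi : i ∈ I) :
    indMk b I k χ (h * genT b k (some i)) = kap b k σ i • indMk b I k χ h := by
  rw [kap, ← hχ.2 i hi, ← indMk_mul]

/-- In the induced module T_w T_i v_e = κ_i T_w v_e for i ∈ I, so dividing by ε(T_w) makes the
vectors constant on cosets. It is enough to treat the case where s_i lengthens w; the other follows
by exchanging w and w s_i. -/
lemma indMk_finT_mul_finRefl (hχ : IsChi b I k σ γ χ) (w : P.weylGroup) {i : b.support}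
    (hi : i ∈ I) :
    (epsT b k σ (w * finRefl b i))⁻¹ • indMk b I k χ (finT b k (w * finRefl b i)) =
      (epsT b k σ w)⁻¹ • indMk b I k χ (finT b k w) := by
  have key (w : P.weylGroup) (h : b.IsPos (w • (i : ι))) :
      (epsT b k σ (w * finRefl b i))⁻¹ • indMk b I k χ (finT b k (w * finRefl b i)) =
        (epsT b k σ w)⁻¹ • indMk b I k χ (finT b k w) := by
    rw [← finT_mul_genT b k h, indMk_mul_genT b I k σ hχ _ hi, epsT_mul_finRefl b k σ h]
    exact inv_mul_smul_smul (M := Ind b I k χ) (kap_ne_zero b k σ i) _ _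
  by_cases h : b.IsPos (w • (i : ι))
  · exact key w h
  · have h1 := key _ (isPos_mul_finRefl b h)
    rw [mul_finRefl_cancel] at h1
    exact h1.symm

lemma indMk_finT_coset (hχ : IsChi b I k σ γ χ) {v w : P.weylGroup} (h : v⁻¹ * w ∈ parGrp b I) :
    (epsT b k σ v)⁻¹ • indMk b I k χ (finT b k v) =
      (epsT b k σ w)⁻¹ • indMk b I k χ (finT b k w) := by
  have key (x : P.weylGroup) (hx : x ∈ parGrp b I) : ∀ v : P.weylGroup,
      (epsT b k σ (v * x))⁻¹ • indMk b I k χ (finT b k (v * x)) =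
        (epsT b k σ v)⁻¹ • indMk b I k χ (finT b k v) := by
    induction hx using Subgroup.closure_induction with
    | mem x hx =>
      obtain ⟨i, hi, rfl⟩ := hx
      exact fun v => indMk_finT_mul_finRefl b I k σ hχ v hi
    | one => intro v; rw [mul_one]
    | mul x y _ _ h1 h2 => intro v; rw [← mul_assoc, h2, h1]
    | inv x _ h => intro v; rw [← h, inv_mul_cancel_right]
  have := key _ h v
  rw [mul_inv_cancel_left] at this
  exact this.symm

/-- The map `[w W_I] ↦ ε(T_w)⁻¹ T_w v_e`. -/
def cosetVec (hχ : IsChi b I k σ γ χ) : (P.weylGroup ⧸ parGrp b I →₀ ℂ) →ₗ[ℂ] Ind b I k χ :=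
  Finsupp.linearCombination ℂ fun C => Quotient.lift
    (fun w : P.weylGroup => (epsT b k σ w)⁻¹ • indMk b I k χ (finT b k w))
    (fun _ _ h => indMk_finT_coset b I k σ hχ (QuotientGroup.leftRel_apply.mp h)) C

/-- The quotient map factors through `psi` on `bern`, so identities in the induced module may be
checked on coset coefficients. Independence of the coset vectors in that module is not required. -/
lemma cosetVec_psi (hχ : IsChi b I k σ γ χ) {h : Hecke b k} (hh : h ∈ bern b k) :
    cosetVec b I k σ hχ (psi b I k σ γ h) = indMk b I k χ h := by
  refine bern_ext b k (f := (cosetVec b I k σ hχ).comp (psi b I k σ γ)) (g := indMk b I k χ) ?_ hh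
  intro w x
  rw [LinearMap.comp_apply, psi_mul_Yel b I k σ γ (finT_mem_bern b k w), map_smul, psi_finT,
    indMk_mul_Yel b I k σ hχ, cosetVec, Finsupp.linearCombination_single]
  change _ • _ • (epsT b k σ w)⁻¹ • indMk b I k χ (finT b k w) = _
  exact congrArg _ (smul_inv_smul₀ (β := Ind b I k χ) (epsT_ne_zero b k σ w) _)

lemma mem_indIdeal_of_psi_eq_zero (hχ : IsChi b I k σ γ χ) {h : Hecke b k} (hh : h ∈ bern b k)
    (h0 : psi b I k σ γ h = 0) : h ∈ indIdeal b I k χ := by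
  have h1 := cosetVec_psi b I k σ hχ hh
  rw [h0, map_zero] at h1
  exact (Submodule.Quotient.mk_eq_zero _).mp h1.symm

end Induced

/-! ### Spherical vectors -/

lemma mk_finRefl_mul_eq_iff (i : b.support) (v w : P.weylGroup) :
    (QuotientGroup.mk (finRefl b i * v) : P.weylGroup ⧸ parGrp b I) =
      QuotientGroup.mk (finRefl b i * w) ↔
    (QuotientGroup.mk v : P.weylGroup ⧸ parGrp b I) = QuotientGroup.mk w := by
  rw [QuotientGroup.eq, QuotientGroup.eq, mul_inv_rev, mul_assoc, inv_mul_cancel_left]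

/-- Because w⁻¹α_i lies outside R₀^I, s_i lengthens every element of w W_I and shortens every
element of s_i w W_I. Hence the coset s_i w W_I receives T_i T_v from w W_I with factor κ_i, and
from itself only the quadratic correction. -/
lemma psi_genT_mul_finT {i : b.support} {w : P.weylGroup}
    (h : w⁻¹ • (i : ι) ∈ posOutside b I) (v : P.weylGroup) :
    psi b I k σ γ (genT b k (some i) * finT b k v) (QuotientGroup.mk (finRefl b i * w)) =
      kap b k σ i * psi b I k σ γ (finT b k v) (QuotientGroup.mk w) +
        kdiff b k (some i) *
          psi b I k σ γ (finT b k v) (QuotientGroup.mk (finRefl b i * w)) := by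
  classical
  by_cases hv : b.IsPos (v⁻¹ • (i : ι))
  · have h1 : (QuotientGroup.mk v : P.weylGroup ⧸ parGrp b I) ≠
        QuotientGroup.mk (finRefl b i * w) := by
      intro e
      rw [← finRefl_mul_cancel b i v, mk_finRefl_mul_eq_iff, eq_comm, QuotientGroup.eq] at e
      have h2 := isPos_inv_smul_of_coset b I h e
      rw [finRefl_mul_inv_smul, isPos_neg_iff] at h2
      exact h2 hv
    rw [genT_mul_finT b k hv, psi_finT, psi_finT, epsT_finRefl_mul b k σ hv,
      Finsupp.single_eq_of_ne h1.symm, Finsupp.single_apply, Finsupp.single_apply, mul_zero,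
      add_zero, mul_ite, mul_zero]
    simp only [mk_finRefl_mul_eq_iff]
  · have h1 : (QuotientGroup.mk v : P.weylGroup ⧸ parGrp b I) ≠ QuotientGroup.mk w := by
      intro e
      rw [eq_comm, QuotientGroup.eq] at e
      exact hv (isPos_inv_smul_of_coset b I h e)
    have h2 : (QuotientGroup.mk (finRefl b i * v) : P.weylGroup ⧸ parGrp b I) ≠
        QuotientGroup.mk (finRefl b i * w) := by
      rwa [Ne, mk_finRefl_mul_eq_iff]
    rw [genT_mul_finT_of_not b k hv, map_add, map_smul, Finsupp.add_apply, Finsupp.smul_apply,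
      psi_finT, psi_finT, Finsupp.single_eq_of_ne h1.symm, Finsupp.single_eq_of_ne h2.symm,
      zero_add, mul_zero, zero_add, smul_eq_mul]

lemma psi_genT_mul {i : b.support} {w : P.weylGroup}
    (h : w⁻¹ • (i : ι) ∈ posOutside b I) {a : Hecke b k} (ha : a ∈ bern b k) :
    psi b I k σ γ (genT b k (some i) * a) (QuotientGroup.mk (finRefl b i * w)) =
      kap b k σ i * psi b I k σ γ a (QuotientGroup.mk w) +
        kdiff b k (some i) * psi b I k σ γ a (QuotientGroup.mk (finRefl b i * w)) := by
  refine bern_ext b k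
    (f := (Finsupp.lapply (QuotientGroup.mk (finRefl b i * w))).comp
      ((psi b I k σ γ).comp (LinearMap.mulLeft ℂ (genT b k (some i)))))
    (g := kap b k σ i • (Finsupp.lapply (QuotientGroup.mk w)).comp (psi b I k σ γ) +
      kdiff b k (some i) •
        (Finsupp.lapply (QuotientGroup.mk (finRefl b i * w))).comp (psi b I k σ γ)) ?_ ha
  intro v x
  have hv := finT_mem_bern b k v
  simp only [LinearMap.comp_apply, LinearMap.mulLeft_apply, LinearMap.add_apply,
    LinearMap.smul_apply, Finsupp.lapply_apply, smul_eq_mul]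
  rw [← mul_assoc, psi_mul_Yel b I k σ γ (mul_mem (genT_mem_bern b k i) hv),
    psi_mul_Yel b I k σ γ hv, Finsupp.smul_apply, Finsupp.smul_apply, Finsupp.smul_apply,
    psi_genT_mul_finT b I k σ h, smul_eq_mul, smul_eq_mul, smul_eq_mul]
  ring

/-- The coefficients of a spherical vector are determined by the coefficient of `v_e`. -/
lemma psi_apply_of_spherical {a : Hecke b k} (ha : a ∈ bern b k)
    (H : ∀ i : b.support, psi b I k σ γ (genT b k (some i) * a) = kap b k σ i • psi b I k σ γ a)
    {u : P.weylGroup} (hu : u ∈ minReps b I) :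
    psi b I k σ γ a (QuotientGroup.mk u) =
      epsT b k σ u ^ 2 * psi b I k σ γ a (QuotientGroup.mk 1) := by
  induction u using weyl_induction b with
  | one => rw [epsT_one, one_pow, one_mul]
  | mul i w hp ih =>
    have hw : w ∈ minReps b I := by
      rw [← finRefl_mul_cancel b i w]
      apply finRefl_mul_mem_minReps b I hu
      rw [finRefl_mul_inv_smul, isPos_neg_iff]
      exact not_not.mpr hp
    have h1 := psi_genT_mul b I k σ (γ := γ) (inv_smul_mem_posOutside b I hu hp) ha
    -- The eigenvector equation at the coset of s_i w reads κ c(s_i w) = κ c(w) + (κ - κ⁻¹) c(s_i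
    -- w), that is c(s_i w) = κ² c(w).
    rw [H i, Finsupp.smul_apply, smul_eq_mul, ih hw, kdiff_eq b k σ] at h1
    rw [epsT_finRefl_mul b k σ hp]
    have hk := kap_ne_zero b k σ i
    field_simp at h1
    linear_combination h1

lemma psi_symmetrizer {u : P.weylGroup} (hu : u ∈ minReps b I) :
    psi b I k σ γ (symmetrizer b I k σ) (QuotientGroup.mk u) = epsT b k σ u ^ 2 := by
  rw [symmetrizer, map_sum, Finsupp.finsetSum_apply, Finset.sum_eq_single u]
  · rw [map_smul, psi_finT, Finsupp.smul_apply, Finsupp.single_eq_same, smul_eq_mul, sq]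
    rfl
  · intro w hw hne
    rw [map_smul, psi_finT, Finsupp.smul_apply, Finsupp.single_eq_of_ne, smul_zero]
    intro e
    rw [QuotientGroup.eq] at e
    exact hne (eq_of_mem_minReps b I hu hw e).symm
  · exact fun h => absurd hu h

lemma symmetrizer_mem_bern : symmetrizer b I k σ ∈ bern b k :=
  sum_mem fun w _ => Subalgebra.smul_mem _ (finT_mem_bern b k w) _

/-! ### The expansion in intertwiners -/

/-- The element `∑ c_w I_w` over the minimal coset representatives. -/
def intSum (γ : Torus P) : Hecke b k :=
  ∑ w ∈ minReps b I, coeffW b I k σ γ w • intertwiner b k w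

lemma intSum_mem_bern : intSum b I k σ γ ∈ bern b k :=
  sum_mem fun w _ => Subalgebra.smul_mem _ (intertwiner_mem_bern b k w) _

/-- The index sets of the two products differ exactly by w⁻¹α_i, the new inversion of s_i w; its
parameter is k_i by invariance. -/
lemma coeffW_eq {i : b.support} {w : P.weylGroup} (hm : finRefl b i * w ∈ minReps b I)
    (hp : b.IsPos (w⁻¹ • (i : ι))) :
    coeffW b I k σ γ w = ((kap b k σ i)⁻¹ - kap b k σ i * tpow γ (corootC P (w⁻¹ • (i : ι)))) *
      coeffW b I k σ γ (finRefl b i * w) := by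
  classical
  have hs : {j ∈ posOutside b I | b.IsPos (w • j)} =
      insert (w⁻¹ • (i : ι)) {j ∈ posOutside b I | b.IsPos ((finRefl b i * w) • j)} := by
    have h1 := invSet_finRefl_mul b hp
    ext j
    have h2 := congrArg (j ∈ ·) h1
    simp only [Finset.mem_cons, mem_invSet, eq_iff_iff] at h2
    rw [Finset.mem_insert, Finset.mem_filter, Finset.mem_filter]
    by_cases hj : j = w⁻¹ • (i : ι)
    · subst hj
      simp only [true_or, iff_true, smul_inv_smul]
      exact ⟨inv_smul_mem_posOutside b I hm hp, isPos_simple b i⟩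
    · simp only [hj, false_or] at h2 ⊢
      refine and_congr_right fun hjo => ?_
      have := isPos_of_mem_posOutside b I hjo
      tauto
  have hn : w⁻¹ • (i : ι) ∉ {j ∈ posOutside b I | b.IsPos ((finRefl b i * w) • j)} := by
    rw [Finset.mem_filter, mul_smul, smul_inv_smul, finRefl_smul_self, isPos_neg_iff]
    exact fun h => h.2 (isPos_simple b i)
  rw [coeffW, coeffW]
  convert Finset.prod_insert hn using 1
  · exact Finset.prod_congr (by rw [← hs]) fun _ _ => rfl
  · rw [kRoot_inv_smul, kap, inv_sgnPow, sgnPow]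

lemma intertwiner_pair_aux {A : Type*} [Ring A] [Algebra ℂ A] {T u v X : A} {c : ℂ}
    (hX : X * v = u * X) :
    (T * (1 - u) + c • u) * X = T * X - T * X * v + c • (X * v) := by
  rw [add_mul, smul_mul_assoc, mul_assoc, sub_mul, one_mul, ← hX, mul_sub, ← mul_assoc]

lemma intertwiner_finRefl_mul_eq {i : b.support} {w : P.weylGroup}
    (hp : b.IsPos (w⁻¹ • (i : ι))) :
    intertwiner b k (finRefl b i * w) =
      genT b k (some i) * intertwiner b k w -
        genT b k (some i) * intertwiner b k w * Yel b k (corootC P (w⁻¹ • (i : ι))) +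
      kdiff b k (some i) • (intertwiner b k w * Yel b k (corootC P (w⁻¹ • (i : ι)))) := by
  rw [intertwiner_finRefl_mul b k hp, simpleInt_eq]
  apply intertwiner_pair_aux
  rw [intertwiner_mul_Yel, wact_corootC, smul_inv_smul]

lemma psi_intertwiner_finRefl_mul {i : b.support} {w : P.weylGroup}
    (hp : b.IsPos (w⁻¹ • (i : ι))) :
    psi b I k σ γ (intertwiner b k (finRefl b i * w)) =
      (1 - tpow γ (corootC P (w⁻¹ • (i : ι)))) •
        psi b I k σ γ (genT b k (some i) * intertwiner b k w) +
      (kdiff b k (some i) * tpow γ (corootC P (w⁻¹ • (i : ι)))) •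
        psi b I k σ γ (intertwiner b k w) := by
  have hI := intertwiner_mem_bern b k w
  rw [intertwiner_finRefl_mul_eq b k hp, map_add, map_sub, map_smul, psi_mul_Yel b I k σ γ hI,
    psi_mul_Yel b I k σ γ (mul_mem (genT_mem_bern b k i) hI)]
  module

lemma psi_genT_mul_genT_mul (i : b.support) (a : Hecke b k) :
    psi b I k σ γ (genT b k (some i) * (genT b k (some i) * a)) =
      kdiff b k (some i) • psi b I k σ γ (genT b k (some i) * a) + psi b I k σ γ a := by
  rw [← mul_assoc, genT_mul_self, add_mul, smul_mul_assoc, one_mul, map_add, map_smul]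

lemma psi_genT_mul_intertwiner {i : b.support} {w : P.weylGroup}
    (hp : b.IsPos (w⁻¹ • (i : ι))) :
    psi b I k σ γ (genT b k (some i) * intertwiner b k (finRefl b i * w)) =
      kdiff b k (some i) • psi b I k σ γ (genT b k (some i) * intertwiner b k w) +
      (1 - tpow γ (corootC P (w⁻¹ • (i : ι)))) • psi b I k σ γ (intertwiner b k w) := by
  have hI := intertwiner_mem_bern b k w
  have hT := genT_mem_bern b k i
  rw [intertwiner_finRefl_mul_eq b k hp, mul_add, mul_sub, mul_smul_comm,
    ← mul_assoc _ _ (Yel b k _), ← mul_assoc _ _ (Yel b k _), map_add, map_sub, map_smul,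
    psi_mul_Yel b I k σ γ (mul_mem hT hI),
    psi_mul_Yel b I k σ γ (mul_mem hT (mul_mem hT hI)), psi_genT_mul_genT_mul]
  module

/-- The contribution of `w` to `T_i ∑ c_w I_w - ε(T_i) ∑ c_w I_w`. -/
def defect (γ : Torus P) (i : b.support) (w : P.weylGroup) : P.weylGroup ⧸ parGrp b I →₀ ℂ :=
  coeffW b I k σ γ w • (psi b I k σ γ (genT b k (some i) * intertwiner b k w) -
    kap b k σ i • psi b I k σ γ (intertwiner b k w))

/-- Both T_i I_{s_i w} and I_{s_i w} are combinations of T_i I_w and I_w after evaluation at γ; the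
coefficient recursion is designed so that the total vanishes. -/
lemma defect_add_defect {i : b.support} {w : P.weylGroup}
    (hm : finRefl b i * w ∈ minReps b I) (hp : b.IsPos (w⁻¹ • (i : ι))) :
    defect b I k σ γ i w + defect b I k σ γ i (finRefl b i * w) = 0 := by
  rw [defect, defect, psi_genT_mul_intertwiner b I k σ hp, psi_intertwiner_finRefl_mul b I k σ hp,
    coeffW_eq b I k σ hm hp, kdiff_eq b k σ]
  have hk := mul_inv_cancel₀ (kap_ne_zero b k σ i)
  set κ := kap b k σ i
  set κ' := κ⁻¹
  set x := tpow γ (corootC P (w⁻¹ • (i : ι)))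
  set c := coeffW b I k σ γ (finRefl b i * w)
  set t := psi b I k σ γ (genT b k (some i) * intertwiner b k w)
  set a := psi b I k σ γ (intertwiner b k w)
  -- The coefficient of `t` cancels identically, and that of `a` collapses to a multiple of 1 - κ
  -- κ⁻¹.
  have h1 : ((κ' - κ * x) * c) • (t - κ • a) +
      c • ((κ - κ') • t + (1 - x) • a - κ • ((1 - x) • t + ((κ - κ') * x) • a)) =
      (c * (1 - κ * κ') * (1 - x)) • a := by
    module
  rw [h1, hk, sub_self, mul_zero, zero_mul, zero_smul]

/-- Here s_i w = w s_j with j ∈ I, so T_i moves through I_w to become T_j, which acts on v_e by the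
same scalar κ. -/
lemma defect_eq_zero (hγ : γ ∈ torusI b I k σ) {i : b.support} {w : P.weylGroup}
    (hw : w ∈ minReps b I) (hm : finRefl b i * w ∉ minReps b I) :
    defect b I k σ γ i w = 0 := by
  obtain ⟨j, hj, e⟩ := exists_smul_eq_of_notMem b I hw hm
  rw [defect, genT_mul_intertwiner b k e, psi_mul_genT b I k σ hγ hj (intertwiner_mem_bern b k w),
    kap, kSimple_eq_of_smul b k e, ← kap, sub_self, smul_zero]

lemma psi_genT_mul_intSum (hγ : γ ∈ torusI b I k σ) (i : b.support) :
    psi b I k σ γ (genT b k (some i) * intSum b I k σ γ) =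
      kap b k σ i • psi b I k σ γ (intSum b I k σ γ) := by
  classical
  have h : ∑ w ∈ minReps b I, defect b I k σ γ i w = 0 := by
    -- The involution pairs w with s_i w when the latter is again a minimal representative and fixes
    -- w otherwise; a fixed w has zero defect.
    refine Finset.sum_involution
      (fun w _ => if finRefl b i * w ∈ minReps b I then finRefl b i * w else w) ?_ ?_ ?_ ?_
    · intro w hw
      split_ifs with hm
      · by_cases hp : b.IsPos (w⁻¹ • (i : ι))
        · exact defect_add_defect b I k σ hm hp
        · have := defect_add_defect b I k σ (γ := γ) (i := i) (w := finRefl b i * w)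
            (by rwa [finRefl_mul_cancel]) (isPos_finRefl_mul_inv b hp)
          rwa [finRefl_mul_cancel, add_comm] at this
      · rw [defect_eq_zero b I k σ hγ hw hm, add_zero]
    · intro w hw hne
      split_ifs with hm
      · intro e
        have h1 : finRefl b i = 1 := mul_eq_right.mp e
        have h2 : b.IsPos (finRefl b i • (i : ι)) := by
          rw [h1, one_smul]; exact isPos_simple b i
        rw [finRefl_smul_self, isPos_neg_iff] at h2
        exact h2 (isPos_simple b i)
      · exact absurd (defect_eq_zero b I k σ hγ hw hm) hne
    · intro w hw
      split_ifs with hm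
      · exact hm
      · exact hw
    · intro w hw
      by_cases hm : finRefl b i * w ∈ minReps b I
      · simp only [if_pos hm, finRefl_mul_cancel, if_pos hw]
      · simp only [if_neg hm]
  rw [← sub_eq_zero, ← h, intSum, Finset.mul_sum, map_sum, map_sum, Finset.smul_sum,
    ← Finset.sum_sub_distrib]
  refine Finset.sum_congr rfl fun w _ => ?_
  rw [defect, mul_smul_comm, map_smul, map_smul]
  module

/-! ### The leading coefficient -/

/-- A minimal representative is shortest in its coset, so shorter T_v Y^λ cannot contribute there.
This discards all lower terms of the intertwiners. -/
lemma psi_apply_eq_zero {n : ℕ} {a : Hecke b k} (ha : a ∈ lenFil b k n) {u : P.weylGroup}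
    (hu : u ∈ minReps b I) (hn : n ≤ finLen b u) :
    psi b I k σ γ a (QuotientGroup.mk u) = 0 := by
  induction ha using Submodule.span_induction with
  | mem a hm =>
    obtain ⟨v, y, hv, rfl⟩ := hm
    rw [← yHom_eX, psi_finT_mul_yHom, Finsupp.single_eq_of_ne]
    intro e
    rw [QuotientGroup.eq] at e
    have := finLen_le_of_coset b I hu e
    omega
  | zero => rw [map_zero, Finsupp.zero_apply]
  | add h h' _ _ h1 h2 => rw [map_add, Finsupp.add_apply, h1, h2, add_zero]
  | smul c h _ h1 => rw [map_smul, Finsupp.smul_apply, h1, smul_zero]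

lemma psi_intertwiner_apply {u w : P.weylGroup} (hu : u ∈ minReps b I)
    (hwu : finLen b w ≤ finLen b u) :
    psi b I k σ γ (intertwiner b k w) (QuotientGroup.mk u) =
      Finsupp.single (QuotientGroup.mk w) (epsT b k σ w * evalT γ (qInv b w))
        (QuotientGroup.mk u : P.weylGroup ⧸ parGrp b I) := by
  have h := psi_apply_eq_zero b I k σ (γ := γ) (isIntertwiner_intertwiner b k w).sub_mem hu hwu
  rw [map_sub, Finsupp.sub_apply, sub_eq_zero, psi_finT_mul_yHom] at h
  exact h

lemma psi_intSum_longest {u : P.weylGroup} (hu : u ∈ minReps b I)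
    (hmax : ∀ w ∈ minReps b I, finLen b w ≤ finLen b u) (hinv : invSet b u = posOutside b I) :
    psi b I k σ γ (intSum b I k σ γ) (QuotientGroup.mk u) =
      epsT b k σ u * ∏ i ∈ posOutside b I, (1 - tpow γ (corootC P i)) := by
  classical
  rw [intSum, map_sum, Finsupp.finsetSum_apply, Finset.sum_eq_single u]
  -- The longest u makes every root outside R₀^I negative, so the product defining its coefficient
  -- is empty.
  · have h1 : coeffW b I k σ γ u = 1 := by
      rw [coeffW, Finset.filter_eq_empty_iff.mpr, Finset.prod_empty]
      intro i hi
      rw [← hinv, mem_invSet] at hi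
      exact hi.2
    have h2 : evalT γ (qInv b u) = ∏ i ∈ posOutside b I, (1 - tpow γ (corootC P i)) := by
      rw [qInv, hinv, map_prod]
      refine Finset.prod_congr rfl fun i _ => ?_
      rw [map_sub, map_one, evalT_eX]
    rw [map_smul, Finsupp.smul_apply, psi_intertwiner_apply b I k σ hu le_rfl, h1, one_smul,
      Finsupp.single_eq_same, h2]
  · intro w hw hne
    rw [map_smul, Finsupp.smul_apply, psi_intertwiner_apply b I k σ hu (hmax w hw),
      Finsupp.single_eq_of_ne, smul_zero]
    intro e
    rw [QuotientGroup.eq] at e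
    exact hne (eq_of_mem_minReps b I hu hw e).symm
  · exact fun h => absurd hu h

/-- Every coset has a minimal representative w, where both sides have coefficient ε(T_w)² times
their coefficient at v_e. The latter equals 1 for the symmetrizer, and for the intertwiner sum it is
found by reading its value at the longest u backwards through the same factor. -/
theorem psi_symmetrizer_eq (hγ : γ ∈ torusI b I k σ)
    (hreg : ∀ i ∈ posOutside b I, tpow γ (corootC P i) ≠ 1) :
    psi b I k σ γ (symmetrizer b I k σ) =
      coeff0 b I k σ γ • psi b I k σ γ (intSum b I k σ γ) := by
  obtain ⟨u, hu, hmax, hinv⟩ := exists_longest b I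
  have hsph {w : P.weylGroup} (hw : w ∈ minReps b I) :=
    psi_apply_of_spherical b I k σ (intSum_mem_bern b I k σ (γ := γ))
      (psi_genT_mul_intSum b I k σ hγ) hw
  have h1 := psi_intSum_longest b I k σ (γ := γ) hu hmax hinv
  rw [hsph hu] at h1
  have hp : ∏ i ∈ posOutside b I, (1 - tpow γ (corootC P i)) ≠ 0 :=
    Finset.prod_ne_zero_iff.mpr fun i hi => sub_ne_zero.mpr (hreg i hi).symm
  have h2 : coeff0 b I k σ γ =
      epsT b k σ u / ∏ i ∈ posOutside b I, (1 - tpow γ (corootC P i)) := by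
    rw [coeff0, Finset.prod_div_distrib, epsT_eq_prod, hinv]
  have h3 : coeff0 b I k σ γ * psi b I k σ γ (intSum b I k σ γ) (QuotientGroup.mk 1) = 1 := by
    have he := epsT_ne_zero b k σ u
    have h4 : epsT b k σ u * psi b I k σ γ (intSum b I k σ γ) (QuotientGroup.mk 1) =
        ∏ i ∈ posOutside b I, (1 - tpow γ (corootC P i)) := by
      apply mul_left_cancel₀ he
      rw [← h1]
      ring
    rw [h2, div_mul_eq_mul_div, h4, div_self hp]
  ext C
  obtain ⟨v, rfl⟩ := QuotientGroup.mk_surjective C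
  obtain ⟨w, hw, hwv⟩ := exists_minRep b I v
  rw [← QuotientGroup.eq.mpr hwv, psi_symmetrizer b I k σ hw, Finsupp.smul_apply, hsph hw,
    smul_eq_mul, mul_left_comm, h3, mul_one]

theorem symmetrizer_sub_mem_indIdeal (hγ : γ ∈ torusI b I k σ)
    (hreg : ∀ i ∈ posOutside b I, tpow γ (corootC P i) ≠ 1) {χ : parabolic b I k →ₐ[ℂ] ℂ}
    (hχ : IsChi b I k σ γ χ) :
    symmetrizer b I k σ - coeff0 b I k σ γ • intSum b I k σ γ ∈ indIdeal b I k χ := by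
  apply mem_indIdeal_of_psi_eq_zero b I k σ hχ
  · exact sub_mem (symmetrizer_mem_bern b I k σ)
      (Subalgebra.smul_mem _ (intSum_mem_bern b I k σ) _)
  · rw [map_sub, map_smul, psi_symmetrizer_eq b I k σ hγ hreg, sub_self]

/-- The annihilator of m in H(k) is a left ideal containing all h - χ(h), so it contains the
difference of the two elements. -/
theorem symmetrizer_smul_eq (hγ : γ ∈ torusI b I k σ)
    (hreg : ∀ i ∈ posOutside b I, tpow γ (corootC P i) ≠ 1) {χ : parabolic b I k →ₐ[ℂ] ℂ}
    (hχ : IsChi b I k σ γ χ) {M : Type*} [AddCommGroup M] [Module ℂ M] [Module (Hecke b k) M]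
    [IsScalarTower ℂ (Hecke b k) M] (m : M)
    (hm : ∀ h : parabolic b I k, (h : Hecke b k) • m = χ h • m) :
    symmetrizer b I k σ • m =
      coeff0 b I k σ γ • ∑ w ∈ minReps b I, coeffW b I k σ γ w • (intertwiner b k w • m) := by
  have h1 : indIdeal b I k χ ≤ LinearMap.ker (LinearMap.toSpanSingleton (Hecke b k) M m) := by
    rw [indIdeal, Submodule.span_le]
    rintro _ ⟨h, rfl⟩
    change ((h : Hecke b k) - algebraMap ℂ (Hecke b k) (χ h)) • m = 0
    rw [sub_smul, hm, algebraMap_smul, sub_self]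
  have h2 : (symmetrizer b I k σ - coeff0 b I k σ γ • intSum b I k σ γ) • m = 0 :=
    h1 (symmetrizer_sub_mem_indIdeal b I k σ hγ hreg hχ)
  rw [sub_smul, sub_eq_zero, smul_assoc, intSum, Finset.sum_smul] at h2
  simpa only [smul_assoc] using h2

lemma parabolic_smul_vE {χ : parabolic b I k →ₐ[ℂ] ℂ} (h : parabolic b I k) :
    (h : Hecke b k) • vE b I k χ = χ h • vE b I k χ := by
  have h1 := indMk_mul b I k (χ := χ) 1 h
  rw [one_mul] at h1
  rw [show vE b I k χ = indMk b I k χ 1 from rfl, ← h1]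
  change (h : Hecke b k) • Submodule.Quotient.mk 1 = Submodule.Quotient.mk _
  rw [← Submodule.Quotient.mk_smul, smul_eq_mul, mul_one]

end AffHecke

end

/-! ### The character and the expansion of the (anti)spherical vector. -/

open AffHecke in
theorem mainTheorem5 {ι V N : Type*} [Finite ι] [AddCommGroup V] [Module ℝ V]
    [AddCommGroup N] [Module ℝ N] (P : RootPairing ι ℝ V N) [P.IsRootSystem]
    [P.IsCrystallographic] [P.IsReduced] [P.IsIrreducible] (b : P.Base)
    (k : Mult P) (σ : ℤˣ) (I : Set b.support) (γ : Torus P) (hγ : γ ∈ torusI b I k σ)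
    (hreg : ∀ i ∈ posOutside b I, tpow γ (corootC P i) ≠ 1) :
    (∃! χ : parabolic b I k →ₐ[ℂ] ℂ, IsChi b I k σ γ χ) ∧
    ∀ χ : parabolic b I k →ₐ[ℂ] ℂ, IsChi b I k σ γ χ →
      (∀ (M : Type*) [AddCommGroup M] [Module ℂ M] [Module (Hecke b k) M]
        [IsScalarTower ℂ (Hecke b k) M] (m : M),
        (∀ h : parabolic b I k, (h : Hecke b k) • m = χ h • m) →
        symmetrizer b I k σ • m =
          coeff0 b I k σ γ • ∑ w ∈ minReps b I, coeffW b I k σ γ w • (intertwiner b k w • m)) ∧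
      sphVec b I k σ χ =
        coeff0 b I k σ γ • ∑ w ∈ minReps b I, coeffW b I k σ γ w • bVec b I k χ w := by
  refine ⟨existsUnique_isChi b I k σ hγ, fun χ hχ => ⟨?_, ?_⟩⟩
  · intro M _ _ _ _ m hm
    exact symmetrizer_smul_eq b I k σ hγ hreg hχ m hm
  · exact symmetrizer_smul_eq b I k σ hγ hreg hχ (vE b I k χ) (parabolic_smul_vE b I k)
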